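/- Let $G$ be a (Hausdorff) locally compact group with a left Haar measure $dx$, and let $\omega:G\to[1,\infty)$ be a weight function, i.e. $\omega$ is continuous, $\omega(xy)\le\omega(x)\omega(y)$ for all $x,y\in G$, and $\omega(e)=1$. As usual, "almost everywhere" refers to locally null sets (of $G$, $G\times G$, $G\times G\times G$ with their Haar measures), and functions that agree almost everywhere are identified. Let $L^1(G,\omega)$ be the Banach algebra of Borel functions $f:G\to\mathbb C$ with $\|f\|_\omega=\int_G|f|\,\omega\,dx<\infty$, under the convolution $(f*g)(x)=\int_G f(y)g(y^{-1}x)\,dy$. Let $L^\infty(G,1/\omega)$ be the space of Borel functions $h$ with $\|h\|=\|h/\omega\|_\infty<\infty$, identified with $L^1(G,\omega)^*$ by $\langle h,f\rangle=\int_G f(x)h(x)\,dx$. It is a bimodule over $L^1(G,\omega)$ by $\langle a\cdot h,c\rangle=\langle h,c*a\rangle$ and $\langle h\cdot a,c\rangle=\langle h,a*c\rangle$. Let $\mathcal Z$ be the space of bounded derivations $D:L^1(G,\omega)\to L^\infty(G,1/\omega)$, i.e. bounded linear maps with $D(a*b)=D(a)\cdot b+a\cdot D(b)$, with the operator norm.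 Let $\mathcal I_{nn}\subseteq\mathcal Z$ be the set of inner derivations $a\mapsto h\cdot a-a\cdot h$, $h\in L^\infty(G,1/\omega)$. Let $D(G,\omega)$ be the space of Borel functions $p:G\times G\to\mathbb C$ that are quasi-additive, i.e. $$p(xy,z)=p(x,yz)+p(y,zx)\quad\text{for almost all }x,y,z\in G,$$ and satisfy $\sup_{x,y}\frac{|p(x,y)|}{\omega(x)\omega(y)}<\infty$. It is normed by the essential supremum of $\frac{|p(x,y)|}{\omega(x)\omega(y)}$, i.e. it is a subspace of $L^\infty(G\times G,1/(\omega\otimes\omega))$. Let $I(G,\omega)\subseteq D(G,\omega)$ be the set of those $p$ for which there is $h\in L^\infty(G,1/\omega)$ with $p(x,y)=h(xy)-h(yx)$ for almost all $x,y$. **Theorem.** (i) $D(G,\omega)$ is a Banach space, and there is an isometric linear isomorphism $\Gamma$ of $\mathcal Z$ onto $D(G,\omega)$ such that, for every $D\in\mathcal Z$, $p=\Gamma(D)$ is the only element of $D(G,\omega)$ with $$\langle D(f),g\rangle=\int_G\int_G p(x,y)f(x)g(y)\,dx\,dy\qquad\text{for all } f,g\in L^1(G,\omega).$$ (ii) $\Gamma(\mathcal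 I_{nn})=I(G,\omega)$. (iii) For every $D\in\mathcal Z$ there is a unique $p\in D(G,\omega)$ such that, for every $f\in L^1(G,\omega)$, $D(f)(x)=\int_G p(y,x)f(y)\,dy$ for almost every $x\in G$. (iv) If $\omega$ is multiplicative, i.e. $\omega(xy)=\omega(x)\omega(y)$ for all $x,y$, then $D(G,\omega)=I(G,\omega)$. In particular, $D(G,1)=I(G,1)$. -/

import Mathlib

open MeasureTheory MeasureTheory.Measure TopologicalSpace
open scoped ENNReal

namespace Beurling

noncomputable section

/-! ### Inner regular Haar measure -/

section RadonHaar

variable (H : Type*) [Group H] [TopologicalSpace H] [IsTopologicalGroup H]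
  [LocallyCompactSpace H] [MeasurableSpace H] [BorelSpace H]

/-- The inner regular left Haar measure `E ↦ sup {haar (E ∩ K) : K compact}` of a locally compact
group. Its null sets are the locally null sets, i.e. the sets meeting every compact set in a
null set; for a `σ`-compact group it is the usual Haar measure. -/
def radonHaar [T2Space H] : Measure H :=
  Measure.ofMeasurable (fun E _ => ⨆ K : Compacts H, (haar : Measure H) (E ∩ K)) (by simp) (by
    intro f hf hd
    have key : ∀ K : Compacts H, (haar : Measure H) ((⋃ i, f i) ∩ K)
        = ∑' i, (haar : Measure H) (f i ∩ K) := by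
      intro K
      rw [Set.iUnion_inter]
      refine measure_iUnion (fun i j hij => ?_)
        (fun i => (hf i).inter K.isCompact.measurableSet)
      exact (hd hij).mono Set.inter_subset_left Set.inter_subset_left
    simp_rw [key]
    apply le_antisymm
    · exact iSup_le fun K => ENNReal.tsum_le_tsum fun i =>
        le_iSup (fun K : Compacts H => (haar : Measure H) (f i ∩ K)) K
    · rw [ENNReal.tsum_eq_iSup_sum]
      refine iSup_le fun s => ?_
      rw [ENNReal.finsetSum_iSup]
      · exact iSup_mono fun K => ENNReal.sum_le_tsum s
      · intro K L
        exact ⟨K ⊔ L, fun i => ⟨measure_mono (Set.inter_subset_inter_right _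
          (by simp)), measure_mono (Set.inter_subset_inter_right _ (by simp))⟩⟩)

variable {H}
variable [T2Space H]

theorem radonHaar_apply {E : Set H} (hE : MeasurableSet E) :
    radonHaar H E = ⨆ K : Compacts H, (haar : Measure H) (E ∩ K) := by
  rw [radonHaar, Measure.ofMeasurable_apply _ hE]

theorem radonHaar_compact {K : Set H} (hK : IsCompact K) :
    radonHaar H K = (haar : Measure H) K := by
  rw [radonHaar_apply hK.measurableSet]
  apply le_antisymm
  · exact iSup_le fun L => measure_mono Set.inter_subset_left
  · refine le_trans ?_ (le_iSup (fun L : Compacts H => (haar : Measure H) (K ∩ L)) ⟨K, hK⟩)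
    simp

instance : IsFiniteMeasureOnCompacts (radonHaar H) where
  lt_top_of_isCompact K hK := by rw [radonHaar_compact hK]; exact hK.measure_lt_top

instance : (radonHaar H).IsMulLeftInvariant where
  map_mul_left_eq_self g := by
    ext E hE
    rw [Measure.map_apply (measurable_const_mul g) hE, radonHaar_apply hE,
      radonHaar_apply (measurable_const_mul g hE)]
    have h1 : ∀ K : Set H, (haar : Measure H) ((fun x => g * x) ⁻¹' E ∩ K)
        = (haar : Measure H) (E ∩ (fun x => g⁻¹ * x) ⁻¹' K) := by
      intro K
      rw [← measure_preimage_mul (haar : Measure H) g (E ∩ (fun x => g⁻¹ * x) ⁻¹' K)]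
      congr 1
      ext x
      simp
    apply le_antisymm
    · refine iSup_le fun K => ?_
      rw [h1]
      refine le_iSup (fun K : Compacts H => (haar : Measure H) (E ∩ K))
        ⟨(fun x => g⁻¹ * x) ⁻¹' (K : Set H), ?_⟩
      exact (Homeomorph.mulLeft g⁻¹).isCompact_preimage.2 K.isCompact
    · refine iSup_le fun K => ?_
      have h2 : (K : Set H) = (fun x => g⁻¹ * x) ⁻¹' ((fun x => g * x) ⁻¹' (K : Set H)) := by
        ext x; simp
      rw [h2, ← h1]
      refine le_iSup (fun L : Compacts H => (haar : Measure H) ((fun x => g * x) ⁻¹' E ∩ L))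
        ⟨(fun x => g * x) ⁻¹' (K : Set H), ?_⟩
      exact (Homeomorph.mulLeft g).isCompact_preimage.2 K.isCompact

instance : (radonHaar H).IsOpenPosMeasure where
  open_pos U hU hne := by
    obtain ⟨x, hx⟩ := hne
    obtain ⟨K, hK, hxK, hKU⟩ := exists_compact_subset hU hx
    intro h0
    have h1 : radonHaar H K = 0 := measure_mono_null hKU h0
    rw [radonHaar_compact hK] at h1
    exact (measure_pos_of_mem_nhds (haar : Measure H)
      (mem_interior_iff_mem_nhds.1 hxK)).ne' h1

instance : (radonHaar H).IsHaarMeasure where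

instance : (radonHaar H).InnerRegular where
  innerRegular E hE r hr := by
    rw [radonHaar_apply hE] at hr
    obtain ⟨L, hL⟩ := lt_iSup_iff.1 hr
    obtain ⟨K, hKE, hK, hrK⟩ := (hE.inter L.isCompact.measurableSet).exists_lt_isCompact_of_ne_top
      ((measure_mono Set.inter_subset_right).trans_lt L.isCompact.measure_lt_top).ne hL
    exact ⟨K, hKE.trans Set.inter_subset_left, hK, by rwa [radonHaar_compact hK]⟩

end RadonHaar

/-! ### Powers of `G` with their Borel `σ`-algebra -/

/-- A copy of `X` which carries the Borel `σ`-algebra of its topology. It is used for `G × G` and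
`G × G × G`, whose Borel `σ`-algebra may be larger than the product `σ`-algebra. -/
def WithBorel (X : Type*) : Type _ := X

namespace WithBorel

variable {X : Type*}

/-- A point of `X`, seen in the copy. -/
def mk (x : X) : WithBorel X := x

/-- A point of the copy, seen in `X`. -/
def out (x : WithBorel X) : X := x

instance [Group X] : Group (WithBorel X) := inferInstanceAs (Group X)
instance [TopologicalSpace X] : TopologicalSpace (WithBorel X) :=
  inferInstanceAs (TopologicalSpace X)
instance [Group X] [TopologicalSpace X] [IsTopologicalGroup X] :
    IsTopologicalGroup (WithBorel X) := inferInstanceAs (IsTopologicalGroup X)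
instance [TopologicalSpace X] [LocallyCompactSpace X] : LocallyCompactSpace (WithBorel X) :=
  inferInstanceAs (LocallyCompactSpace X)
instance [TopologicalSpace X] [T2Space X] : T2Space (WithBorel X) :=
  inferInstanceAs (T2Space X)
instance [TopologicalSpace X] : MeasurableSpace (WithBorel X) := borel (WithBorel X)
instance [TopologicalSpace X] : BorelSpace (WithBorel X) := ⟨rfl⟩

theorem continuous_out [TopologicalSpace X] : Continuous (out : WithBorel X → X) :=
  continuous_id

end WithBorel

/-! ### Weighted Lebesgue spaces -/

/-- A strictly positive continuous function, by which the functions of a weighted space are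
multiplied. -/
structure PosFun (X : Type*) [TopologicalSpace X] where
  toFun : X → ℝ
  continuous : Continuous toFun
  pos : ∀ x, 0 < toFun x

section WeightedLp

variable {X : Type*} [TopologicalSpace X] [MeasurableSpace X]

/-- The functions `f` (modulo equality almost everywhere) such that `v f ∈ L^r(m)`. -/
def weightedLpSubmodule (r : ℝ≥0∞) (v : PosFun X) (m : Measure X) :
    Submodule ℂ (X →ₘ[m] ℂ) where
  carrier := {f | MemLp (fun x => (v.toFun x : ℂ) * f x) r m}
  add_mem' {f g} hf hg := by
    refine (MemLp.add hf hg).ae_eq ?_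
    filter_upwards [AEEqFun.coeFn_add f g] with x e
    simp [e, mul_add]
  zero_mem' := by
    refine (MemLp.zero (ε := ℂ)).ae_eq ?_
    filter_upwards [AEEqFun.coeFn_zero (β := ℂ) (μ := m)] with x e
    simp [e]
  smul_mem' c f hf := by
    refine (MemLp.const_smul hf c).ae_eq ?_
    filter_upwards [AEEqFun.coeFn_smul c f] with x e
    simp only [e, Pi.smul_apply, smul_eq_mul]
    ring

/-- The space of all `f` with `v f ∈ L^r(m)`, with the norm `‖v f‖_r`. -/
def WeightedLp (r : ℝ≥0∞) (v : PosFun X) (m : Measure X) : Type _ :=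
  weightedLpSubmodule r v m

namespace WeightedLp

variable (r : ℝ≥0∞) (v : PosFun X) (m : Measure X)

instance : AddCommGroup (WeightedLp r v m) :=
  inferInstanceAs (AddCommGroup (weightedLpSubmodule r v m))
instance : Module ℂ (WeightedLp r v m) :=
  inferInstanceAs (Module ℂ (weightedLpSubmodule r v m))

variable {r v m}

/-- The underlying class of functions. -/
def toAE (f : WeightedLp r v m) : X →ₘ[m] ℂ :=
  ((show weightedLpSubmodule r v m from f) : X →ₘ[m] ℂ)

instance : CoeFun (WeightedLp r v m) (fun _ => X → ℂ) := ⟨fun f => (toAE f : X → ℂ)⟩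

theorem memLp (f : WeightedLp r v m) : MemLp (fun x => (v.toFun x : ℂ) * f x) r m :=
  (show weightedLpSubmodule r v m from f).2

theorem coeFn_add (f g : WeightedLp r v m) : (f + g : WeightedLp r v m) =ᵐ[m]
    fun x => f x + g x :=
  AEEqFun.coeFn_add (toAE f) (toAE g)

theorem coeFn_smul (c : ℂ) (f : WeightedLp r v m) : (c • f : WeightedLp r v m) =ᵐ[m]
    fun x => c * f x :=
  AEEqFun.coeFn_smul c (toAE f)

theorem coeFn_zero : (0 : WeightedLp r v m) =ᵐ[m] fun _ => (0 : ℂ) :=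
  AEEqFun.coeFn_zero

@[ext]
theorem ext {f g : WeightedLp r v m} (h : f =ᵐ[m] g) : f = g :=
  Subtype.ext (AEEqFun.ext h)

variable (r v m) in
/-- The map `f ↦ v f` into `L^r(m)`. -/
def toLp : WeightedLp r v m →ₗ[ℂ] Lp ℂ r m where
  toFun f := f.memLp.toLp
  map_add' f g := by
    refine Lp.ext ?_
    filter_upwards [(f + g).memLp.coeFn_toLp, f.memLp.coeFn_toLp, g.memLp.coeFn_toLp,
      Lp.coeFn_add f.memLp.toLp g.memLp.toLp, coeFn_add f g] with x e1 e2 e3 e4 e5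
    rw [e1, e4, Pi.add_apply, e2, e3, e5, mul_add]
  map_smul' c f := by
    refine Lp.ext ?_
    filter_upwards [(c • f).memLp.coeFn_toLp, f.memLp.coeFn_toLp,
      Lp.coeFn_smul c f.memLp.toLp, coeFn_smul c f] with x e1 e2 e3 e4
    rw [e1, RingHom.id_apply, e3, Pi.smul_apply, e2, e4, smul_eq_mul]
    ring

theorem coeFn_toLp (f : WeightedLp r v m) :
    toLp r v m f =ᵐ[m] fun x => (v.toFun x : ℂ) * f x :=
  f.memLp.coeFn_toLp

theorem toLp_injective : Function.Injective (toLp r v m) := by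
  intro f g h
  apply ext
  have h1 := coeFn_toLp f
  rw [h] at h1
  filter_upwards [h1, coeFn_toLp g] with x h1 h2
  rw [h2] at h1
  exact (mul_left_cancel₀ (Complex.ofReal_ne_zero.2 (v.pos x).ne') h1).symm

instance [Fact (1 ≤ r)] : NormedAddCommGroup (WeightedLp r v m) :=
  NormedAddCommGroup.induced _ _ (toLp r v m) toLp_injective
instance [Fact (1 ≤ r)] : NormedSpace ℂ (WeightedLp r v m) :=
  NormedSpace.induced ℂ _ _ (toLp r v m)

/-- The class of a function. -/
def mk (f : X → ℂ) (hf : MemLp (fun x => (v.toFun x : ℂ) * f x) r m)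
    (hf' : AEStronglyMeasurable f m) : WeightedLp r v m :=
  (⟨AEEqFun.mk f hf', hf.ae_eq (by
    filter_upwards [AEEqFun.coeFn_mk f hf'] with x e
    rw [e])⟩ : weightedLpSubmodule r v m)

theorem coeFn_mk (f : X → ℂ) (hf : MemLp (fun x => (v.toFun x : ℂ) * f x) r m)
    (hf' : AEStronglyMeasurable f m) : mk f hf hf' =ᵐ[m] f :=
  AEEqFun.coeFn_mk f hf'

end WeightedLp

end WeightedLp

/-! ### Weights and Beurling algebras -/

/-- A weight function on `G`: a continuous submultiplicative function `ω : G → [1, ∞)` with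
`ω(e) = 1`. -/
structure Weight (G : Type*) [Group G] [TopologicalSpace G] where
  toFun : G → ℝ
  continuous : Continuous toFun
  one_le : ∀ x, 1 ≤ toFun x
  map_mul_le : ∀ x y, toFun (x * y) ≤ toFun x * toFun y
  map_one : toFun 1 = 1

namespace Weight

variable {G : Type*} [Group G] [TopologicalSpace G]

instance : CoeFun (Weight G) (fun _ => G → ℝ) := ⟨Weight.toFun⟩

theorem pos (ω : Weight G) (x : G) : 0 < ω x := one_pos.trans_le (ω.one_le x)

/-- The constant weight `1`. -/
def const (G : Type*) [Group G] [TopologicalSpace G] : Weight G :=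
  ⟨fun _ => 1, continuous_const, fun _ => le_rfl, fun _ _ => by simp, rfl⟩

/-- `ω(xy) = ω(x) ω(y)` for all `x`, `y`. -/
def IsMultiplicative (ω : Weight G) : Prop := ∀ x y, ω (x * y) = ω x * ω y

/-- The function `ω`. -/
def fn (ω : Weight G) : PosFun G := ⟨ω, ω.continuous, ω.pos⟩

/-- The function `1/ω`. -/
def inv (ω : Weight G) : PosFun G :=
  ⟨fun x => (ω x)⁻¹, ω.continuous.inv₀ fun x => (ω.pos x).ne', fun x => inv_pos.2 (ω.pos x)⟩

/-- The function `1/ω^⊗` on `G × G`, where `ω^⊗(x, y) = ω(x) ω(y)`. -/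
def tensorInv (ω : Weight G) : PosFun (WithBorel (G × G)) where
  toFun q := (ω q.out.1 * ω q.out.2)⁻¹
  continuous := ((ω.continuous.comp (continuous_fst.comp WithBorel.continuous_out)).mul
    (ω.continuous.comp (continuous_snd.comp WithBorel.continuous_out))).inv₀
      fun q => (mul_pos (ω.pos q.out.1) (ω.pos q.out.2)).ne'
  pos q := inv_pos.2 (mul_pos (ω.pos q.out.1) (ω.pos q.out.2))

end Weight

section Algebra

variable {G : Type*} [Group G] [TopologicalSpace G] [MeasurableSpace G]

/-- `L^1(G, ω)`, with the norm `‖ω f‖_1`. -/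
abbrev L1 (μ : Measure G) (ω : Weight G) : Type _ := WeightedLp 1 ω.fn μ

/-- `L^∞(G, 1/ω)`, with the norm `‖h/ω‖_∞`. -/
abbrev LInf (μ : Measure G) (ω : Weight G) : Type _ := WeightedLp ∞ ω.inv μ

/-- The duality `⟨h, f⟩ = ∫ f(x) h(x) dx` between `L^∞(G, 1/ω)` and `L^1(G, ω)`. -/
def pair {μ : Measure G} {ω : Weight G} (h : LInf μ ω) (f : L1 μ ω) : ℂ :=
  ∫ x, f x * h x ∂μ

/-- The convolution `(f * g)(x) = ∫ f(y) g(y⁻¹x) dy`. -/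
def convolve (μ : Measure G) (f g : G → ℂ) (x : G) : ℂ :=
  ∫ y, f y * g (y⁻¹ * x) ∂μ

open Classical in
/-- The convolution product of `L^1(G, ω)`: the class of `convolve μ f g`. (The convolution of
two elements of `L^1(G, ω)` belongs to `L^1(G, ω)`, so the second branch never occurs.) -/
def L1.conv {μ : Measure G} {ω : Weight G} (f g : L1 μ ω) : L1 μ ω :=
  if hc : MemLp (fun x => (ω.fn.toFun x : ℂ) * convolve μ f g x) 1 μ ∧
      AEStronglyMeasurable (convolve μ f g) μ then
    WeightedLp.mk (convolve μ f g) hc.1 hc.2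
  else 0

theorem integrable_pair {μ : Measure G} {ω : Weight G} (h : LInf μ ω) (f : L1 μ ω) :
    Integrable (fun x => f x * h x) μ := by
  have h3 := h.memLp.integrable_mul f.memLp
  refine h3.congr (Filter.Eventually.of_forall fun x => ?_)
  have : (ω x : ℂ) ≠ 0 := Complex.ofReal_ne_zero.2 (ω.pos x).ne'
  simp only [Pi.mul_apply, Weight.fn, Weight.inv, Complex.ofReal_inv]
  field_simp

theorem pair_add {μ : Measure G} {ω : Weight G} (h k : LInf μ ω) (f : L1 μ ω) :
    pair (h + k) f = pair h f + pair k f := by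
  unfold pair
  rw [← integral_add (integrable_pair h f) (integrable_pair k f)]
  refine integral_congr_ae ?_
  filter_upwards [WeightedLp.coeFn_add h k] with x e
  rw [e]; ring

theorem pair_smul {μ : Measure G} {ω : Weight G} (c : ℂ) (h : LInf μ ω) (f : L1 μ ω) :
    pair (c • h) f = c * pair h f := by
  unfold pair
  rw [← integral_const_mul]
  refine integral_congr_ae ?_
  filter_upwards [WeightedLp.coeFn_smul c h] with x e
  rw [e]; ring

theorem pair_zero {μ : Measure G} {ω : Weight G} (f : L1 μ ω) :
    pair (0 : LInf μ ω) f = 0 := by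
  have := pair_smul 0 (0 : LInf μ ω) f
  rwa [zero_smul, zero_mul] at this

/-- The space of bounded derivations `D : L^1(G, ω) → L^∞(G, 1/ω) = L^1(G, ω)^*`, with the operator
norm. The condition is `D(a * b) = D(a) · b + a · D(b)` for the dual module actions
`⟨z · b, c⟩ = ⟨z, b * c⟩` and `⟨a · z, c⟩ = ⟨z, c * a⟩`. -/
def derivations (μ : Measure G) (ω : Weight G) : Submodule ℂ (L1 μ ω →L[ℂ] LInf μ ω) where
  carrier := {D | ∀ a b c : L1 μ ω,
    pair (D (a.conv b)) c = pair (D a) (b.conv c) + pair (D b) (c.conv a)}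
  add_mem' {D E} hD hE a b c := by
    change pair (D _ + E _) c = pair (D a + E a) _ + pair (D b + E b) _
    rw [pair_add, pair_add, pair_add, hD a b c, hE a b c]
    ring
  zero_mem' a b c := by
    change pair 0 c = pair 0 _ + pair 0 _
    simp [pair_zero]
  smul_mem' t D hD a b c := by
    change pair (t • D _) c = pair (t • D a) _ + pair (t • D b) _
    rw [pair_smul, pair_smul, pair_smul, hD a b c]
    ring

/-- `D = ad_h` for some `h ∈ L^∞(G, 1/ω)`, where `ad_h(a) = h · a - a · h`. -/
def IsInner {μ : Measure G} {ω : Weight G} (D : L1 μ ω →L[ℂ] LInf μ ω) : Prop :=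
  ∃ h : LInf μ ω, ∀ a c : L1 μ ω, pair (D a) c = pair h (a.conv c) - pair h (c.conv a)

/-! ### Quasi-additive functions -/

variable [IsTopologicalGroup G] [LocallyCompactSpace G] [T2Space G]

/-- A Borel function `p` on `G × G` is quasi-additive if
`p(xy, z) = p(x, yz) + p(y, zx)` for almost all `(x, y, z)` in `G × G × G`. -/
def QuasiAdditive (p : WithBorel (G × G) → ℂ) : Prop :=
  Measurable p ∧ ∀ᵐ t ∂radonHaar (WithBorel (G × G × G)),
    p (.mk (t.out.1 * t.out.2.1, t.out.2.2)) =
      p (.mk (t.out.1, t.out.2.1 * t.out.2.2)) + p (.mk (t.out.2.1, t.out.2.2 * t.out.1))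

/-- `L^∞(G × G, 1/ω^⊗)`, with the norm `‖p/ω^⊗‖_∞`. -/
abbrev LInf₂ (ω : Weight G) : Type _ :=
  WeightedLp ∞ ω.tensorInv (radonHaar (WithBorel (G × G)))

/-- `D(G, ω)`: the quasi-additive functions `p` with `sup |p(x, y)| / (ω(x) ω(y)) < ∞`, as a
subspace of `L^∞(G × G, 1/ω^⊗)`; so functions that agree almost everywhere are identified. -/
def quasiAdditive (ω : Weight G) : Submodule ℂ (LInf₂ ω) where
  carrier := {P | ∃ p : WithBorel (G × G) → ℂ, QuasiAdditive p ∧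
    (∃ C : ℝ, ∀ x y : G, ‖p (.mk (x, y))‖ / (ω x * ω y) ≤ C) ∧
    P =ᵐ[radonHaar (WithBorel (G × G))] p}
  add_mem' := by
    rintro P Q ⟨p, ⟨hp, hp'⟩, ⟨C, hC⟩, hPp⟩ ⟨q, ⟨hq, hq'⟩, ⟨E, hE⟩, hQq⟩
    refine ⟨fun z => p z + q z, ⟨hp.add hq, ?_⟩, ⟨C + E, fun x y => ?_⟩, ?_⟩
    · filter_upwards [hp', hq'] with t h1 h2
      rw [h1, h2]; ring
    · refine le_trans ?_ (add_le_add (hC x y) (hE x y))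
      rw [← add_div]
      exact div_le_div_of_nonneg_right (norm_add_le _ _) (mul_pos (ω.pos x) (ω.pos y)).le
    · filter_upwards [WeightedLp.coeFn_add P Q, hPp, hQq] with z e1 e2 e3
      rw [e1, e2, e3]
  zero_mem' := ⟨fun _ => 0, ⟨measurable_const, by simp⟩, ⟨0, by simp⟩, WeightedLp.coeFn_zero⟩
  smul_mem' := by
    rintro c P ⟨p, ⟨hp, hp'⟩, ⟨C, hC⟩, hPp⟩
    refine ⟨fun z => c * p z, ⟨hp.const_mul c, ?_⟩, ⟨‖c‖ * C, fun x y => ?_⟩, ?_⟩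
    · filter_upwards [hp'] with t h1
      rw [h1]; ring
    · rw [norm_mul, mul_div_assoc]
      exact mul_le_mul_of_nonneg_left (hC x y) (norm_nonneg c)
    · filter_upwards [WeightedLp.coeFn_smul c P, hPp] with z e1 e2
      rw [e1, e2]

/-- `I(G, ω)`: the classes of the functions `p(x, y) = h(xy) - h(yx)`, `h ∈ L^∞(G, 1/ω)`. -/
def innerQuasiAdditive (μ : Measure G) (ω : Weight G) : Set (LInf₂ ω) :=
  {P | ∃ h : LInf μ ω, ∀ᵐ q ∂radonHaar (WithBorel (G × G)),
    P q = h (q.out.1 * q.out.2) - h (q.out.2 * q.out.1)}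

end Algebra

end

end Beurling

namespace Beurling

set_option linter.unusedSectionVars false

open Set Filter Topology ProbabilityTheory

noncomputable section

/-! ### Products of finite inner regular Borel measures -/

section FiniteProduct

variable {X Y : Type*} [TopologicalSpace X] [TopologicalSpace Y]

/-! A bounded operator from $L^1(G,\omega)$ to its dual is a bounded bilinear form on
$L^1(G,\omega)$. Dividing out the weight turns it into a form on $L^1(G)\times L^1(G)$, that is, a
functional on $L^1(G\times G)$, and so a bounded function. Hence every operator has a kernel $p$
with $|p|\le\|D\|\,\omega\otimes\omega$ (`exists_kernel`), unique up to null sets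
(`eq_of_forms_eq`). Conversely, a kernel with $|p|\le C\,\omega\otimes\omega$ gives an operator of
norm at most $C$, so the correspondence is isometric. Tested on $a,b,c$, the derivation identity
compares the integrals of $p(xy,z)$ and of $p(x,yz)+p(y,zx)$ against $a(x)b(y)c(z)$; it therefore
means that $p$ is quasi-additive (`IsKernel.op_mem_derivations_iff`). The kernel of the inner
derivation of $h$ is $h(xy)-h(yx)$ (`pair_op_commutator`).

A multiplicative weight with values in $[1,\infty)$ is constant, so (iv) concerns bounded
quasi-additive functions, and real ones suffice. With $z=y^{-1}v$, quasi-additivity reads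
$r(xy,y^{-1}v)=r(x,v)+r(y,y^{-1}vx)$. Let $K$ be a compact neighbourhood of the identity, $c$ its
measure and $M_a(u)=\int_K r(ay,(ay)^{-1}u)\,dy$. Replacing $y$ by $ay$ and integrating over $K$
gives $M_{xa}(xv)=c\,r(x,v)+M_a(vx)$. Since $xa$ runs through $G$ together with $a$, the essential
supremum $h$ of all $M_a$ satisfies $c\,r(x,v)\le h(xv)-h(vx)$ (`exists_le_commutator`). No
invariant mean is needed. The same bound for $-r$ shows that $r$ is antisymmetric, and this turns
the inequality into an equality (`exists_eq_commutator`).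

The rest is measure theory: $G$ need not be $\sigma$-compact, and the Borel sets of $G\times G$ need
not be product measurable. For finite inner regular measures, however, Borel sets agree with product
measurable sets up to null sets (`exists_product_measurableSet`), which yields Fubini's theorem over
$\sigma$-compact rectangles (`IsRadonProduct.restrict`). Furthermore $G$ splits into open
$\sigma$-compact cosets (`exists_partition`), of which a compact set meets finitely many, so
functions found on the cosets can be glued (`exists_glue`). -/

theorem WithBorel.continuous_mk {Z : Type*} [TopologicalSpace Z] :
    Continuous (WithBorel.mk : Z → WithBorel Z) := continuous_id

/-- The rectangle `A × B`, seen in the copy of the product. -/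
def rect (A : Set X) (B : Set Y) : Set (WithBorel (X × Y)) := {q | q.out.1 ∈ A ∧ q.out.2 ∈ B}

theorem isCompact_rect {A : Set X} {B : Set Y} (hA : IsCompact A) (hB : IsCompact B) :
    IsCompact (rect A B) := hA.prod hB

theorem isOpen_rect {A : Set X} {B : Set Y} (hA : IsOpen A) (hB : IsOpen B) :
    IsOpen (rect A B) := hA.prod hB

theorem continuous_slice_left (y : Y) : Continuous fun x : X => WithBorel.mk (x, y) :=
  WithBorel.continuous_mk.comp (by fun_prop)

theorem continuous_slice_right (x : X) : Continuous fun y : Y => WithBorel.mk (x, y) :=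
  WithBorel.continuous_mk.comp (by fun_prop)

/-- The exchange of the two factors. -/
def swapB (q : WithBorel (X × Y)) : WithBorel (Y × X) := .mk (q.out.2, q.out.1)

theorem continuous_swapB : Continuous (swapB : WithBorel (X × Y) → WithBorel (Y × X)) :=
  WithBorel.continuous_mk.comp
    ((continuous_snd.comp WithBorel.continuous_out).prodMk
      (continuous_fst.comp WithBorel.continuous_out))

variable [MeasurableSpace X] [BorelSpace X] [MeasurableSpace Y] [BorelSpace Y]

theorem measurable_out : Measurable (WithBorel.out : WithBorel (X × Y) → X × Y) :=
  (continuous_fst.comp WithBorel.continuous_out).measurable.prodMk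
    (continuous_snd.comp WithBorel.continuous_out).measurable

theorem measurableSet_rect {A : Set X} {B : Set Y} (hA : MeasurableSet A) (hB : MeasurableSet B) :
    MeasurableSet (rect A B) := measurable_out (hA.prod hB)

/-- A product set contained in an open set has an open rectangular neighbourhood there. -/
theorem exists_rect_of_isCompact {O : Set (WithBorel (X × Y))} (hO : IsOpen O) {K : Set X}
    {L : Set Y} (hK : IsCompact K) (hL : IsCompact L) (h : ∀ x ∈ K, ∀ y ∈ L, .mk (x, y) ∈ O) :
    ∃ (U : Set X) (V : Set Y), IsOpen U ∧ IsOpen V ∧ K ⊆ U ∧ L ⊆ V ∧ rect U V ⊆ O := by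
  obtain ⟨U, V, h1, h2, h3, h4, h5⟩ := generalized_tube_lemma (n := (show Set (X × Y) from O))
    hK hL hO (fun q hq => h q.1 hq.1 q.2 hq.2)
  exact ⟨U, V, h1, h2, h3, h4, h5⟩

/-- For an open set the measure of the slice is lower semicontinuous in `y`: a compact part of the
slice survives small changes of `y`, by the tube lemma. Open sets form a π-system that generates the
Borel sets. -/
theorem measurable_slice_measure (l : Measure X) [IsFiniteMeasure l] [l.InnerRegular] :
    Measurable fun y : Y => l.map (fun x => WithBorel.mk (x, y)) := by
  have hm : ∀ y : Y, Measurable fun x : X => WithBorel.mk (x, y) :=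
    fun y => (continuous_slice_left y).measurable
  have : ∀ y : Y, IsFiniteMeasure (l.map (fun x => WithBorel.mk (x, y))) :=
    fun y => inferInstance
  refine Measurable.measure_of_isPiSystem (S := {s | IsOpen s})
    (BorelSpace.measurable_eq) isPiSystem_isOpen ?_ ?_
  · intro s hs
    apply LowerSemicontinuous.measurable
    intro y t ht
    have hs : IsOpen s := hs
    change t < l.map (fun x => WithBorel.mk (x, y)) s at ht
    change ∀ᶠ y' in 𝓝 y, t < l.map (fun x => WithBorel.mk (x, y')) s
    rw [Measure.map_apply (hm y) (IsOpen.measurableSet hs)] at ht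
    obtain ⟨K, hKs, hK, htK⟩ := ((hm y) (IsOpen.measurableSet hs)).exists_lt_isCompact ht
    obtain ⟨U, V, hU, hV, hKU, hyV, hUV⟩ := exists_rect_of_isCompact hs hK
      (isCompact_singleton (x := y)) (fun x hx y' hy' => by rw [mem_singleton_iff.1 hy']; exact hKs hx)
    filter_upwards [hV.mem_nhds (hyV rfl)] with y' hy'
    rw [Measure.map_apply (hm y') (IsOpen.measurableSet hs)]
    exact htK.trans_le (measure_mono fun x hx => hUV ⟨hKU hx, hy'⟩)
  · simp_rw [Measure.map_apply (hm _) MeasurableSet.univ]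
    simp

variable [T2Space X] [T2Space Y]

/-- Borel sets of the product are, up to null sets, measurable for the product `σ`-algebra. -/
theorem exists_product_measurableSet (p : Measure (WithBorel (X × Y))) [IsFiniteMeasure p]
    [p.InnerRegular] {E : Set (WithBorel (X × Y))} (hE : MeasurableSet E) :
    ∃ F : Set (X × Y), MeasurableSet F ∧ E =ᵐ[p] WithBorel.out ⁻¹' F := by
  have hcompact : ∀ K : Set (WithBorel (X × Y)), IsCompact K →
      ∃ F : Set (X × Y), MeasurableSet F ∧ K =ᵐ[p] WithBorel.out ⁻¹' F := by
    intro K hK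
    -- Finitely many open rectangles cover `K` inside an open set of almost the same measure. The
    -- intersection of these finite unions over `n` exceeds `K` by a null set only.
    have h1 : ∀ n : ℕ, ∃ F : Set (X × Y), MeasurableSet F ∧ K ⊆ WithBorel.out ⁻¹' F ∧
        p (WithBorel.out ⁻¹' F) ≤ p K + (n + 1 : ℝ≥0∞)⁻¹ := by
      intro n
      obtain ⟨O, hKO, hO, hpO⟩ := hK.exists_isOpen_lt_add (μ := p) (ε := (n + 1 : ℝ≥0∞)⁻¹)
        (by simp)
      have h2 : ∀ q ∈ K, ∃ R : Set (X × Y), MeasurableSet R ∧ R ⊆ WithBorel.mk ⁻¹' O ∧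
          WithBorel.out ⁻¹' R ∈ 𝓝 q := by
        intro q hq
        obtain ⟨U, V, hU, hV, hqU, hqV, hUV⟩ := exists_rect_of_isCompact hO
          (isCompact_singleton (x := q.out.1)) (isCompact_singleton (x := q.out.2))
          (fun x hx y hy => by
            rw [mem_singleton_iff.1 hx, mem_singleton_iff.1 hy]; exact hKO hq)
        exact ⟨U ×ˢ V, hU.measurableSet.prod hV.measurableSet, hUV,
          (isOpen_rect hU hV).mem_nhds ⟨hqU rfl, hqV rfl⟩⟩
      choose! R hR1 hR2 hR3 using h2
      obtain ⟨t, htK, ht⟩ := hK.elim_nhds_subcover _ hR3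
      refine ⟨⋃ q ∈ t, R q, t.measurableSet_biUnion fun q hq => hR1 q (htK q hq), ?_, ?_⟩
      · simpa using ht
      · refine (measure_mono ?_).trans hpO.le
        intro q hq
        simp only [mem_preimage, mem_iUnion] at hq
        obtain ⟨z, hz, hqz⟩ := hq
        exact hR2 z (htK z hz) hqz
    choose F hF1 hF2 hF3 using h1
    refine ⟨⋂ n, F n, .iInter hF1, ?_⟩
    have hsub : K ⊆ WithBorel.out ⁻¹' (⋂ n, F n) := by
      rw [preimage_iInter]; exact subset_iInter hF2
    refine ae_eq_of_subset_of_measure_ge hsub ?_ hK.measurableSet.nullMeasurableSet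
      (measure_ne_top _ _)
    have hlim : Tendsto (fun n : ℕ => p K + (n + 1 : ℝ≥0∞)⁻¹) atTop (𝓝 (p K + 0)) := by
      refine tendsto_const_nhds.add ?_
      have := (tendsto_add_atTop_iff_nat 1).2 ENNReal.tendsto_inv_nat_nhds_zero
      simpa using this
    rw [add_zero] at hlim
    exact ge_of_tendsto' hlim fun n =>
      (measure_mono (preimage_mono (iInter_subset _ n))).trans (hF3 n)
  -- By inner regularity, `E` is a countable union of compact sets up to a null set.
  have h1 : ∀ n : ℕ, ∃ K ⊆ E, IsCompact K ∧ p E < p K + (n + 1 : ℝ≥0∞)⁻¹ := fun n =>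
    hE.exists_isCompact_lt_add (measure_ne_top _ _) (by simp)
  choose K hKE hK hpK using h1
  choose F hF1 hF2 using fun n => hcompact (K n) (hK n)
  refine ⟨⋃ n, F n, .iUnion hF1, ?_⟩
  have h2 : (⋃ n, K n : Set _) =ᵐ[p] E := by
    refine ae_eq_of_subset_of_measure_ge (iUnion_subset hKE) ?_
      (MeasurableSet.iUnion fun n => (hK n).measurableSet).nullMeasurableSet (measure_ne_top _ _)
    have hlim : Tendsto (fun n : ℕ => p (⋃ n, K n) + (n + 1 : ℝ≥0∞)⁻¹) atTop
        (𝓝 (p (⋃ n, K n) + 0)) := by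
      refine tendsto_const_nhds.add ?_
      have := (tendsto_add_atTop_iff_nat 1).2 ENNReal.tendsto_inv_nat_nhds_zero
      simpa using this
    rw [add_zero] at hlim
    exact ge_of_tendsto' hlim fun n =>
      (hpK n).le.trans (add_le_add_left (measure_mono (subset_iUnion K n)) _)
  refine h2.symm.trans ?_
  rw [preimage_iUnion]
  exact Filter.EventuallyEq.countable_iUnion hF2

theorem map_out_eq_prod {l : Measure X} {n : Measure Y} [IsFiniteMeasure l] [IsFiniteMeasure n]
    {p : Measure (WithBorel (X × Y))}
    (h : ∀ A B, MeasurableSet A → MeasurableSet B → p (rect A B) = l A * n B) :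
    p.map WithBorel.out = l.prod n := by
  refine (Measure.prod_eq fun A B hA hB => ?_).symm
  rw [Measure.map_apply measurable_out (hA.prod hB)]
  exact h A B hA hB

/-- Almost all sections of a null set are null. -/
theorem ae_slice_null {l : Measure X} {n : Measure Y} [IsFiniteMeasure l] [IsFiniteMeasure n]
    [l.InnerRegular] [n.InnerRegular]
    {p : Measure (WithBorel (X × Y))} [IsFiniteMeasure p] [p.InnerRegular]
    (h : ∀ A B, MeasurableSet A → MeasurableSet B → p (rect A B) = l A * n B)
    {N : Set (WithBorel (X × Y))} (hN : MeasurableSet N) (hpN : p N = 0) :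
    ∀ᵐ y ∂n, l.map (fun x => WithBorel.mk (x, y)) N = 0 := by
  have hm : ∀ y : Y, Measurable fun x : X => WithBorel.mk (x, y) :=
    fun y => (continuous_slice_left y).measurable
  -- Chebyshev's inequality for the slice measures of an open set. A compact part of the superlevel
  -- set is covered by finitely many `V y`; the union `R` of the rectangles lies in `O` and is
  -- product measurable, so the classical Tonelli theorem applies to it.
  have key : ∀ O : Set (WithBorel (X × Y)), IsOpen O → ∀ t : ℝ≥0∞,
      t * n {y | t < l.map (fun x => WithBorel.mk (x, y)) O} ≤ p O := by
    intro O hO t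
    set S := {y | t < l.map (fun x => WithBorel.mk (x, y)) O} with hS
    have hSm : MeasurableSet S := measurableSet_lt measurable_const
      ((Measure.measurable_coe hO.measurableSet).comp (measurable_slice_measure l))
    rw [hSm.measure_eq_iSup_isCompact_of_ne_top (measure_ne_top _ _)]
    simp_rw [ENNReal.mul_iSup]
    refine iSup_le fun C => iSup_le fun hCS => iSup_le fun hC => ?_
    have h2 : ∀ y ∈ C, ∃ (U : Set X) (V : Set Y), IsOpen U ∧ IsOpen V ∧ t < l U ∧ V ∈ 𝓝 y ∧
        rect U V ⊆ O := by
      intro y hy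
      have ht := hCS hy
      rw [hS, mem_ofPred_eq, Measure.map_apply (hm y) hO.measurableSet] at ht
      obtain ⟨K, hKs, hK, htK⟩ := ((hm y) hO.measurableSet).exists_lt_isCompact ht
      obtain ⟨U, V, hU, hV, hKU, hyV, hUV⟩ := exists_rect_of_isCompact hO hK
        (isCompact_singleton (x := y))
        (fun x hx y' hy' => by rw [mem_singleton_iff.1 hy']; exact hKs hx)
      exact ⟨U, V, hU, hV, htK.trans_le (measure_mono hKU), hV.mem_nhds (hyV rfl), hUV⟩
    choose! U V hU hV htU hVy hUV using h2
    obtain ⟨s, hsC, hs⟩ := hC.elim_nhds_subcover _ hVy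
    set R : Set (X × Y) := ⋃ y ∈ s, U y ×ˢ V y with hR
    have hRm : MeasurableSet R := s.measurableSet_biUnion fun y hy =>
      (hU y (hsC y hy)).measurableSet.prod (hV y (hsC y hy)).measurableSet
    have hRO : WithBorel.out ⁻¹' R ⊆ O := by
      intro q hq
      simp only [hR, mem_preimage, mem_iUnion] at hq
      obtain ⟨z, hz, hqz⟩ := hq
      exact hUV z (hsC z hz) hqz
    calc t * n C = ∫⁻ _ in C, t ∂n := by simp
      _ ≤ ∫⁻ y in C, l ((fun x => (x, y)) ⁻¹' R) ∂n := by
        refine setLIntegral_mono' hC.measurableSet fun y hy => ?_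
        obtain ⟨z, hz, hyz⟩ := mem_iUnion₂.1 (hs hy)
        refine (htU z (hsC z hz)).le.trans (measure_mono fun x hx => ?_)
        exact mem_iUnion₂.2 ⟨z, hz, hx, hyz⟩
      _ ≤ ∫⁻ y, l ((fun x => (x, y)) ⁻¹' R) ∂n := setLIntegral_le_lintegral _ _
      _ = (l.prod n) R := (Measure.prod_apply_symm hRm).symm
      _ = p (WithBorel.out ⁻¹' R) := by
        rw [← map_out_eq_prod h, Measure.map_apply measurable_out hRm]
      _ ≤ p O := measure_mono hRO
  -- The null set `N` lies in open sets `Kᶜ` of arbitrarily small measure, with `K` compact in the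
  -- complement of `N`; this contradicts `key` if the superlevel set has positive measure.
  have key2 : ∀ k : ℕ, n {y | (k + 1 : ℝ≥0∞)⁻¹ < l.map (fun x => WithBorel.mk (x, y)) N} = 0 := by
    intro k
    by_contra hne
    set a := n {y | (k + 1 : ℝ≥0∞)⁻¹ < l.map (fun x => WithBorel.mk (x, y)) N}
    have hpos : (k + 1 : ℝ≥0∞)⁻¹ * a ≠ 0 := mul_ne_zero (by simp) hne
    obtain ⟨K, hKN, hK, hpK⟩ := hN.compl.exists_isCompact_lt_add (μ := p) (measure_ne_top _ _) hpos
    have hO : IsOpen Kᶜ := hK.isClosed.isOpen_compl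
    have h3 : p Kᶜ < (k + 1 : ℝ≥0∞)⁻¹ * a := by
      have e1 : p Nᶜ = p univ := by
        rw [measure_compl hN (measure_ne_top _ _), hpN, tsub_zero]
      rw [measure_compl hK.measurableSet (measure_ne_top _ _), ← e1]
      refine ENNReal.sub_lt_of_lt_add ?_ (by rwa [add_comm])
      exact measure_mono hKN
    refine absurd (key Kᶜ hO (k + 1 : ℝ≥0∞)⁻¹) (not_le.2 (h3.trans_le ?_))
    gcongr
    refine measure_mono fun y hy => ?_
    exact lt_of_lt_of_le hy (measure_mono (subset_compl_comm.1 hKN))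
  rw [ae_iff]
  refine measure_mono_null ?_ (measure_iUnion_null key2)
  intro y hy
  obtain ⟨k, hk⟩ := ENNReal.exists_inv_nat_lt (show l.map (fun x => WithBorel.mk (x, y)) N ≠ 0 from hy)
  refine mem_iUnion.2 ⟨k, lt_of_le_of_lt ?_ hk⟩
  exact ENNReal.inv_le_inv.2 (by simp)

/-- The formula is classical for a product measurable set. A Borel set differs from one by a null
set, almost all of whose slices are null. -/
theorem eq_bind_slice {l : Measure X} {n : Measure Y} [IsFiniteMeasure l] [IsFiniteMeasure n]
    [l.InnerRegular] [n.InnerRegular]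
    {p : Measure (WithBorel (X × Y))} [IsFiniteMeasure p] [p.InnerRegular]
    (h : ∀ A B, MeasurableSet A → MeasurableSet B → p (rect A B) = l A * n B) :
    p = n.bind fun y => l.map (fun x => WithBorel.mk (x, y)) := by
  have hm : ∀ y : Y, Measurable fun x : X => WithBorel.mk (x, y) :=
    fun y => (continuous_slice_left y).measurable
  ext E hE
  rw [Measure.bind_apply hE (measurable_slice_measure l).aemeasurable]
  obtain ⟨F, hF, hEF⟩ := exists_product_measurableSet p hE
  have hFm : MeasurableSet (WithBorel.out ⁻¹' F) := measurable_out hF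
  have h1 := ae_slice_null h (hE.symmDiff hFm) (measure_symmDiff_eq_zero_iff.2 hEF)
  calc p E = p (WithBorel.out ⁻¹' F) := measure_congr hEF
    _ = (l.prod n) F := by rw [← map_out_eq_prod h, Measure.map_apply measurable_out hF]
    _ = ∫⁻ y, l ((fun x => (x, y)) ⁻¹' F) ∂n := Measure.prod_apply_symm hF
    _ = _ := by
      refine lintegral_congr_ae ?_
      filter_upwards [h1] with y hy
      rw [measure_congr (measure_symmDiff_eq_zero_iff.1 hy), Measure.map_apply (hm y) hFm]
      rfl

/-- The product relation between Borel measures on `X`, `Y` and `X × Y`, in the form of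
disintegrations along both factors. -/
structure IsProduct (l : Measure X) (n : Measure Y) (p : Measure (WithBorel (X × Y))) : Prop where
  measurable_left : Measurable fun y : Y => l.map (fun x => WithBorel.mk (x, y))
  measurable_right : Measurable fun x : X => n.map (fun y => WithBorel.mk (x, y))
  eq_left : p = n.bind fun y : Y => l.map (fun x => WithBorel.mk (x, y))
  eq_right : p = l.bind fun x : X => n.map (fun y => WithBorel.mk (x, y))

/-- The disintegration along the second factor is `eq_bind_slice`; the one along the first factor is
the same result for the image of `p` under the exchange of the factors. -/
theorem IsProduct.of_rect {l : Measure X} {n : Measure Y} [IsFiniteMeasure l] [IsFiniteMeasure n]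
    [l.InnerRegular] [n.InnerRegular]
    {p : Measure (WithBorel (X × Y))} [IsFiniteMeasure p] [p.InnerRegular]
    (h : ∀ A B, MeasurableSet A → MeasurableSet B → p (rect A B) = l A * n B) :
    IsProduct l n p := by
  have hsX : Measurable (swapB : WithBorel (X × Y) → WithBorel (Y × X)) :=
    continuous_swapB.measurable
  have hsY : Measurable (swapB : WithBorel (Y × X) → WithBorel (X × Y)) :=
    continuous_swapB.measurable
  have hr : Measurable fun x : X => n.map (fun y => WithBorel.mk (x, y)) := by
    have h1 := (Measure.measurable_map _ hsY).comp (measurable_slice_measure (Y := X) n)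
    convert! h1 using 2 with x
    rw [Function.comp_apply, Measure.map_map hsY (continuous_slice_left x).measurable]
    rfl
  refine ⟨measurable_slice_measure l, hr, eq_bind_slice h, ?_⟩
  have : (p.map swapB).InnerRegular := InnerRegular.map_of_continuous continuous_swapB
  have h2 := eq_bind_slice (l := n) (n := l) (p := p.map swapB) (by
    intro A B hA hB
    rw [Measure.map_apply hsX (measurableSet_rect hA hB), mul_comm, ← h B A hB hA]
    congr 1
    ext q
    simp only [rect, mem_preimage, mem_ofPred_eq]
    exact and_comm)
  have h3 : p = (p.map swapB).map swapB := by
    rw [Measure.map_map hsY hsX]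
    exact Measure.map_id.symm
  rw [h3, h2]
  ext E hE
  rw [Measure.map_apply hsY hE, Measure.bind_apply (hsY hE)
    (measurable_slice_measure (Y := X) n).aemeasurable, Measure.bind_apply hE hr.aemeasurable]
  refine lintegral_congr fun x => ?_
  rw [Measure.map_apply (continuous_slice_left x).measurable (hsY hE),
    Measure.map_apply (continuous_slice_right x).measurable hE]
  rfl

end FiniteProduct

/-! ### Iterated integrals for measures with a product relation. -/

section Fubini

variable {X Y : Type*} [TopologicalSpace X] [TopologicalSpace Y]
  [MeasurableSpace X] [BorelSpace X] [MeasurableSpace Y] [BorelSpace Y]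

theorem measurable_integral_slice {l : Measure X}
    (hl : Measurable fun y : Y => l.map (fun x => WithBorel.mk (x, y)))
    {F : WithBorel (X × Y) → ℂ} (hF : Measurable F) :
    Measurable fun y => ∫ x, F (.mk (x, y)) ∂l := by
  let κ : Kernel Y (WithBorel (X × Y)) := ⟨_, hl⟩
  have := (hF.stronglyMeasurable.integral_kernel (κ := κ)).measurable
  convert! this using 2 with y
  exact (integral_map (continuous_slice_left y).measurable.aemeasurable
    hF.stronglyMeasurable.aestronglyMeasurable).symm

theorem measurable_integral_slice' {n : Measure Y}
    (hn : Measurable fun x : X => n.map (fun y => WithBorel.mk (x, y)))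
    {F : WithBorel (X × Y) → ℂ} (hF : Measurable F) :
    Measurable fun x => ∫ y, F (.mk (x, y)) ∂n := by
  let κ : Kernel X (WithBorel (X × Y)) := ⟨_, hn⟩
  have := (hF.stronglyMeasurable.integral_kernel (κ := κ)).measurable
  convert! this using 2 with x
  exact (integral_map (continuous_slice_right x).measurable.aemeasurable
    hF.stronglyMeasurable.aestronglyMeasurable).symm

namespace IsProduct

variable {l : Measure X} {n : Measure Y} {p : Measure (WithBorel (X × Y))}

theorem lintegral_left (h : IsProduct l n p) {F : WithBorel (X × Y) → ℝ≥0∞} (hF : Measurable F) :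
    ∫⁻ q, F q ∂p = ∫⁻ y, ∫⁻ x, F (.mk (x, y)) ∂l ∂n := by
  rw [h.eq_left, lintegral_bind h.measurable_left.aemeasurable hF.aemeasurable]
  exact lintegral_congr fun y => lintegral_map hF (continuous_slice_left y).measurable

theorem lintegral_right (h : IsProduct l n p) {F : WithBorel (X × Y) → ℝ≥0∞} (hF : Measurable F) :
    ∫⁻ q, F q ∂p = ∫⁻ x, ∫⁻ y, F (.mk (x, y)) ∂n ∂l := by
  rw [h.eq_right, lintegral_bind h.measurable_right.aemeasurable hF.aemeasurable]
  exact lintegral_congr fun x => lintegral_map hF (continuous_slice_right x).measurable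

theorem integral_left (h : IsProduct l n p) {F : WithBorel (X × Y) → ℂ} (hF : Measurable F)
    (hi : Integrable F p) : ∫ q, F q ∂p = ∫ y, ∫ x, F (.mk (x, y)) ∂l ∂n := by
  let κ : Kernel Y (WithBorel (X × Y)) := ⟨_, h.measurable_left⟩
  have e : p = (κ ∘ₖ Kernel.const Unit n) () := by
    rw [Kernel.comp_apply, Kernel.const_apply]; exact h.eq_left
  rw [e] at hi ⊢
  rw [Kernel.integral_comp hi, Kernel.const_apply]
  refine integral_congr_ae (.of_forall fun y => ?_)
  exact integral_map (continuous_slice_left y).measurable.aemeasurable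
    hF.stronglyMeasurable.aestronglyMeasurable

theorem integral_right (h : IsProduct l n p) {F : WithBorel (X × Y) → ℂ} (hF : Measurable F)
    (hi : Integrable F p) : ∫ q, F q ∂p = ∫ x, ∫ y, F (.mk (x, y)) ∂n ∂l := by
  let κ : Kernel X (WithBorel (X × Y)) := ⟨_, h.measurable_right⟩
  have e : p = (κ ∘ₖ Kernel.const Unit l) () := by
    rw [Kernel.comp_apply, Kernel.const_apply]; exact h.eq_right
  rw [e] at hi ⊢
  rw [Kernel.integral_comp hi, Kernel.const_apply]
  refine integral_congr_ae (.of_forall fun x => ?_)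
  exact integral_map (continuous_slice_right x).measurable.aemeasurable
    hF.stronglyMeasurable.aestronglyMeasurable

theorem ae_left (h : IsProduct l n p) {P : WithBorel (X × Y) → Prop} (hP : ∀ᵐ q ∂p, P q) :
    ∀ᵐ y ∂n, ∀ᵐ x ∂l, P (.mk (x, y)) := by
  rw [h.eq_left] at hP
  filter_upwards [ae_ae_of_ae_bind h.measurable_left.aemeasurable hP] with y hy
  exact ae_of_ae_map (continuous_slice_left y).measurable.aemeasurable hy

theorem ae_right (h : IsProduct l n p) {P : WithBorel (X × Y) → Prop} (hP : ∀ᵐ q ∂p, P q) :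
    ∀ᵐ x ∂l, ∀ᵐ y ∂n, P (.mk (x, y)) := by
  rw [h.eq_right] at hP
  filter_upwards [ae_ae_of_ae_bind h.measurable_right.aemeasurable hP] with x hx
  exact ae_of_ae_map (continuous_slice_right x).measurable.aemeasurable hx

theorem sum {ι κ : Type*} [Countable ι] [Countable κ] [Nonempty ι] [Nonempty κ] {l : ι → Measure X} {n : κ → Measure Y}
    {p : ι × κ → Measure (WithBorel (X × Y))} (h : ∀ i j, IsProduct (l i) (n j) (p (i, j))) :
    IsProduct (Measure.sum l) (Measure.sum n) (Measure.sum p) := by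
  have el : ∀ (E : Set (WithBorel (X × Y))) (_ : MeasurableSet E) (y : Y),
      (Measure.sum l).map (fun x => WithBorel.mk (x, y)) E =
        ∑' i, (l i).map (fun x => WithBorel.mk (x, y)) E := by
    intro E hE y
    have hm := (continuous_slice_left (X := X) y).measurable
    rw [Measure.map_apply hm hE, Measure.sum_apply _ (hm hE)]
    exact tsum_congr fun i => (Measure.map_apply hm hE).symm
  have er : ∀ (E : Set (WithBorel (X × Y))) (_ : MeasurableSet E) (x : X),
      (Measure.sum n).map (fun y => WithBorel.mk (x, y)) E =
        ∑' i, (n i).map (fun y => WithBorel.mk (x, y)) E := by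
    intro E hE x
    have hm := (continuous_slice_right (Y := Y) x).measurable
    rw [Measure.map_apply hm hE, Measure.sum_apply _ (hm hE)]
    exact tsum_congr fun i => (Measure.map_apply hm hE).symm
  -- Measurability of the slices of `l i` is part of a statement about a pair of indices, so some
  -- second index must exist.
  inhabit ι
  inhabit κ
  have ml : Measurable fun y : Y => (Measure.sum l).map (fun x => WithBorel.mk (x, y)) := by
    refine Measure.measurable_of_measurable_coe _ fun E hE => ?_
    simp_rw [el E hE]
    exact .tsum fun i => (Measure.measurable_coe hE).comp (h i default).measurable_left
  have mr : Measurable fun x : X => (Measure.sum n).map (fun y => WithBorel.mk (x, y)) := by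
    refine Measure.measurable_of_measurable_coe _ fun E hE => ?_
    simp_rw [er E hE]
    exact .tsum fun j => (Measure.measurable_coe hE).comp (h default j).measurable_right
  refine ⟨ml, mr, ?_, ?_⟩
  · ext E hE
    rw [Measure.sum_apply _ hE, Measure.bind_apply hE ml.aemeasurable, lintegral_sum_measure,
      ENNReal.tsum_prod']
    rw [ENNReal.tsum_comm]
    refine tsum_congr fun j => ?_
    simp_rw [el E hE]
    rw [lintegral_tsum (f := fun i y => (l i).map (fun x => WithBorel.mk (x, y)) E)
      fun i => ((Measure.measurable_coe hE).comp (h i default).measurable_left).aemeasurable]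
    refine tsum_congr fun i => ?_
    conv_lhs => rw [(h i j).eq_left]
    rw [Measure.bind_apply hE (h i j).measurable_left.aemeasurable]
  · ext E hE
    rw [Measure.sum_apply _ hE, Measure.bind_apply hE mr.aemeasurable, lintegral_sum_measure,
      ENNReal.tsum_prod']
    refine tsum_congr fun i => ?_
    simp_rw [er E hE]
    rw [lintegral_tsum (f := fun j x => (n j).map (fun y => WithBorel.mk (x, y)) E)
      fun j => ((Measure.measurable_coe hE).comp (h default j).measurable_right).aemeasurable]
    refine tsum_congr fun j => ?_
    conv_lhs => rw [(h i j).eq_right]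
    rw [Measure.bind_apply hE (h i j).measurable_right.aemeasurable]

end IsProduct

end Fubini

/-! ### Products of Radon measures -/

section Radon

variable {X Y : Type*} [TopologicalSpace X] [TopologicalSpace Y] [T2Space X] [T2Space Y]
  [MeasurableSpace X] [BorelSpace X] [MeasurableSpace Y] [BorelSpace Y]

/-- The inner regular measure `p` on `X × Y` is the Radon product of `m` and `n`. -/
structure IsRadonProduct (m : Measure X) (n : Measure Y) (p : Measure (WithBorel (X × Y))) :
    Prop where
  innerRegular : p.InnerRegular
  rect_eq : ∀ (A : Set X) (B : Set Y) (K : Set X) (L : Set Y), MeasurableSet A → MeasurableSet B →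
    IsCompact K → IsCompact L → A ⊆ K → B ⊆ L → p (rect A B) = m A * n B

theorem exists_disjoint_pieces {A : Set X} (hA : IsSigmaCompact A) :
    ∃ S : ℕ → Set X, (∀ i, MeasurableSet (S i)) ∧ (∀ i, ∃ K, IsCompact K ∧ S i ⊆ K) ∧
      Pairwise (Function.onFun Disjoint S) ∧ ⋃ i, S i = A := by
  obtain ⟨K, hK, hKA⟩ := hA
  refine ⟨disjointed K, fun i => .disjointed (fun i => (hK i).measurableSet) i,
    fun i => ⟨K i, hK i, disjointed_subset K i⟩, disjoint_disjointed K, ?_⟩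
  rw [iUnion_disjointed, hKA]

theorem _root_.IsSigmaCompact.measurableSet' {A : Set X} (hA : IsSigmaCompact A) :
    MeasurableSet A := by
  obtain ⟨K, hK, rfl⟩ := hA
  exact .iUnion fun i => (hK i).measurableSet

/-- Both sets are cut into countably many disjoint relatively compact pieces. On a product of two
pieces all measures are finite and `IsProduct.of_rect` applies; the pieces are then summed. -/
theorem IsRadonProduct.restrict {m : Measure X} {n : Measure Y} {p : Measure (WithBorel (X × Y))}
    [IsFiniteMeasureOnCompacts m] [IsFiniteMeasureOnCompacts n]
    [m.InnerRegular] [n.InnerRegular] (h : IsRadonProduct m n p) {A : Set X} {B : Set Y}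
    (hA : IsSigmaCompact A) (hB : IsSigmaCompact B) :
    IsProduct (m.restrict A) (n.restrict B) (p.restrict (rect A B)) := by
  obtain ⟨S, hS, hSK, hSd, rfl⟩ := exists_disjoint_pieces hA
  obtain ⟨T, hT, hTL, hTd, rfl⟩ := exists_disjoint_pieces hB
  have e : rect (⋃ i, S i) (⋃ i, T i) = ⋃ z : ℕ × ℕ, rect (S z.1) (T z.2) := by
    ext q
    simp [rect]
  have hd : Pairwise (Function.onFun Disjoint fun z : ℕ × ℕ => rect (S z.1) (T z.2)) := by
    intro z w hzw
    refine disjoint_left.2 fun q hq hq' => ?_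
    by_cases h1 : z.1 = w.1
    · have h2 : z.2 ≠ w.2 := fun h2 => hzw (Prod.ext h1 h2)
      exact disjoint_left.1 (hTd h2) hq.2 hq'.2
    · exact disjoint_left.1 (hSd h1) hq.1 hq'.1
  rw [e, Measure.restrict_iUnion hSd hS, Measure.restrict_iUnion hTd hT,
    Measure.restrict_iUnion hd fun z => measurableSet_rect (hS z.1) (hT z.2)]
  refine IsProduct.sum (p := fun z : ℕ × ℕ => p.restrict (rect (S z.1) (T z.2))) fun i j => ?_
  obtain ⟨K, hK, hSK⟩ := hSK i
  obtain ⟨L, hL, hTL⟩ := hTL j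
  have h0 := h.rect_eq _ _ K L (hS i) (hT j) hK hL hSK hTL
  have f1 : m (S i) < ∞ := (measure_mono hSK).trans_lt hK.measure_lt_top
  have f2 : n (T j) < ∞ := (measure_mono hTL).trans_lt hL.measure_lt_top
  have : IsFiniteMeasure (m.restrict (S i)) := isFiniteMeasure_restrict.2 f1.ne
  have : IsFiniteMeasure (n.restrict (T j)) := isFiniteMeasure_restrict.2 f2.ne
  have : IsFiniteMeasure (p.restrict (rect (S i) (T j))) :=
    isFiniteMeasure_restrict.2 (by rw [h0]; exact (ENNReal.mul_lt_top f1 f2).ne)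
  have := h.innerRegular
  refine IsProduct.of_rect fun A B hA hB => ?_
  rw [Measure.restrict_apply (measurableSet_rect hA hB), Measure.restrict_apply hA,
    Measure.restrict_apply hB, ← h.rect_eq _ _ K L (hA.inter (hS i)) (hB.inter (hT j)) hK hL
      (inter_subset_right.trans hSK) (inter_subset_right.trans hTL)]
  congr 1
  ext q
  simp only [rect, mem_inter_iff, mem_ofPred_eq]
  tauto

end Radon

theorem measure_eq_zero_of_forall_isCompact {X : Type*} [TopologicalSpace X] [MeasurableSpace X]
    (m : Measure X) [m.InnerRegular] {E : Set X} (hE : MeasurableSet E)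
    (h : ∀ K, IsCompact K → m (E ∩ K) = 0) : m E = 0 := by
  rw [hE.measure_eq_iSup_isCompact]
  simp only [ENNReal.iSup_eq_zero]
  intro K hKE hK
  have := h K hK
  rwa [inter_eq_right.2 hKE] at this

theorem innerRegular_restrict {X : Type*} [TopologicalSpace X] [MeasurableSpace X]
    (m : Measure X) [m.InnerRegular] {R : Set X} (hR : MeasurableSet R) :
    (m.restrict R).InnerRegular where
  innerRegular E hE r hr := by
    rw [Measure.restrict_apply hE] at hr
    obtain ⟨K, hKE, hK, hrK⟩ := (hE.inter hR).exists_lt_isCompact hr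
    refine ⟨K, hKE.trans inter_subset_left, hK, ?_⟩
    rwa [Measure.restrict_eq_self _ (hKE.trans inter_subset_right)]

section Radon

variable {X Y : Type*} [TopologicalSpace X] [TopologicalSpace Y] [T2Space X] [T2Space Y]
  [MeasurableSpace X] [BorelSpace X] [MeasurableSpace Y] [BorelSpace Y]
  {m : Measure X} {n : Measure Y} {p : Measure (WithBorel (X × Y))}
  [IsFiniteMeasureOnCompacts m] [IsFiniteMeasureOnCompacts n] [m.InnerRegular] [n.InnerRegular]

theorem measurable_slice_restrict (m : Measure X) [IsFiniteMeasureOnCompacts m] [m.InnerRegular]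
    {A : Set X} (hA : IsSigmaCompact A) :
    Measurable fun y : Y => (m.restrict A).map (fun x => WithBorel.mk (x, y)) := by
  obtain ⟨S, hS, hSK, hSd, rfl⟩ := exists_disjoint_pieces hA
  refine Measure.measurable_of_measurable_coe _ fun E hE => ?_
  have hm := fun y => (continuous_slice_left (X := X) (Y := Y) y).measurable
  have : ∀ y : Y, (m.restrict (⋃ i, S i)).map (fun x => WithBorel.mk (x, y)) E =
      ∑' i, (m.restrict (S i)).map (fun x => WithBorel.mk (x, y)) E := by
    intro y
    rw [Measure.restrict_iUnion hSd hS, Measure.map_apply (hm y) hE,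
      Measure.sum_apply _ (hm y hE)]
    exact tsum_congr fun i => (Measure.map_apply (hm y) hE).symm
  simp_rw [this]
  refine .tsum fun i => (Measure.measurable_coe hE).comp ?_
  obtain ⟨K, hK, hSK⟩ := hSK i
  have : IsFiniteMeasure (m.restrict (S i)) :=
    isFiniteMeasure_restrict.2 ((measure_mono hSK).trans_lt hK.measure_lt_top).ne
  exact measurable_slice_measure _

theorem measurable_slice_restrict' (n : Measure Y) [IsFiniteMeasureOnCompacts n] [n.InnerRegular]
    {B : Set Y} (hB : IsSigmaCompact B) :
    Measurable fun x : X => (n.restrict B).map (fun y => WithBorel.mk (x, y)) := by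
  have hsY : Measurable (swapB : WithBorel (Y × X) → WithBorel (X × Y)) :=
    continuous_swapB.measurable
  have h1 := (Measure.measurable_map _ hsY).comp (measurable_slice_restrict (Y := X) n hB)
  convert! h1 using 2 with x
  rw [Function.comp_apply, Measure.map_map hsY (continuous_slice_left x).measurable]
  rfl

namespace IsRadonProduct

/-- A compact set lies in the rectangle spanned by its two projections, so compact rectangles detect
null sets. -/
theorem measure_eq_zero (h : IsRadonProduct m n p) {E : Set (WithBorel (X × Y))}
    (hE : MeasurableSet E)
    (h0 : ∀ K L, IsCompact K → IsCompact L → p (E ∩ rect K L) = 0) : p E = 0 := by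
  have := h.innerRegular
  refine measure_eq_zero_of_forall_isCompact p hE fun C hC => ?_
  refine measure_mono_null (inter_subset_inter_right _ ?_) (h0 ((fun q => q.out.1) '' C)
    ((fun q => q.out.2) '' C) (hC.image (continuous_fst.comp WithBorel.continuous_out))
    (hC.image (continuous_snd.comp WithBorel.continuous_out)))
  exact fun q hq => ⟨mem_image_of_mem _ hq, mem_image_of_mem _ hq⟩

/-- Every slice, and not only almost every one, is assumed to be null; this is the form in which
null sets are pulled back along $(x,y)\mapsto yx$ and $(x,y)\mapsto y^{-1}x$. -/
theorem measure_eq_zero_of_left (h : IsRadonProduct m n p) {E : Set (WithBorel (X × Y))}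
    (hE : MeasurableSet E) (h0 : ∀ y, m {x | .mk (x, y) ∈ E} = 0) : p E = 0 := by
  refine h.measure_eq_zero hE fun K L hK hL => ?_
  have hr := h.restrict hK.isSigmaCompact hL.isSigmaCompact
  rw [← Measure.restrict_apply hE, hr.eq_left, Measure.bind_apply hE
    hr.measurable_left.aemeasurable]
  refine (lintegral_congr fun y => ?_).trans lintegral_zero
  have hm := (continuous_slice_left (X := X) (Y := Y) y).measurable
  rw [Measure.map_apply hm hE]
  exact nonpos_iff_eq_zero.1 ((Measure.restrict_apply_le _ _).trans (h0 y).le)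

theorem measure_eq_zero_of_right (h : IsRadonProduct m n p) {E : Set (WithBorel (X × Y))}
    (hE : MeasurableSet E) (h0 : ∀ x, n {y | .mk (x, y) ∈ E} = 0) : p E = 0 := by
  refine h.measure_eq_zero hE fun K L hK hL => ?_
  have hr := h.restrict hK.isSigmaCompact hL.isSigmaCompact
  rw [← Measure.restrict_apply hE, hr.eq_right, Measure.bind_apply hE
    hr.measurable_right.aemeasurable]
  refine (lintegral_congr fun x => ?_).trans lintegral_zero
  have hm := (continuous_slice_right (X := X) (Y := Y) x).measurable
  rw [Measure.map_apply hm hE]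
  exact nonpos_iff_eq_zero.1 ((Measure.restrict_apply_le _ _).trans (h0 x).le)

theorem ae_left (h : IsRadonProduct m n p) {P : WithBorel (X × Y) → Prop} (hP : ∀ᵐ q ∂p, P q)
    {A : Set X} {B : Set Y} (hA : IsSigmaCompact A) (hB : IsSigmaCompact B) :
    ∀ᵐ y ∂n.restrict B, ∀ᵐ x ∂m.restrict A, P (.mk (x, y)) :=
  (h.restrict hA hB).ae_left (ae_restrict_of_ae hP)

theorem ae_right (h : IsRadonProduct m n p) {P : WithBorel (X × Y) → Prop} (hP : ∀ᵐ q ∂p, P q)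
    {A : Set X} {B : Set Y} (hA : IsSigmaCompact A) (hB : IsSigmaCompact B) :
    ∀ᵐ x ∂m.restrict A, ∀ᵐ y ∂n.restrict B, P (.mk (x, y)) :=
  (h.restrict hA hB).ae_right (ae_restrict_of_ae hP)

section Supported

variable {A : Set X} {B : Set Y}

theorem lintegral_left (h : IsRadonProduct m n p) (hA : IsSigmaCompact A) (hB : IsSigmaCompact B)
    {F : WithBorel (X × Y) → ℝ≥0∞} (hF : Measurable F)
    (h0 : ∀ x y, F (.mk (x, y)) ≠ 0 → x ∈ A ∧ y ∈ B) :
    ∫⁻ q, F q ∂p = ∫⁻ y, ∫⁻ x, F (.mk (x, y)) ∂m ∂n := by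
  have e : ∫⁻ q in rect A B, F q ∂p = ∫⁻ q, F q ∂p :=
    setLIntegral_eq_of_support_subset fun q hq => h0 q.out.1 q.out.2 hq
  rw [← e, (h.restrict hA hB).lintegral_left hF]
  have e2 : ∀ y, ∫⁻ x in A, F (.mk (x, y)) ∂m = ∫⁻ x, F (.mk (x, y)) ∂m := fun y =>
    setLIntegral_eq_of_support_subset fun x hx => (h0 x y hx).1
  simp_rw [e2]
  refine setLIntegral_eq_of_support_subset fun y hy => ?_
  by_contra hB
  refine hy ((lintegral_congr fun x => ?_).trans lintegral_zero)
  by_contra hx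
  exact hB (h0 x y hx).2

theorem lintegral_right (h : IsRadonProduct m n p) (hA : IsSigmaCompact A) (hB : IsSigmaCompact B)
    {F : WithBorel (X × Y) → ℝ≥0∞} (hF : Measurable F)
    (h0 : ∀ x y, F (.mk (x, y)) ≠ 0 → x ∈ A ∧ y ∈ B) :
    ∫⁻ q, F q ∂p = ∫⁻ x, ∫⁻ y, F (.mk (x, y)) ∂n ∂m := by
  have e : ∫⁻ q in rect A B, F q ∂p = ∫⁻ q, F q ∂p :=
    setLIntegral_eq_of_support_subset fun q hq => h0 q.out.1 q.out.2 hq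
  rw [← e, (h.restrict hA hB).lintegral_right hF]
  have e2 : ∀ x, ∫⁻ y in B, F (.mk (x, y)) ∂n = ∫⁻ y, F (.mk (x, y)) ∂n := fun x =>
    setLIntegral_eq_of_support_subset fun y hy => (h0 x y hy).2
  simp_rw [e2]
  refine setLIntegral_eq_of_support_subset fun x hx => ?_
  by_contra hA
  refine hx ((lintegral_congr fun y => ?_).trans lintegral_zero)
  by_contra hy
  exact hA (h0 x y hy).1

variable {F : WithBorel (X × Y) → ℂ}

theorem integral_left (h : IsRadonProduct m n p) (hA : IsSigmaCompact A) (hB : IsSigmaCompact B)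
    (hF : Measurable F) (h0 : ∀ x y, F (.mk (x, y)) ≠ 0 → x ∈ A ∧ y ∈ B)
    (hi : Integrable F p) :
    ∫ q, F q ∂p = ∫ y, ∫ x, F (.mk (x, y)) ∂m ∂n := by
  have e : ∫ q in rect A B, F q ∂p = ∫ q, F q ∂p :=
    setIntegral_eq_integral_of_forall_compl_eq_zero fun q hq => by
      by_contra hq'
      exact hq (h0 q.out.1 q.out.2 hq')
  rw [← e, (h.restrict hA hB).integral_left hF hi.integrableOn]
  have e2 : ∀ y, ∫ x in A, F (.mk (x, y)) ∂m = ∫ x, F (.mk (x, y)) ∂m := fun y =>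
    setIntegral_eq_integral_of_forall_compl_eq_zero fun x hx => by
      by_contra hx'
      exact hx (h0 x y hx').1
  simp_rw [e2]
  refine setIntegral_eq_integral_of_forall_compl_eq_zero fun y hy => ?_
  refine (integral_congr_ae (.of_forall fun x => ?_)).trans (integral_zero _ _)
  by_contra hx
  exact hy (h0 x y hx).2

theorem integral_right (h : IsRadonProduct m n p) (hA : IsSigmaCompact A) (hB : IsSigmaCompact B)
    (hF : Measurable F) (h0 : ∀ x y, F (.mk (x, y)) ≠ 0 → x ∈ A ∧ y ∈ B)
    (hi : Integrable F p) :
    ∫ q, F q ∂p = ∫ x, ∫ y, F (.mk (x, y)) ∂n ∂m := by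
  have e : ∫ q in rect A B, F q ∂p = ∫ q, F q ∂p :=
    setIntegral_eq_integral_of_forall_compl_eq_zero fun q hq => by
      by_contra hq'
      exact hq (h0 q.out.1 q.out.2 hq')
  rw [← e, (h.restrict hA hB).integral_right hF hi.integrableOn]
  have e2 : ∀ x, ∫ y in B, F (.mk (x, y)) ∂n = ∫ y, F (.mk (x, y)) ∂n := fun x =>
    setIntegral_eq_integral_of_forall_compl_eq_zero fun y hy => by
      by_contra hy'
      exact hy (h0 x y hy').2
  simp_rw [e2]
  refine setIntegral_eq_integral_of_forall_compl_eq_zero fun x hx => ?_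
  refine (integral_congr_ae (.of_forall fun y => ?_)).trans (integral_zero _ _)
  by_contra hy
  exact hx (h0 x y hy).1

end Supported

theorem measure_rect_lt_top (h : IsRadonProduct m n p) {K : Set X} {L : Set Y}
    (hK : IsCompact K) (hL : IsCompact L) : p (rect K L) < ∞ := by
  rw [h.rect_eq K L K L hK.measurableSet hL.measurableSet hK hL subset_rfl subset_rfl]
  exact ENNReal.mul_lt_top hK.measure_lt_top hL.measure_lt_top

/-- A function whose integrals over small rectangles vanish is zero almost everywhere. -/
theorem ae_eq_zero (h : IsRadonProduct m n p) {F : WithBorel (X × Y) → ℂ} (hF : Measurable F)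
    (hi : ∀ K L, IsCompact K → IsCompact L → IntegrableOn F (rect K L) p)
    (h0 : ∀ (A : Set X) (B : Set Y) (K : Set X) (L : Set Y), MeasurableSet A → MeasurableSet B →
      IsCompact K → IsCompact L → A ⊆ K → B ⊆ L → ∫ q in rect A B, F q ∂p = 0) :
    F =ᵐ[p] 0 := by
  have hE : MeasurableSet {q | F q ≠ 0} := (measurableSet_eq_fun hF measurable_const).compl
  refine h.measure_eq_zero (E := {q | F q ≠ 0}) hE fun K L hK hL => ?_
  have hKL := measurableSet_rect hK.measurableSet hL.measurableSet
  have : IsFiniteMeasure (p.restrict (rect K L)) :=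
    isFiniteMeasure_restrict.2 (h.measure_rect_lt_top hK hL).ne
  have := h.innerRegular
  have hI : Integrable F (p.restrict (rect K L)) := hi K L hK hL
  -- The product measurable sets over which the integral vanishes contain the rectangles and are
  -- closed under complements and disjoint countable unions, so they are all product measurable
  -- sets.
  have key : ∀ R : Set (X × Y), MeasurableSet R →
      ∫ q in WithBorel.out ⁻¹' R, F q ∂(p.restrict (rect K L)) = 0 := by
    have huniv : ∫ q, F q ∂(p.restrict (rect K L)) = 0 :=
      h0 K L K L hK.measurableSet hL.measurableSet hK hL subset_rfl subset_rfl
    intro R hR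
    induction R, hR using MeasurableSpace.induction_on_inter generateFrom_prod.symm
      isPiSystem_prod with
    | empty => simp
    | basic R hR =>
      obtain ⟨A, hA, B, hB, rfl⟩ := hR
      rw [Measure.restrict_restrict (measurable_out (MeasurableSet.prod hA hB))]
      have e : WithBorel.out ⁻¹' (A ×ˢ B) ∩ rect K L = rect (A ∩ K) (B ∩ L) := by
        ext q
        simp only [rect, mem_inter_iff, mem_ofPred_eq, mem_preimage, mem_prod]
        tauto
      rw [e]
      exact h0 _ _ K L (MeasurableSet.inter hA hK.measurableSet)
        (MeasurableSet.inter hB hL.measurableSet) hK hL inter_subset_right inter_subset_right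
    | compl R hR ih =>
      rw [preimage_compl]
      have := integral_add_compl (measurable_out hR) hI
      rwa [ih, zero_add, huniv] at this
    | iUnion f hfd hfm ih =>
      rw [preimage_iUnion, integral_iUnion (fun i => measurable_out (hfm i))
        (fun i j hij => (hfd hij).preimage _) hI.integrableOn]
      simp [ih]
  have hz : F =ᵐ[p.restrict (rect K L)] 0 := by
    refine hI.ae_eq_zero_of_forall_setIntegral_eq_zero fun E hE _ => ?_
    -- Passage from product measurable sets to Borel sets.
    obtain ⟨R, hR, hER⟩ := exists_product_measurableSet (p.restrict (rect K L)) hE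
    rw [setIntegral_congr_set hER]
    exact key R hR
  rw [← Measure.restrict_apply hE]
  exact hz

end IsRadonProduct

end Radon

/-! ### Products of Haar measures -/

section HaarProduct

variable {X Y : Type*} [Group X] [TopologicalSpace X] [IsTopologicalGroup X]
  [LocallyCompactSpace X] [T2Space X] [MeasurableSpace X] [BorelSpace X]
  [Group Y] [TopologicalSpace Y] [IsTopologicalGroup Y]
  [LocallyCompactSpace Y] [T2Space Y] [MeasurableSpace Y] [BorelSpace Y]

theorem continuous_fst_out : Continuous fun q : WithBorel (X × Y) => q.out.1 :=
  continuous_fst.comp WithBorel.continuous_out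

theorem continuous_snd_out : Continuous fun q : WithBorel (X × Y) => q.out.2 :=
  continuous_snd.comp WithBorel.continuous_out

/-- For fixed relatively compact `B`, the set function $A\mapsto r(A\times B)$ is an inner regular
left invariant measure that is finite on compact sets, hence a multiple of `m` by uniqueness of Haar
measure. -/
theorem exists_radonHaar_rect_left (m : Measure X) [m.IsHaarMeasure] [m.InnerRegular] {B L : Set Y}
    (hB : MeasurableSet B) (hL : IsCompact L) (hBL : B ⊆ L) :
    ∃ c : NNReal, ∀ A : Set X, MeasurableSet A →
      radonHaar (WithBorel (X × Y)) (rect A B) = c * m A := by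
  set r := radonHaar (WithBorel (X × Y))
  set r' : Measure X := (r.restrict (rect univ B)).map (fun q => q.out.1) with hr'
  have happ : ∀ A : Set X, MeasurableSet A → r' A = r (rect A B) := by
    intro A hA
    rw [hr', Measure.map_apply continuous_fst_out.measurable hA,
      Measure.restrict_apply (continuous_fst_out.measurable hA)]
    congr 1
    ext q
    simp [rect]
  have : (r.restrict (rect univ B)).InnerRegular :=
    innerRegular_restrict _ (measurableSet_rect .univ hB)
  have i1 : r'.InnerRegular := InnerRegular.map_of_continuous continuous_fst_out
  have i2 : r'.IsMulLeftInvariant := by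
    refine ⟨fun g => ?_⟩
    ext A hA
    rw [Measure.map_apply (measurable_const_mul g) hA, happ _ (measurable_const_mul g hA), happ _ hA,
      ← measure_preimage_mul r (WithBorel.mk (g, (1 : Y))) (rect A B)]
    congr 1
    ext q
    change _ ↔ g * q.out.1 ∈ A ∧ 1 * q.out.2 ∈ B
    rw [one_mul]
    rfl
  have i3 : IsFiniteMeasureOnCompacts r' := by
    refine ⟨fun K hK => ?_⟩
    rw [happ K hK.measurableSet]
    refine (measure_mono ?_).trans_lt (isCompact_rect hK hL).measure_lt_top
    exact fun q hq => ⟨hq.1, hBL hq.2⟩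
  refine ⟨haarScalarFactor r' m, fun A hA => ?_⟩
  rw [← happ A hA]
  conv_lhs => rw [isMulLeftInvariant_eq_smul_of_innerRegular r' m]
  rfl

theorem exists_radonHaar_rect_right (n : Measure Y) [n.IsHaarMeasure] [n.InnerRegular] {A K : Set X}
    (hA : MeasurableSet A) (hK : IsCompact K) (hAK : A ⊆ K) :
    ∃ c : NNReal, ∀ B : Set Y, MeasurableSet B →
      radonHaar (WithBorel (X × Y)) (rect A B) = c * n B := by
  set r := radonHaar (WithBorel (X × Y))
  set r' : Measure Y := (r.restrict (rect A univ)).map (fun q => q.out.2) with hr'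
  have happ : ∀ B : Set Y, MeasurableSet B → r' B = r (rect A B) := by
    intro B hB
    rw [hr', Measure.map_apply continuous_snd_out.measurable hB,
      Measure.restrict_apply (continuous_snd_out.measurable hB)]
    congr 1
    ext q
    simp [rect, and_comm]
  have : (r.restrict (rect A univ)).InnerRegular :=
    innerRegular_restrict _ (measurableSet_rect hA .univ)
  have i1 : r'.InnerRegular := InnerRegular.map_of_continuous continuous_snd_out
  have i2 : r'.IsMulLeftInvariant := by
    refine ⟨fun g => ?_⟩
    ext B hB
    rw [Measure.map_apply (measurable_const_mul g) hB, happ _ (measurable_const_mul g hB), happ _ hB,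
      ← measure_preimage_mul r (WithBorel.mk ((1 : X), g)) (rect A B)]
    congr 1
    ext q
    change _ ↔ 1 * q.out.1 ∈ A ∧ g * q.out.2 ∈ B
    rw [one_mul]
    rfl
  have i3 : IsFiniteMeasureOnCompacts r' := by
    refine ⟨fun L hL => ?_⟩
    rw [happ L hL.measurableSet]
    refine (measure_mono ?_).trans_lt (isCompact_rect hK hL).measure_lt_top
    exact fun q hq => ⟨hAK hq.1, hq.2⟩
  refine ⟨haarScalarFactor r' n, fun B hB => ?_⟩
  rw [← happ B hB]
  conv_lhs => rw [isMulLeftInvariant_eq_smul_of_innerRegular r' n]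
  rfl

theorem exists_isRadonProduct (m : Measure X) (n : Measure Y) [m.IsHaarMeasure] [m.InnerRegular]
    [n.IsHaarMeasure] [n.InnerRegular] :
    ∃ c : NNReal, c ≠ 0 ∧ IsRadonProduct m n (c • radonHaar (WithBorel (X × Y))) := by
  obtain ⟨K, hK, hK1⟩ := exists_compact_mem_nhds (1 : X)
  obtain ⟨L, hL, hL1⟩ := exists_compact_mem_nhds (1 : Y)
  obtain ⟨t, ht⟩ := exists_radonHaar_rect_right n hK.measurableSet hK subset_rfl
  have hmK : m K ≠ 0 := (measure_pos_of_mem_nhds m hK1).ne'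
  have ht0 : t ≠ 0 := by
    rintro rfl
    have h1 := ht L hL.measurableSet
    simp only [ENNReal.coe_zero, zero_mul] at h1
    refine (measure_pos_of_mem_nhds (radonHaar (WithBorel (X × Y)))
      (x := (1 : WithBorel (X × Y))) ?_).ne' h1
    exact prod_mem_nhds hK1 hL1
  -- With $r(A\times B)=s\,m(A)$ and $r(K\times B)=t\,n(B)$, taking $A=K$ gives $s\,m(K)=t\,n(B)$.
  -- Hence $m(K)/t$ is the factor that turns $r(A\times B)$ into $m(A)n(B)$.
  refine ⟨(m K).toNNReal / t, ?_, ⟨inferInstance, ?_⟩⟩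
  · exact div_ne_zero (by simp [ENNReal.toNNReal_eq_zero_iff, hmK, hK.measure_lt_top.ne]) ht0
  · intro A B K' L' hA hB _ hL' _ hBL
    obtain ⟨s, hs⟩ := exists_radonHaar_rect_left m hB hL' hBL
    have e1 := ht B hB
    rw [hs K hK.measurableSet] at e1
    rw [Measure.smul_apply, ENNReal.smul_def, smul_eq_mul, hs A hA, ENNReal.coe_div ht0, ENNReal.coe_toNNReal hK.measure_lt_top.ne]
    have ht' : (t : ℝ≥0∞) ≠ 0 := by simpa using ht0
    calc m K / t * (s * m A) = (s * m K) / t * m A := by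
          rw [div_eq_mul_inv, div_eq_mul_inv]; ring
      _ = (t * n B) / t * m A := by rw [e1]
      _ = m A * n B := by
        rw [mul_comm (t : ℝ≥0∞), ENNReal.mul_div_cancel_right ht' ENNReal.coe_ne_top, mul_comm]

variable (m : Measure X) (n : Measure Y) [m.IsHaarMeasure] [m.InnerRegular]
    [n.IsHaarMeasure] [n.InnerRegular]

/-- The Radon product of two inner regular Haar measures. -/
def prodHaar : Measure (WithBorel (X × Y)) :=
  (exists_isRadonProduct m n).choose • radonHaar (WithBorel (X × Y))

theorem isRadonProduct_prodHaar : IsRadonProduct m n (prodHaar m n) :=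
  (exists_isRadonProduct m n).choose_spec.2

instance : (prodHaar m n).IsHaarMeasure :=
  IsHaarMeasure.nnreal_smul _ (exists_isRadonProduct m n).choose_spec.1

instance : (prodHaar m n).InnerRegular := (isRadonProduct_prodHaar m n).innerRegular

theorem ae_prodHaar : ae (prodHaar m n) = ae (radonHaar (WithBorel (X × Y))) := by
  ext s
  have := (exists_isRadonProduct m n).choose_spec.1
  simp [mem_ae_iff, prodHaar, this]

end HaarProduct

/-! ### The dual of `L^1` -/

section DualL1

variable {Ω : Type*} [MeasurableSpace Ω]

/-- The functional `f ↦ ∫ q f` on `L^1`, for a bounded measurable function `q`. -/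
def mulIntegral (m : Measure Ω) (q : Ω → ℂ) (hq : Measurable q) (C : ℝ) (hC : ∀ x, ‖q x‖ ≤ C) :
    Lp ℂ 1 m →L[ℂ] ℂ :=
  LinearMap.mkContinuous
    { toFun := fun f => ∫ x, q x * f x ∂m
      map_add' := fun f g => by
        have hi : ∀ f : Lp ℂ 1 m, Integrable (fun x => q x * f x) m := fun f =>
          (L1.integrable_coeFn f).bdd_mul hq.aestronglyMeasurable (.of_forall hC)
        rw [← integral_add (hi f) (hi g)]
        refine integral_congr_ae ?_
        filter_upwards [Lp.coeFn_add f g] with x e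
        rw [e, Pi.add_apply, mul_add]
      map_smul' := fun c f => by
        rw [RingHom.id_apply, smul_eq_mul, ← integral_const_mul]
        refine integral_congr_ae ?_
        filter_upwards [Lp.coeFn_smul c f] with x e
        rw [e, Pi.smul_apply, smul_eq_mul]
        ring } C (fun f => by
      change ‖∫ x, q x * f x ∂m‖ ≤ C * ‖f‖
      rw [L1.norm_eq_integral_norm, ← integral_const_mul]
      refine norm_integral_le_of_norm_le ((L1.integrable_coeFn f).norm.const_mul C)
        (.of_forall fun x => ?_)
      rw [norm_mul]
      exact mul_le_mul_of_nonneg_right (hC x) (norm_nonneg _))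

theorem mulIntegral_apply (m : Measure Ω) (q : Ω → ℂ) (hq : Measurable q) (C : ℝ)
    (hC : ∀ x, ‖q x‖ ≤ C) (f : Lp ℂ 1 m) : mulIntegral m q hq C hC f = ∫ x, q x * f x ∂m := rfl

/-- The inclusion of `L^2` into `L^1` for a finite measure. -/
def l2ToL1 (m : Measure Ω) [IsFiniteMeasure m] : Lp ℂ 2 m →L[ℂ] Lp ℂ 1 m :=
  LinearMap.mkContinuous
    { toFun := fun f => ((Lp.memLp f).mono_exponent one_le_two).toLp f
      map_add' := fun f g => by
        refine Lp.ext ?_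
        filter_upwards [((Lp.memLp (f + g)).mono_exponent one_le_two).coeFn_toLp,
          ((Lp.memLp f).mono_exponent one_le_two).coeFn_toLp,
          ((Lp.memLp g).mono_exponent one_le_two).coeFn_toLp, Lp.coeFn_add f g,
          Lp.coeFn_add (((Lp.memLp f).mono_exponent one_le_two).toLp f)
          (((Lp.memLp g).mono_exponent one_le_two).toLp g)] with x e1 e2 e3 e4 e5
        rw [e1, e4, e5, Pi.add_apply, Pi.add_apply, e2, e3]
      map_smul' := fun c f => by
        refine Lp.ext ?_
        filter_upwards [((Lp.memLp (c • f)).mono_exponent one_le_two).coeFn_toLp,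
          ((Lp.memLp f).mono_exponent one_le_two).coeFn_toLp, Lp.coeFn_smul c f,
          Lp.coeFn_smul c (((Lp.memLp f).mono_exponent one_le_two).toLp f)] with x e1 e2 e3 e4
        rw [e1, e3, RingHom.id_apply, e4, Pi.smul_apply, Pi.smul_apply, e2] }
    ((m univ ^ (1 / (1 : ℝ≥0∞).toReal - 1 / (2 : ℝ≥0∞).toReal)).toReal) (fun f => by
      change ‖((Lp.memLp f).mono_exponent one_le_two).toLp f‖ ≤ _
      rw [Lp.norm_toLp, Lp.norm_def, mul_comm, ← ENNReal.toReal_mul]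
      refine ENNReal.toReal_mono (ENNReal.mul_ne_top (Lp.eLpNorm_ne_top f) ?_)
        (eLpNorm_le_eLpNorm_mul_rpow_measure_univ one_le_two (Lp.aestronglyMeasurable f))
      refine ENNReal.rpow_ne_top_of_nonneg (by norm_num) (measure_ne_top _ _))

theorem l2ToL1_coeFn (m : Measure Ω) [IsFiniteMeasure m] (f : Lp ℂ 2 m) : l2ToL1 m f =ᵐ[m] f :=
  ((Lp.memLp f).mono_exponent one_le_two).coeFn_toLp

/-- Functionals on `L^1` of a finite measure are represented by bounded functions. -/
theorem exists_representation_of_finite (m : Measure Ω) [IsFiniteMeasure m]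
    (Ψ : Lp ℂ 1 m →L[ℂ] ℂ) :
    ∃ q : Ω → ℂ, Measurable q ∧ (∀ x, ‖q x‖ ≤ ‖Ψ‖) ∧
      ∀ f : Lp ℂ 1 m, Ψ f = ∫ x, q x * f x ∂m := by
  -- The restriction of the functional to $L^2$ is an inner product with `v`, so the conjugate of
  -- `v` is the candidate density.
  set v := (InnerProductSpace.toDual ℂ (Lp ℂ 2 m)).symm (Ψ.comp (l2ToL1 m))
  set q : Ω → ℂ := fun x => starRingEnd ℂ (v x) with hqdef
  have hq : Measurable q :=
    Complex.continuous_conj.measurable.comp (Lp.stronglyMeasurable v).measurable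
  have h1 : ∀ g : Lp ℂ 2 m, Ψ (l2ToL1 m g) = ∫ x, q x * g x ∂m := by
    intro g
    have : inner ℂ v g = Ψ (l2ToL1 m g) := InnerProductSpace.toDual_symm_apply
    rw [← this, L2.inner_def]
    refine integral_congr_ae (.of_forall fun x => ?_)
    simp [hqdef, mul_comm]
  have h2 : ∀ (g : Ω → ℂ) (hg : MemLp g 2 m) (hg1 : MemLp g 1 m),
      Ψ (hg1.toLp g) = ∫ x, q x * g x ∂m := by
    intro g hg hg1
    have e : hg1.toLp g = l2ToL1 m (hg.toLp g) := by
      refine Lp.ext ?_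
      filter_upwards [hg1.coeFn_toLp, l2ToL1_coeFn m (hg.toLp g), hg.coeFn_toLp] with x e1 e2 e3
      rw [e1, e2, e3]
    rw [e, h1]
    refine integral_congr_ae ?_
    filter_upwards [hg.coeFn_toLp] with x e3
    rw [e3]
  set E : Set Ω := {x | ‖Ψ‖ < ‖q x‖} with hE
  have hEm : MeasurableSet E := measurableSet_lt measurable_const hq.norm
  have hqi : Integrable q m := by
    have : MemLp q 2 m := (Lp.memLp v).star
    exact memLp_one_iff_integrable.1 (this.mono_exponent one_le_two)
  -- Testing with the conjugate phase of `q` on `E` gives $\int_E|q|\le\|\Psi\|\,m(E)$, although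
  -- $|q|>\|\Psi\|$ on `E`.
  have hE0 : m E = 0 := by
    set g : Ω → ℂ := E.indicator (fun x => starRingEnd ℂ (q x) / (‖q x‖ : ℂ)) with hg
    have hgm : Measurable g := Measurable.indicator
      ((Complex.continuous_conj.measurable.comp hq).div
        (Complex.measurable_ofReal.comp hq.norm)) hEm
    have hgb : ∀ x, ‖g x‖ ≤ E.indicator (fun _ => (1 : ℝ)) x := by
      intro x
      by_cases hx : x ∈ E
      · simp only [hg, indicator_of_mem hx, norm_div, RCLike.norm_conj, Complex.norm_real,
          norm_norm]
        exact div_self_le_one _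
      · simp [hg, indicator_of_notMem hx]
    have hgb' : ∀ x, ‖g x‖ ≤ 1 := fun x => (hgb x).trans (indicator_le_self' (by simp) x)
    have hg2 : MemLp g 2 m := MemLp.of_bound hgm.aestronglyMeasurable 1 (.of_forall hgb')
    have hg1 : MemLp g 1 m := MemLp.of_bound hgm.aestronglyMeasurable 1 (.of_forall hgb')
    have e1 := h2 g hg2 hg1
    have e2 : ∫ x, q x * g x ∂m = ((∫ x in E, ‖q x‖ ∂m : ℝ) : ℂ) := by
      rw [← integral_indicator hEm]
      refine Eq.trans ?_ (integral_ofReal (𝕜 := ℂ))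
      refine integral_congr_ae (.of_forall fun x => ?_)
      by_cases hx : x ∈ E
      · have : (‖q x‖ : ℂ) ≠ 0 := by
          rw [Complex.ofReal_ne_zero]
          exact ((norm_nonneg Ψ).trans_lt hx).ne'
        simp only [hg, indicator_of_mem hx]
        rw [← mul_div_assoc, Complex.mul_conj, Complex.normSq_eq_norm_sq]
        push_cast
        field_simp
        rfl
      · simp [hg, indicator_of_notMem hx]
    have e3 : ∫ x in E, ‖q x‖ ∂m ≤ ∫ x in E, ‖Ψ‖ ∂m := by
      have e4 : ‖hg1.toLp g‖ ≤ m.real E := by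
        rw [L1.norm_eq_integral_norm]
        calc ∫ x, ‖hg1.toLp g x‖ ∂m = ∫ x, ‖g x‖ ∂m := by
              refine integral_congr_ae ?_
              filter_upwards [hg1.coeFn_toLp] with x e
              rw [e]
          _ ≤ ∫ x, E.indicator (fun _ => (1 : ℝ)) x ∂m :=
              integral_mono (memLp_one_iff_integrable.1 hg1).norm
                ((integrable_const _).indicator hEm) hgb
          _ = m.real E := by simp [integral_indicator hEm]
      have e5 := (Ψ.le_opNorm (hg1.toLp g)).trans
        (mul_le_mul_of_nonneg_left e4 (norm_nonneg Ψ))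
      rw [e1, e2, Complex.norm_real, Real.norm_eq_abs] at e5
      rw [setIntegral_const, smul_eq_mul, mul_comm]
      exact (le_abs_self _).trans e5
    by_contra hne
    have hi : IntegrableOn (fun x => ‖q x‖ - ‖Ψ‖) E m :=
      (hqi.norm.sub (integrable_const _)).integrableOn
    have h3 : 0 < ∫ x in E, (‖q x‖ - ‖Ψ‖) ∂m := by
      rw [setIntegral_pos_iff_support_of_nonneg_ae ?_ hi]
      · refine (pos_iff_ne_zero.2 hne).trans_le (measure_mono fun x hx => ?_)
        exact ⟨(sub_pos.2 hx).ne', hx⟩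
      · filter_upwards [ae_restrict_mem hEm] with x hx
        exact (sub_pos.2 hx).le
    rw [integral_sub hqi.norm.integrableOn (integrable_const _)] at h3
    linarith
  -- Setting the density to zero on the null set `E` makes the bound hold at every point.
  have hq' : Measurable (Eᶜ.indicator q) := hq.indicator hEm.compl
  have hb : ∀ x, ‖Eᶜ.indicator q x‖ ≤ ‖Ψ‖ := by
    intro x
    by_cases hx : x ∈ Eᶜ
    · rw [indicator_of_mem hx]; exact not_lt.1 hx
    · rw [indicator_of_notMem hx, norm_zero]; exact norm_nonneg _
  have hqq : Eᶜ.indicator q =ᵐ[m] q := by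
    filter_upwards [measure_eq_zero_iff_ae_notMem.1 hE0] with x hx
    exact indicator_of_mem (show x ∈ Eᶜ from hx) _
  refine ⟨Eᶜ.indicator q, hq', hb, fun f => ?_⟩
  rw [← mulIntegral_apply m _ hq' _ hb]
  refine Lp.induction ENNReal.one_ne_top (fun f => Ψ f = mulIntegral m _ hq' _ hb f)
    ?_ ?_ (isClosed_eq Ψ.continuous (mulIntegral m _ hq' _ hb).continuous) f
  · intro c s hs hμs
    rw [Lp.simpleFunc.coe_indicatorConst, indicatorConstLp,
      h2 _ (memLp_indicator_const 2 hs c (.inr hμs.ne)), mulIntegral_apply]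
    refine integral_congr_ae ?_
    filter_upwards [hqq, (memLp_indicator_const 1 hs c (.inr hμs.ne)).coeFn_toLp] with x e1 e2
    rw [e1, e2]
  · intro f g hf hg _ h1 h2
    rw [map_add, map_add, h1, h2]

theorem memLp_mul_density (m : Measure Ω) (w : Ω → NNReal) (hw : Measurable w)
    (f : Lp ℂ 1 (m.withDensity fun x => (w x : ℝ≥0∞))) :
    MemLp (fun x => (w x : ℂ) * f x) 1 m := by
  have hf := (Lp.stronglyMeasurable f).measurable
  refine ⟨(Measurable.mul (by fun_prop) hf).aestronglyMeasurable, ?_⟩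
  have h1 := (Lp.memLp f).2
  rw [eLpNorm_one_eq_lintegral_enorm] at h1 ⊢
  rw [lintegral_withDensity_eq_lintegral_mul _ hw.coe_nnreal_ennreal hf.enorm] at h1
  refine (lintegral_congr fun x => ?_).trans_lt h1
  rw [enorm_mul, Pi.mul_apply]
  congr 1
  rw [enorm_eq_nnnorm]
  simp

/-- Multiplication by a density `w`, from `L^1(w m)` to `L^1(m)`. -/
def mulDensity (m : Measure Ω) (w : Ω → NNReal) (hw : Measurable w) :
    Lp ℂ 1 (m.withDensity fun x => (w x : ℝ≥0∞)) →ₗ[ℂ] Lp ℂ 1 m where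
  toFun f := (memLp_mul_density m w hw f).toLp
  map_add' f g := by
    have h1 := (ae_withDensity_iff hw.coe_nnreal_ennreal).1 (Lp.coeFn_add f g)
    refine Lp.ext ?_
    filter_upwards [(memLp_mul_density m w hw (f + g)).coeFn_toLp, h1,
      Lp.coeFn_add (memLp_mul_density m w hw f).toLp (memLp_mul_density m w hw g).toLp,
      (memLp_mul_density m w hw f).coeFn_toLp,
      (memLp_mul_density m w hw g).coeFn_toLp] with x e1 e2 e3 e4 e5
    rw [e1, e3, Pi.add_apply, e4, e5]
    by_cases hx : w x = 0
    · simp [hx]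
    · rw [e2 (by simpa using hx), Pi.add_apply, mul_add]
  map_smul' c f := by
    have h1 := (ae_withDensity_iff hw.coe_nnreal_ennreal).1 (Lp.coeFn_smul c f)
    refine Lp.ext ?_
    filter_upwards [(memLp_mul_density m w hw (c • f)).coeFn_toLp, h1,
      Lp.coeFn_smul c (memLp_mul_density m w hw f).toLp,
      (memLp_mul_density m w hw f).coeFn_toLp] with x e1 e2 e3 e4
    rw [e1, RingHom.id_apply, e3, Pi.smul_apply, e4]
    by_cases hx : w x = 0
    · simp [hx]
    · rw [e2 (by simpa using hx), Pi.smul_apply, smul_eq_mul, smul_eq_mul]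
      ring

theorem mulDensity_coeFn (m : Measure Ω) (w : Ω → NNReal) (hw : Measurable w)
    (f : Lp ℂ 1 (m.withDensity fun x => (w x : ℝ≥0∞))) :
    mulDensity m w hw f =ᵐ[m] fun x => (w x : ℂ) * f x := (memLp_mul_density m w hw f).coeFn_toLp

theorem norm_mulDensity (m : Measure Ω) (w : Ω → NNReal) (hw : Measurable w)
    (f : Lp ℂ 1 (m.withDensity fun x => (w x : ℝ≥0∞))) : ‖mulDensity m w hw f‖ = ‖f‖ := by
  change ‖(memLp_mul_density m w hw f).toLp‖ = _
  rw [Lp.norm_toLp, Lp.norm_def, eLpNorm_one_eq_lintegral_enorm, eLpNorm_one_eq_lintegral_enorm,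
    lintegral_withDensity_eq_lintegral_mul _ hw.coe_nnreal_ennreal
      (Lp.stronglyMeasurable f).measurable.enorm]
  congr 1
  refine lintegral_congr fun x => ?_
  rw [enorm_mul, Pi.mul_apply]
  congr 1
  rw [enorm_eq_nnnorm]
  simp

/-- Local representation of a functional on `L^1`. -/
theorem exists_representation_of_density (m : Measure Ω) (w : Ω → NNReal) (hw : Measurable w)
    (hwi : ∫⁻ x, w x ∂m ≠ ∞) (Φ : Lp ℂ 1 m →L[ℂ] ℂ) :
    ∃ q : Ω → ℂ, Measurable q ∧ (∀ x, ‖q x‖ ≤ ‖Φ‖) ∧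
      ∀ f : Lp ℂ 1 m, (∀ᵐ x ∂m, w x = 0 → f x = 0) → Φ f = ∫ x, q x * f x ∂m := by
  have : IsFiniteMeasure (m.withDensity fun x => (w x : ℝ≥0∞)) := isFiniteMeasure_withDensity hwi
  set T : Lp ℂ 1 (m.withDensity fun x => (w x : ℝ≥0∞)) →L[ℂ] Lp ℂ 1 m :=
    (mulDensity m w hw).mkContinuous 1 (fun f => by rw [norm_mulDensity, one_mul]) with hT
  obtain ⟨q, hq, hqb, hq2⟩ := exists_representation_of_finite
    (m.withDensity fun x => (w x : ℝ≥0∞)) (Φ.comp T)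
  refine ⟨q, hq, fun x => (hqb x).trans ?_, fun f hf => ?_⟩
  · refine ContinuousLinearMap.opNorm_le_bound _ (norm_nonneg _) fun g => ?_
    have := Φ.le_opNorm (T g)
    have e : ‖T g‖ = ‖g‖ := norm_mulDensity m w hw g
    rwa [e] at this
  · have hfm := (Lp.stronglyMeasurable f).measurable
    have hwm : Measurable fun x => (w x : ℂ) := by fun_prop
    -- Multiplication by `w` is an isometry of $L^1(w\,m)$ into $L^1(m)$ and takes $f/w$ back to
    -- $f$, because $f$ vanishes wherever $w$ does. Thus the finite case for $w\,m$ represents `Φ`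
    -- at `f`.
    have hg : MemLp (fun x => f x / (w x : ℂ)) 1 (m.withDensity fun x => (w x : ℝ≥0∞)) := by
      refine ⟨(hfm.div hwm).aestronglyMeasurable, ?_⟩
      have h1 := (Lp.memLp f).2
      rw [eLpNorm_one_eq_lintegral_enorm] at h1 ⊢
      have h2 := lintegral_withDensity_eq_lintegral_mul m hw.coe_nnreal_ennreal (hfm.div hwm).enorm
      simp only [Pi.div_apply] at h2
      rw [h2]
      refine (lintegral_mono fun x => ?_).trans_lt h1
      rw [Pi.mul_apply]
      have e : (w x : ℝ≥0∞) = ‖(w x : ℂ)‖ₑ := by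
        rw [enorm_eq_nnnorm]
        simp
      rw [e, ← enorm_mul]
      by_cases hx : (w x : ℂ) = 0
      · simp [hx]
      · rw [mul_div_cancel₀ _ hx]
    have e : T (hg.toLp _) = f := by
      refine Lp.ext ?_
      have h1 := (ae_withDensity_iff hw.coe_nnreal_ennreal).1 hg.coeFn_toLp
      filter_upwards [mulDensity_coeFn m w hw (hg.toLp _), h1, hf] with x e1 e2 e3
      rw [hT, LinearMap.mkContinuous_apply, e1]
      by_cases hx : w x = 0
      · rw [hx, e3 hx]; simp
      · rw [e2 (by simpa using hx), mul_div_cancel₀ _ (by simpa using hx)]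
    have h2 := hq2 (hg.toLp _)
    rw [ContinuousLinearMap.comp_apply, e] at h2
    rw [h2]
    calc ∫ x, q x * hg.toLp _ x ∂(m.withDensity fun x => (w x : ℝ≥0∞))
        = ∫ x, q x * (f x / (w x : ℂ)) ∂(m.withDensity fun x => (w x : ℝ≥0∞)) := by
          refine integral_congr_ae ?_
          filter_upwards [hg.coeFn_toLp] with x e
          rw [e]
      _ = ∫ x, w x • (q x * (f x / (w x : ℂ))) ∂m := by
          rw [integral_withDensity_eq_integral_smul hw]
      _ = _ := by
          refine integral_congr_ae ?_
          filter_upwards [hf] with x hx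
          by_cases hx0 : w x = 0
          · simp [hx hx0]
          · have : (w x : ℂ) ≠ 0 := by simpa using hx0
            rw [NNReal.smul_def, Complex.real_smul]
            field_simp

end DualL1

/-! ### Clopen partitions, approximation by continuous functions, gluing. -/

section Partition

open Pointwise in
/-- A locally compact group is partitioned into `σ`-compact open sets. -/
theorem exists_partition (H : Type*) [Group H] [TopologicalSpace H] [IsTopologicalGroup H]
    [LocallyCompactSpace H] :
    ∃ c : H → Set H, ∀ i, IsOpen (c ⁻¹' {i}) ∧ IsSigmaCompact (c ⁻¹' {i}) := by
  obtain ⟨V, hV, hV1⟩ := exists_compact_mem_nhds (1 : H)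
  -- The powers of the compact symmetric neighbourhood `W` form an open $\sigma$-compact subgroup
  -- `S`. A point is labelled by its left coset of `S`; labels that are not cosets have empty
  -- fibres.
  set W := V ∪ V⁻¹ with hW
  have hWc : IsCompact W := hV.union hV.inv
  have hWi : W⁻¹ = W := by rw [hW, union_inv, inv_inv, union_comm]
  have hpow : ∀ n : ℕ, IsCompact (W ^ n) := by
    intro n
    induction n with
    | zero => rw [pow_zero]; exact isCompact_singleton
    | succ n ih => rw [pow_succ]; exact ih.mul hWc
  let S : Subgroup H :=
    { carrier := ⋃ n : ℕ, W ^ n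
      one_mem' := mem_iUnion.2 ⟨0, by simp⟩
      mul_mem' := by
        intro a b ha hb
        obtain ⟨k, hk⟩ := mem_iUnion.1 ha
        obtain ⟨l, hl⟩ := mem_iUnion.1 hb
        exact mem_iUnion.2 ⟨k + l, by rw [pow_add]; exact mul_mem_mul hk hl⟩
      inv_mem' := by
        intro a ha
        obtain ⟨k, hk⟩ := mem_iUnion.1 ha
        refine mem_iUnion.2 ⟨k, ?_⟩
        have h1 : a⁻¹ ∈ (W ^ k)⁻¹ := inv_mem_inv.2 hk
        rwa [← inv_pow, hWi] at h1 }
  have hSc : IsSigmaCompact (S : Set H) := isSigmaCompact_iUnion_of_isCompact _ hpow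
  have hSo : IsOpen (S : Set H) := by
    refine Subgroup.isOpen_of_mem_nhds S (g := 1) (mem_of_superset hV1 fun x hx => ?_)
    exact mem_iUnion.2 ⟨1, by rw [pow_one]; exact .inl hx⟩
  refine ⟨fun x => x • (S : Set H), fun i => ?_⟩
  by_cases hi : ∃ a : H, i = a • (S : Set H)
  · obtain ⟨a, rfl⟩ := hi
    have e : (fun x : H => x • (S : Set H)) ⁻¹' {a • (S : Set H)} = a • (S : Set H) := by
      ext x
      rw [mem_preimage, mem_singleton_iff, leftCoset_eq_iff, mem_leftCoset_iff,
        ← inv_mem_iff (H := S)]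
      simp
    rw [e]
    exact ⟨hSo.leftCoset a, hSc.image (continuous_const_mul a)⟩
  · have e : (fun x : H => x • (S : Set H)) ⁻¹' {i} = ∅ := by
      ext x
      simp only [mem_preimage, mem_singleton_iff, mem_empty_iff_false, iff_false]
      exact fun h => hi ⟨x, h.symm⟩
    rw [e]
    exact ⟨isOpen_empty, isSigmaCompact_empty⟩

variable {X : Type*} [TopologicalSpace X] [T2Space X] [MeasurableSpace X] [BorelSpace X]
  {m : Measure X} [IsFiniteMeasureOnCompacts m] [m.InnerRegular]

theorem exists_monotone_compacts {A : Set X} (hA : IsSigmaCompact A) :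
    ∃ K : ℕ → Set X, (∀ n, IsCompact (K n)) ∧ Monotone K ∧ ⋃ n, K n = A := by
  obtain ⟨K, hK, rfl⟩ := hA
  refine ⟨Set.accumulate K, fun n => ?_, monotone_accumulate, iUnion_accumulate⟩
  exact (finite_le_nat n).isCompact_biUnion fun i _ => hK i

/-- The cells are open and disjoint, so a compact set meets only finitely many. This is what allows
local statements to be combined when there are uncountably many cells. -/
theorem finite_image_of_partition {ι : Type*} {c : X → ι} (hc : ∀ i, IsOpen (c ⁻¹' {i})) {K : Set X}
    (hK : IsCompact K) : (c '' K).Finite := by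
  obtain ⟨t, ht⟩ := hK.elim_finite_subcover (fun i => c ⁻¹' {i}) hc
    (fun x _ => mem_iUnion.2 ⟨c x, rfl⟩)
  refine t.finite_toSet.subset ?_
  rintro _ ⟨x, hx, rfl⟩
  obtain ⟨i, hi, hxi⟩ := mem_iUnion₂.1 (ht hx)
  rwa [mem_singleton_iff.1 hxi]

/-- A property holds almost everywhere if it does on each set of a partition into open sets. -/
theorem ae_of_partition {ι : Type*} {c : X → ι} (hc : ∀ i, IsOpen (c ⁻¹' {i})) {P : X → Prop}
    (hP : MeasurableSet {x | P x}) (h : ∀ i, ∀ᵐ x ∂m.restrict (c ⁻¹' {i}), P x) :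
    ∀ᵐ x ∂m, P x := by
  refine measure_eq_zero_of_forall_isCompact m (E := {x | P x}ᶜ) hP.compl fun K hK => ?_
  refine measure_mono_null (t := ⋃ i ∈ c '' K, {x | P x}ᶜ ∩ c ⁻¹' {i}) ?_ ?_
  · rintro x ⟨hx, hxK⟩
    exact mem_iUnion₂.2 ⟨c x, mem_image_of_mem _ hxK, hx, rfl⟩
  · refine (measure_biUnion_null_iff (finite_image_of_partition hc hK).countable).2 fun i _ => ?_
    rw [← Measure.restrict_apply hP.compl]
    exact h i

theorem restrict_compact_regular {K : Set X} (hK : IsCompact K) : (m.restrict K).Regular := by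
  have : IsFiniteMeasure (m.restrict K) := isFiniteMeasure_restrict.2 hK.measure_lt_top.ne
  have : (m.restrict K).InnerRegular := innerRegular_restrict m hK.measurableSet
  infer_instance

variable [LocallyCompactSpace X]

/-- Continuous functions with compact support are dense in `L^1` of an inner regular measure. -/
theorem exists_hasCompactSupport_sub_le {f : X → ℂ} (hf : MemLp f 1 m) {ε : ℝ≥0∞} (hε : ε ≠ 0) :
    ∃ g : X → ℂ, eLpNorm (f - g) 1 m ≤ ε ∧ Continuous g ∧ HasCompactSupport g := by
  refine hf.induction_dense ENNReal.one_ne_top (fun g => Continuous g ∧ HasCompactSupport g)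
    ?_ ?_ ?_ hε
  · intro z s hs hms ε hε
    rcases eq_or_ne z 0 with rfl | hz
    · exact ⟨0, by simp, continuous_zero, HasCompactSupport.zero⟩
    have hδ : ε / 2 / ‖z‖ₑ ≠ 0 :=
      (ENNReal.div_pos (ENNReal.div_pos hε (by simp)).ne' (by simp)).ne'
    obtain ⟨K, hKs, hK, hKm⟩ := hs.exists_isCompact_sdiff_lt hms.ne hδ
    -- The measure need not be outer regular, but its restriction to a compact neighbourhood `L` of
    -- `K` is. The open set `U` is chosen there, and the cut-off function vanishes off `U ∩ interior
    -- L`.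
    obtain ⟨L, hL, hKL⟩ := exists_compact_superset hK
    have := restrict_compact_regular (m := m) hL
    have hKL' : m.restrict L K = m K := Measure.restrict_eq_self _ (hKL.trans interior_subset)
    obtain ⟨U, hKU, hUo, hUm⟩ := hK.measurableSet.exists_isOpen_sdiff_lt (μ := m.restrict L)
      (by rw [hKL']; exact hK.measure_lt_top.ne) hδ
    obtain ⟨χ, hχ1, hχ0, hχc, hχb⟩ := exists_continuous_one_zero_of_isCompact hK
      (hUo.inter isOpen_interior).isClosed_compl
      (disjoint_compl_right_iff_subset.2 (subset_inter hKU hKL))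
    refine ⟨fun x => (χ x : ℂ) * z, ?_, by fun_prop, ?_⟩
    · have hb : ∀ x, ‖(χ x : ℂ) * z - s.indicator (fun _ => z) x‖ₑ ≤
          ‖z‖ₑ * ((s \ K).indicator 1 x + ((U \ K) ∩ L).indicator 1 x) := by
        intro x
        by_cases hxK : x ∈ K
        · rw [hχ1 hxK, indicator_of_mem (hKs hxK)]
          simp
        have hb1 : ∀ t ∈ Icc (0 : ℝ) 1, ‖(t : ℂ) * z‖ₑ ≤ ‖z‖ₑ := by
          intro t ht
          rw [enorm_le_iff_norm_le, norm_mul, Complex.norm_real, Real.norm_of_nonneg ht.1]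
          exact mul_le_of_le_one_left (norm_nonneg _) ht.2
        by_cases hxs : x ∈ s
        · rw [indicator_of_mem hxs, indicator_of_mem (show x ∈ s \ K from ⟨hxs, hxK⟩)]
          have e : (χ x : ℂ) * z - z = -(((1 - χ x : ℝ) : ℂ) * z) := by push_cast; ring
          rw [e, enorm_neg]
          refine (hb1 _ ⟨sub_nonneg.2 (hχb x).2, sub_le_self _ (hχb x).1⟩).trans ?_
          rw [Pi.one_apply, mul_add, mul_one]
          exact le_self_add
        · rw [indicator_of_notMem hxs, sub_zero]
          by_cases hxU : x ∈ U ∩ interior L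
          · rw [indicator_of_mem (show x ∈ (U \ K) ∩ L from
              ⟨⟨hxU.1, hxK⟩, interior_subset hxU.2⟩)]
            refine (hb1 _ (hχb x)).trans ?_
            rw [Pi.one_apply, mul_add, mul_one]
            exact le_add_self
          · rw [hχ0 hxU]
            simp
      rw [eLpNorm_one_eq_lintegral_enorm]
      calc ∫⁻ x, ‖(χ x : ℂ) * z - s.indicator (fun _ => z) x‖ₑ ∂m
          ≤ ∫⁻ x, ‖z‖ₑ * ((s \ K).indicator 1 x + ((U \ K) ∩ L).indicator 1 x) ∂m :=
            lintegral_mono hb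
        _ = ‖z‖ₑ * (m (s \ K) + m.restrict L (U \ K)) := by
            have h1 := hs.diff hK.measurableSet
            have h2 := hUo.measurableSet.diff hK.measurableSet
            have h3 : Measurable ((s \ K).indicator (1 : X → ℝ≥0∞)) := measurable_one.indicator h1
            have h4 : Measurable fun x => (s \ K).indicator (1 : X → ℝ≥0∞) x +
                ((U \ K) ∩ L).indicator (1 : X → ℝ≥0∞) x :=
              h3.add (measurable_one.indicator (h2.inter hL.measurableSet))
            rw [lintegral_const_mul _ h4, lintegral_add_left h3,
              lintegral_indicator_one h1, lintegral_indicator_one (h2.inter hL.measurableSet),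
              Measure.restrict_apply h2]
        _ ≤ ‖z‖ₑ * (ε / 2 / ‖z‖ₑ + ε / 2 / ‖z‖ₑ) := by
            gcongr
            exact hUm.2.le
        _ = ε := by
            rw [mul_add, ENNReal.mul_div_cancel (by simpa using hz) (by simp), ENNReal.add_halves]
    · refine HasCompactSupport.mul_right (f := fun x => (χ x : ℂ)) ?_
      exact hχc.comp_left (g := Complex.ofReal) rfl
  · rintro f g ⟨hf, hf'⟩ ⟨hg, hg'⟩
    exact ⟨hf.add hg, hf'.add hg'⟩
  · intro f hf
    exact hf.1.measurable.aestronglyMeasurable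

/-- A bounded Borel function is, almost everywhere on a `σ`-compact set, the limit of a sequence
of continuous functions. -/
theorem exists_continuous_tendsto_ae {A : Set X} (hA : IsSigmaCompact A) {g : X → ℂ}
    (hg : Measurable g) {C : ℝ} (hC : ∀ x, ‖g x‖ ≤ C) :
    ∃ φ : ℕ → X → ℂ, (∀ n, Continuous (φ n)) ∧
      ∀ᵐ x ∂m.restrict A, Tendsto (fun n => φ n x) atTop (𝓝 (g x)) := by
  obtain ⟨K, hK, hKm, rfl⟩ := exists_monotone_compacts hA
  have h1 : ∀ n, ∃ φ : X → ℂ, Continuous φ ∧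
      ∫⁻ x, ‖g x - φ x‖ₑ ∂m.restrict (K n) ≤ (2⁻¹ : ℝ≥0∞) ^ n := by
    intro n
    have := innerRegular_restrict m (hK n).measurableSet
    have : IsFiniteMeasure (m.restrict (K n)) := isFiniteMeasure_restrict.2 (hK n).measure_lt_top.ne
    obtain ⟨φ, h2, h3, -⟩ := exists_hasCompactSupport_sub_le (m := m.restrict (K n))
      (MemLp.of_bound hg.aestronglyMeasurable C (.of_forall hC))
      (ε := (2⁻¹ : ℝ≥0∞) ^ n) (pow_ne_zero _ (by simp))
    rw [eLpNorm_one_eq_lintegral_enorm] at h2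
    exact ⟨φ, h3, h2⟩
  choose φ hφ hφi using h1
  refine ⟨φ, hφ, ?_⟩
  rw [ae_restrict_iUnion_iff]
  intro N
  have hm : ∀ n, Measurable fun x => ‖g x - φ n x‖ₑ := fun n => (hg.sub (hφ n).measurable).enorm
  -- The error of `φ (n + N)` is controlled on `K (n + N)`, which contains `K N`; the shift by `N`
  -- makes all the terms meaningful on `K N`. Summable $L^1$ errors force convergence almost
  -- everywhere.
  have h2 : ∫⁻ x, ∑' n, ‖g x - φ (n + N) x‖ₑ ∂m.restrict (K N) ≠ ∞ := by
    rw [lintegral_tsum fun n => (hm _).aemeasurable]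
    refine ne_top_of_le_ne_top (b := ∑' n : ℕ, (2⁻¹ : ℝ≥0∞) ^ n) ?_ (ENNReal.tsum_le_tsum fun n => ?_)
    · rw [ENNReal.tsum_geometric]
      simp
    · refine (lintegral_mono' (Measure.restrict_mono (hKm (Nat.le_add_left N n)) le_rfl)
        le_rfl).trans ((hφi (n + N)).trans ?_)
      exact pow_le_pow_right_of_le_one' (by simp) (Nat.le_add_right n N)
  have h3 := ae_lt_top (.tsum fun n => hm (n + N)) h2
  filter_upwards [h3] with x hx
  rw [← tendsto_add_atTop_iff_nat N, tendsto_iff_edist_tendsto_0]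
  have h4 := ENNReal.tendsto_atTop_zero_of_tsum_ne_top hx.ne
  refine h4.congr fun n => ?_
  rw [edist_comm, edist_eq_enorm_sub]

/-- Bounded Borel functions on the sets of a partition into `σ`-compact open sets are, up to null
sets, the restrictions of one Borel function. -/
theorem exists_glue {ι : Type*} {c : X → ι} (hc : ∀ i, IsOpen (c ⁻¹' {i}))
    (hcs : ∀ i, IsSigmaCompact (c ⁻¹' {i})) {q : ι → X → ℂ} (hq : ∀ i, Measurable (q i)) {C : ℝ}
    (hC : ∀ i x, ‖q i x‖ ≤ C) :
    ∃ Q : X → ℂ, Measurable Q ∧ (∀ x, ‖Q x‖ ≤ max C 0) ∧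
      ∀ i, ∀ᵐ x ∂m.restrict (c ⁻¹' {i}), Q x = q i x := by
  -- With uncountably many cells the function `x ↦ q (c x) x` need not be Borel. Continuous
  -- approximants, in contrast, glue to continuous functions, since `c` is locally constant, and a
  -- limit of a sequence of these is Borel.
  choose φ hφ hφt using fun i => exists_continuous_tendsto_ae (m := m) (hcs i) (hq i) (hC i)
  have hcont : ∀ n, Continuous fun x => φ (c x) n x := by
    intro n
    rw [continuous_iff_continuousAt]
    intro x
    refine (hφ (c x) n).continuousAt.congr ?_
    filter_upwards [(hc (c x)).mem_nhds rfl] with y hy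
    rw [mem_singleton_iff.1 hy]
  set Q₀ : X → ℂ := fun x => limUnder atTop fun n => φ (c x) n x with hQ₀
  have hQm : Measurable Q₀ :=
    (StronglyMeasurable.limUnder fun n => (hcont n).measurable.stronglyMeasurable).measurable
  -- Where the sequence diverges `limUnder` takes an arbitrary value; cutting off values larger than
  -- `C` restores a bound at every point.
  set Q : X → ℂ := {x | ‖Q₀ x‖ ≤ C}.indicator Q₀ with hQ
  refine ⟨Q, hQm.indicator (measurableSet_le hQm.norm measurable_const), fun x => ?_, fun i => ?_⟩
  · rw [hQ]
    by_cases hx : x ∈ {x | ‖Q₀ x‖ ≤ C}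
    · rw [indicator_of_mem hx]
      exact le_max_of_le_left hx
    · rw [indicator_of_notMem hx, norm_zero]
      exact le_max_right _ _
  · filter_upwards [hφt i, ae_restrict_mem (hc i).measurableSet] with x hx hxi
    have e : Q₀ x = q i x := by
      rw [hQ₀]
      simp only [mem_singleton_iff.1 hxi]
      exact hx.limUnder_eq
    rw [hQ, indicator_of_mem, e]
    rw [mem_ofPred_eq, e]
    exact hC i x

end Partition

/-- A bounded family of measurable functions has an essential supremum for a finite measure, and
it is the supremum of a sequence of the family. -/
theorem exists_seq_iSup_ae {X I : Type*} [MeasurableSpace X] [Nonempty I] (ν : Measure X)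
    [IsFiniteMeasure ν] {M : I → X → ℝ} (hM : ∀ i, Measurable (M i)) {C : ℝ}
    (hC : ∀ i x, |M i x| ≤ C) :
    ∃ j : ℕ → I, ∀ i, ∀ᵐ x ∂ν, M i x ≤ ⨆ n, M (j n) x := by
  have hbdd : ∀ (j : ℕ → I) (x : X), BddAbove (range fun n => M (j n) x) := fun j x =>
    ⟨C, by rintro _ ⟨n, rfl⟩; exact (le_abs_self _).trans (hC _ x)⟩
  have hSm : ∀ j : ℕ → I, Measurable fun x => ⨆ n, M (j n) x := fun j =>
    .iSup fun n => hM (j n)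
  have hSC : ∀ (j : ℕ → I) (x : X), |⨆ n, M (j n) x| ≤ C := by
    intro j x
    rw [abs_le]
    exact ⟨(neg_le_of_abs_le (hC (j 0) x)).trans (le_ciSup (hbdd j x) 0),
      ciSup_le fun n => (le_abs_self _).trans (hC _ x)⟩
  have hSi : ∀ j : ℕ → I, Integrable (fun x => ⨆ n, M (j n) x) ν := fun j =>
    Integrable.of_bound (hSm j).aestronglyMeasurable C (.of_forall (hSC j))
  -- Countable subfamilies are compared by the integral of their supremum. A maximising sequence of
  -- subfamilies is merged into one subfamily `J` through the pairing of natural numbers.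
  set Φ : (ℕ → I) → ℝ := fun j => ∫ x, ⨆ n, M (j n) x ∂ν with hΦ
  have hΦb : BddAbove (range Φ) := by
    refine ⟨∫ _, C ∂ν, ?_⟩
    rintro _ ⟨j, rfl⟩
    exact integral_mono (hSi j) (integrable_const _) fun x => (le_abs_self _).trans (hSC j x)
  obtain ⟨u, -, hu, hur⟩ := exists_seq_tendsto_sSup (range_nonempty Φ) hΦb
  choose j hj using hur
  set J : ℕ → I := fun n => j n.unpair.1 n.unpair.2 with hJ
  have hJk : ∀ k, Φ (j k) ≤ Φ J := by
    intro k
    refine integral_mono (hSi _) (hSi _) fun x => ciSup_le fun n => ?_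
    have := le_ciSup (hbdd J x) (Nat.pair k n)
    simpa [hJ] using this
  have hJs : sSup (range Φ) ≤ Φ J := le_of_tendsto' hu fun k => by rw [← hj]; exact hJk k
  refine ⟨J, fun i => ?_⟩
  -- Adding one more index to the maximal subfamily cannot raise the integral, hence it does not
  -- change the supremum almost everywhere.
  set J' : ℕ → I := fun n => Nat.casesOn n i J with hJ'
  have hle : ∀ x, ⨆ n, M (J n) x ≤ ⨆ n, M (J' n) x := fun x =>
    ciSup_le fun n => le_ciSup (hbdd J' x) (n + 1)
  have hint : ∫ x, ((⨆ n, M (J' n) x) - ⨆ n, M (J n) x) ∂ν = 0 := by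
    rw [integral_sub (hSi _) (hSi _)]
    refine le_antisymm (sub_nonpos.2 ((le_csSup hΦb (mem_range_self J')).trans hJs)) ?_
    exact sub_nonneg.2 (integral_mono (hSi _) (hSi _) hle)
  rw [integral_eq_zero_iff_of_nonneg (fun x => sub_nonneg.2 (hle x)) ((hSi _).sub (hSi _))] at hint
  filter_upwards [hint] with x hx
  have h1 : M i x ≤ ⨆ n, M (J' n) x := le_ciSup (hbdd J' x) 0
  have h2 : (⨆ n, M (J' n) x) - ⨆ n, M (J n) x = 0 := hx
  linarith

/-! ### Functionals on $L^1$ and local essential suprema beyond $\sigma$-finiteness. -/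

section Partition

variable {X : Type*} [TopologicalSpace X] [T2Space X] [MeasurableSpace X] [BorelSpace X]
  {m : Measure X} [IsFiniteMeasureOnCompacts m] [m.InnerRegular]

theorem sigmaFinite_restrict {A : Set X} (hA : IsSigmaCompact A) : SigmaFinite (m.restrict A) := by
  obtain ⟨K, hK, -, rfl⟩ := exists_monotone_compacts hA
  refine ⟨⟨⟨fun n => K n ∪ (⋃ n, K n)ᶜ, fun _ => trivial, fun n => ?_, ?_⟩⟩⟩
  · have hm : MeasurableSet (⋃ n, K n) := .iUnion fun n => (hK n).measurableSet
    refine (measure_union_le _ _).trans_lt (ENNReal.add_lt_top.2 ⟨?_, ?_⟩)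
    · exact (Measure.restrict_apply_le _ _).trans_lt (hK n).measure_lt_top
    · rw [Measure.restrict_apply hm.compl, compl_inter_self, measure_empty]
      exact ENNReal.zero_lt_top
  · rw [← iUnion_union, union_compl_self]

variable [LocallyCompactSpace X]

/-- An integrable function vanishes almost everywhere off a `σ`-compact set. -/
theorem exists_isSigmaCompact_support {f : X → ℂ} (hf : MemLp f 1 m) :
    ∃ A : Set X, IsSigmaCompact A ∧ ∀ᵐ x ∂m, x ∉ A → f x = 0 := by
  choose g hg hgc hgs using fun n : ℕ =>
    exists_hasCompactSupport_sub_le hf (ε := (2⁻¹ : ℝ≥0∞) ^ n) (pow_ne_zero _ (by simp))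
  -- Each approximant vanishes off its compact support, so the integral of $|f|$ off the union of
  -- these supports is at most $2^{-n}$ for every `n`.
  have hA : IsSigmaCompact (⋃ n, tsupport (g n)) := isSigmaCompact_iUnion_of_isCompact _ hgs
  refine ⟨_, hA, ?_⟩
  have hAm := hA.measurableSet'
  have h0 : ∫⁻ x in (⋃ n, tsupport (g n))ᶜ, ‖f x‖ₑ ∂m = 0 := by
    have h1 : ∀ n : ℕ, ∫⁻ x in (⋃ n, tsupport (g n))ᶜ, ‖f x‖ₑ ∂m ≤ (2⁻¹ : ℝ≥0∞) ^ n := by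
      intro n
      refine le_trans ?_ (hg n)
      rw [eLpNorm_one_eq_lintegral_enorm]
      refine le_trans (le_of_eq ?_) (setLIntegral_le_lintegral (⋃ n, tsupport (g n))ᶜ _)
      refine setLIntegral_congr_fun hAm.compl fun x hx => ?_
      have : g n x = 0 := image_eq_zero_of_notMem_tsupport fun h => hx (mem_iUnion.2 ⟨n, h⟩)
      simp [this]
    refine le_antisymm (ge_of_tendsto' (x := atTop) (f := fun n : ℕ => (2⁻¹ : ℝ≥0∞) ^ n) ?_ h1) zero_le
    exact ENNReal.tendsto_pow_atTop_nhds_zero_of_lt_one (by simp)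
  rw [lintegral_eq_zero_iff' hf.1.enorm.restrict] at h0
  filter_upwards [(ae_restrict_iff' hAm.compl).1 h0] with x hx hxA
  simpa using hx hxA

variable {ι : Type*} {c : X → ι}

/-- Functionals on `L^1` are represented by bounded Borel functions. -/
theorem exists_representation (hc : ∀ i, IsOpen (c ⁻¹' {i}))
    (hcs : ∀ i, IsSigmaCompact (c ⁻¹' {i})) (Φ : Lp ℂ 1 m →L[ℂ] ℂ) :
    ∃ q : X → ℂ, Measurable q ∧ (∀ x, ‖q x‖ ≤ ‖Φ‖) ∧
      ∀ (f : X → ℂ) (hf : MemLp f 1 m), HasCompactSupport f → Φ (hf.toLp f) = ∫ x, q x * f x ∂m := by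
  have h1 : ∀ i, ∃ q : X → ℂ, Measurable q ∧ (∀ x, ‖q x‖ ≤ ‖Φ‖) ∧
      ∀ f : Lp ℂ 1 m, (∀ᵐ x ∂m, x ∉ c ⁻¹' {i} → f x = 0) → Φ f = ∫ x, q x * f x ∂m := by
    intro i
    have := sigmaFinite_restrict (m := m) (hcs i)
    have hm := (hc i).measurableSet
    -- A strictly positive integrable density on the $\sigma$-finite cell, extended by zero, reduces
    -- the cell to the representation with a density.
    obtain ⟨g, hg0, hgm, hgi⟩ := exists_pos_lintegral_lt_of_sigmaFinite (m.restrict (c ⁻¹' {i}))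
      one_ne_zero
    obtain ⟨q, hq, hqb, hqf⟩ := exists_representation_of_density m ((c ⁻¹' {i}).indicator g)
      (hgm.indicator hm) (by
        refine ne_top_of_le_ne_top hgi.ne_top (le_of_eq ?_)
        rw [← lintegral_indicator hm]
        refine lintegral_congr fun x => ?_
        by_cases hx : x ∈ c ⁻¹' {i}
        · rw [indicator_of_mem hx, indicator_of_mem hx]
        · rw [indicator_of_notMem hx, indicator_of_notMem hx]; rfl) Φ
    refine ⟨q, hq, hqb, fun f hf => hqf f ?_⟩
    filter_upwards [hf] with x hx hw
    refine hx fun hxi => ?_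
    rw [indicator_of_mem hxi] at hw
    exact (hg0 x).ne' hw
  choose q hq hqb hqf using h1
  obtain ⟨Q, hQ, hQb, hQq⟩ := exists_glue (m := m) hc hcs hq hqb
  rw [max_eq_left (norm_nonneg Φ)] at hQb
  refine ⟨Q, hQ, hQb, fun f hf hfc => ?_⟩
  -- A function with compact support is a finite sum of its restrictions to cells, so the glued
  -- density represents the functional on it.
  set t : Finset ι := (finite_image_of_partition hc hfc.isCompact).toFinset with ht
  have hfi : ∀ i, MemLp ((c ⁻¹' {i}).indicator f) 1 m := fun i => hf.indicator (hc i).measurableSet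
  have hsum : f = ∑ i ∈ t, (c ⁻¹' {i}).indicator f := by
    ext x
    rw [Finset.sum_apply]
    by_cases hx : f x = 0
    · rw [hx]
      refine (Finset.sum_eq_zero fun i _ => ?_).symm
      by_cases hxi : x ∈ c ⁻¹' {i}
      · rw [indicator_of_mem hxi, hx]
      · rw [indicator_of_notMem hxi]
    · rw [Finset.sum_eq_single (c x)]
      · exact (indicator_of_mem (show x ∈ c ⁻¹' {c x} from rfl) f).symm
      · intro i _ hi
        have hxi : x ∉ c ⁻¹' {i} := fun h => hi (mem_singleton_iff.1 h).symm
        exact indicator_of_notMem hxi f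
      · intro h
        exact (h ((Set.Finite.mem_toFinset _).2 (mem_image_of_mem c (subset_tsupport f hx)))).elim
  have hΦ : Φ (hf.toLp f) = ∑ i ∈ t, Φ ((hfi i).toLp _) := by
    rw [← _root_.map_sum]
    congr 1
    refine Lp.ext ?_
    have hall : ∀ᵐ x ∂m, ∀ i ∈ t, (hfi i).toLp _ x = (c ⁻¹' {i}).indicator f x :=
      (ae_ball_iff t.countable_toSet).2 fun i _ => (hfi i).coeFn_toLp
    filter_upwards [hf.coeFn_toLp, Lp.coeFn_finsetSum t fun i => (hfi i).toLp _, hall] with x e1 e2 e3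
    rw [e1, e2, Finset.sum_apply, Finset.sum_congr rfl e3]
    conv_lhs => rw [hsum]
    rw [Finset.sum_apply]
  have hterm : ∀ i, Φ ((hfi i).toLp _) = ∫ x, Q x * (c ⁻¹' {i}).indicator f x ∂m := by
    intro i
    rw [hqf i]
    · refine integral_congr_ae ?_
      filter_upwards [(hfi i).coeFn_toLp, (ae_restrict_iff' (hc i).measurableSet).1 (hQq i)] with x e1 e2
      rw [e1]
      by_cases hx : x ∈ c ⁻¹' {i}
      · rw [e2 hx]
      · rw [indicator_of_notMem hx, mul_zero, mul_zero]
    · filter_upwards [(hfi i).coeFn_toLp] with x e1 hx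
      rw [e1, indicator_of_notMem hx]
  rw [hΦ, Finset.sum_congr rfl fun i _ => hterm i, ← integral_finsetSum]
  · refine integral_congr_ae (.of_forall fun x => ?_)
    simp only
    rw [← Finset.mul_sum]
    conv_rhs => rw [hsum]
    rw [Finset.sum_apply]
  · intro i _
    exact (memLp_one_iff_integrable.1 (hfi i)).bdd_mul hQ.aestronglyMeasurable (.of_forall hQb)

/-- A bounded family of Borel functions has a local essential supremum. -/
theorem exists_local_essSup (hc : ∀ i, IsOpen (c ⁻¹' {i}))
    (hcs : ∀ i, IsSigmaCompact (c ⁻¹' {i})) {I : Type*} [Nonempty I] {M : I → X → ℝ}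
    (hM : ∀ i, Measurable (M i)) {C : ℝ} (hC : ∀ i x, |M i x| ≤ C) :
    ∃ h : X → ℝ, Measurable h ∧ (∀ x, |h x| ≤ max C 0) ∧ (∀ i, ∀ᵐ x ∂m, M i x ≤ h x) ∧
      ∀ K, IsCompact K → ∃ J : Set I, J.Countable ∧
        ∀ᵐ x ∂m.restrict K, ∀ b, (∀ j ∈ J, M j x ≤ b) → h x ≤ b := by
  have h1 : ∀ k, ∃ j : ℕ → I, ∀ i, ∀ᵐ x ∂m.restrict (c ⁻¹' {k}), M i x ≤ ⨆ n, M (j n) x := by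
    intro k
    have := sigmaFinite_restrict (m := m) (hcs k)
    -- The restriction to a cell is $\sigma$-finite and can be replaced by a finite measure with the
    -- same null sets.
    obtain ⟨j, hj⟩ := exists_seq_iSup_ae (m.restrict (c ⁻¹' {k})).toFinite hM hC
    refine ⟨j, fun i => ?_⟩
    have := hj i
    rwa [ae_toFinite] at this
  choose j hj using h1
  have hSm : ∀ k, Measurable fun x => ((⨆ n, M (j k n) x : ℝ) : ℂ) := fun k =>
    Complex.measurable_ofReal.comp (.iSup fun n => hM (j k n))
  have hSC : ∀ k x, ‖((⨆ n, M (j k n) x : ℝ) : ℂ)‖ ≤ C := by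
    intro k x
    rw [Complex.norm_real, Real.norm_eq_abs, abs_le]
    exact ⟨(neg_le_of_abs_le (hC (j k 0) x)).trans (le_ciSup (f := fun n => M (j k n) x)
      ⟨C, by rintro _ ⟨n, rfl⟩; exact (le_abs_self _).trans (hC _ x)⟩ 0),
      ciSup_le fun n => (le_abs_self _).trans (hC _ x)⟩
  obtain ⟨Q, hQ, hQb, hQq⟩ := exists_glue (m := m) hc hcs hSm hSC
  have hh : Measurable fun x => (Q x).re := Complex.measurable_re.comp hQ
  refine ⟨fun x => (Q x).re, hh, fun x => (Complex.abs_re_le_norm _).trans (hQb x), fun i => ?_,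
    fun K hK => ?_⟩
  · refine ae_of_partition hc (measurableSet_le (hM i) hh) fun k => ?_
    filter_upwards [hj k i, hQq k] with x e1 e2
    rw [e2, Complex.ofReal_re]
    exact e1
  · have hfin := finite_image_of_partition hc hK
    -- The compact set meets finitely many cells, and a sequence of the family suffices on each of
    -- them.
    refine ⟨⋃ k ∈ c '' K, range (j k), hfin.countable.biUnion fun k _ => countable_range _, ?_⟩
    have hsub : K ⊆ ⋃ k ∈ c '' K, c ⁻¹' {k} := fun x hx =>
      mem_iUnion₂.2 ⟨c x, mem_image_of_mem c hx, rfl⟩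
    refine ae_restrict_of_ae_restrict_of_subset hsub ?_
    rw [ae_restrict_biUnion_iff _ hfin.countable]
    intro k hk
    filter_upwards [hQq k] with x e2 b hb
    rw [e2, Complex.ofReal_re]
    exact ciSup_le fun n => hb _ (mem_iUnion₂.2 ⟨k, hk, mem_range_self n⟩)

end Partition

/-! ### Integrable Borel functions with `σ`-compact support -/

/-- An integrable Borel function that vanishes off a `σ`-compact set. -/
structure IsTame {X : Type*} [TopologicalSpace X] [MeasurableSpace X] (m : Measure X) (u : X → ℂ) :
    Prop where
  measurable : Measurable u
  integrable : Integrable u m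
  support : ∃ A, IsSigmaCompact A ∧ ∀ x, u x ≠ 0 → x ∈ A

section Tame

variable {X : Type*} [TopologicalSpace X] [T2Space X] [LocallyCompactSpace X] [MeasurableSpace X]
  [BorelSpace X] {m : Measure X} [IsFiniteMeasureOnCompacts m] [m.InnerRegular]

theorem IsTame.bdd_mul {u k : X → ℂ} (hu : IsTame m u) (hk : Measurable k) {C : ℝ}
    (hC : ∀ x, ‖k x‖ ≤ C) : IsTame m fun x => k x * u x := by
  obtain ⟨A, hA, hAu⟩ := hu.support
  exact ⟨hk.mul hu.measurable, hu.integrable.bdd_mul hk.aestronglyMeasurable (.of_forall hC),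
    A, hA, fun x hx => hAu x (right_ne_zero_of_mul hx)⟩

/-- Every integrable Borel function may be cut off at a $\sigma$-compact set, and then Fubini's
theorem over $\sigma$-compact rectangles becomes applicable. -/
theorem exists_isTame_ae_eq {f : X → ℂ} (hf : Measurable f) (hfi : Integrable f m) :
    ∃ A, IsSigmaCompact A ∧ IsTame m (A.indicator f) ∧ f =ᵐ[m] A.indicator f := by
  obtain ⟨A, hA, h0⟩ := exists_isSigmaCompact_support (memLp_one_iff_integrable.2 hfi)
  have hAm := hA.measurableSet'
  refine ⟨A, hA, ⟨hf.indicator hAm, hfi.indicator hAm, A, hA, fun x hx => ?_⟩, ?_⟩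
  · by_contra h
    exact hx (indicator_of_notMem h f)
  · filter_upwards [h0] with x hx
    by_cases hxA : x ∈ A
    · rw [indicator_of_mem hxA]
    · rw [indicator_of_notMem hxA, hx hxA]

theorem isTame_indicator {A K : Set X} (hA : MeasurableSet A) (hK : IsCompact K) (hAK : A ⊆ K)
    {v : X → ℂ} (hv : Continuous v) : IsTame m (A.indicator v) := by
  refine ⟨hv.measurable.indicator hA, ?_, K, hK.isSigmaCompact, fun x hx => hAK ?_⟩
  · exact ((hv.continuousOn.integrableOn_compact hK).mono_set hAK).integrable_indicator hA
  · by_contra h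
    exact hx (indicator_of_notMem h v)

theorem isTame_of_hasCompactSupport {f : X → ℂ} (hf : Continuous f) (hfc : HasCompactSupport f) :
    IsTame m f :=
  ⟨hf.measurable, hf.integrable_of_hasCompactSupport hfc, _, hfc.isCompact.isSigmaCompact,
    fun _ hx => subset_tsupport f hx⟩

/-- A Borel function whose integrals over relatively compact Borel sets vanish is null. -/
theorem ae_eq_zero_of_forall_setIntegral {F : X → ℂ} (hF : Measurable F)
    (hi : ∀ K, IsCompact K → IntegrableOn F K m)
    (h0 : ∀ A K, MeasurableSet A → IsCompact K → A ⊆ K → ∫ x in A, F x ∂m = 0) : F =ᵐ[m] 0 := by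
  have hE : MeasurableSet {x | F x ≠ 0} := (measurableSet_eq_fun hF measurable_const).compl
  refine measure_eq_zero_of_forall_isCompact m (E := {x | F x ≠ 0}) hE fun K hK => ?_
  have : IsFiniteMeasure (m.restrict K) := isFiniteMeasure_restrict.2 hK.measure_lt_top.ne
  have hz : F =ᵐ[m.restrict K] 0 := by
    refine Integrable.ae_eq_zero_of_forall_setIntegral_eq_zero (hi K hK) fun E hE _ => ?_
    rw [Measure.restrict_restrict hE]
    exact h0 _ K (hE.inter hK.measurableSet) hK inter_subset_right
  rw [← Measure.restrict_apply hE]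
  exact hz

end Tame

/-! ### Fubini's theorem for integrable functions with $\sigma$-compact support. -/

section TameProduct

variable {X Y : Type*} [Group X] [TopologicalSpace X] [IsTopologicalGroup X]
  [LocallyCompactSpace X] [T2Space X] [MeasurableSpace X] [BorelSpace X]
  [Group Y] [TopologicalSpace Y] [IsTopologicalGroup Y]
  [LocallyCompactSpace Y] [T2Space Y] [MeasurableSpace Y] [BorelSpace Y]
  {m : Measure X} {n : Measure Y} [m.IsHaarMeasure] [m.InnerRegular]
  [n.IsHaarMeasure] [n.InnerRegular]

theorem isSigmaCompact_rect {A : Set X} {B : Set Y} (hA : IsSigmaCompact A)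
    (hB : IsSigmaCompact B) : IsSigmaCompact (rect A B) := by
  obtain ⟨K, hK, hKm, rfl⟩ := exists_monotone_compacts hA
  obtain ⟨L, hL, hLm, rfl⟩ := exists_monotone_compacts hB
  refine ⟨fun i => rect (K i) (L i), fun i => isCompact_rect (hK i) (hL i), ?_⟩
  ext q
  simp only [rect, mem_iUnion, mem_ofPred_eq]
  constructor
  · rintro ⟨i, h1, h2⟩
    exact ⟨⟨i, h1⟩, i, h2⟩
  · rintro ⟨⟨i, h1⟩, j, h2⟩
    exact ⟨max i j, hKm (le_max_left i j) h1, hLm (le_max_right i j) h2⟩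

namespace IsTame

variable {F : WithBorel (X × Y) → ℂ}

theorem exists_rect (hF : IsTame (prodHaar m n) F) :
    ∃ (A : Set X) (B : Set Y), IsSigmaCompact A ∧ IsSigmaCompact B ∧
      ∀ x y, F (.mk (x, y)) ≠ 0 → x ∈ A ∧ y ∈ B := by
  obtain ⟨S, hS, hSF⟩ := hF.support
  exact ⟨_, _, hS.image continuous_fst_out, hS.image continuous_snd_out, fun x y hxy =>
    ⟨mem_image_of_mem (fun q : WithBorel (X × Y) => q.out.1) (hSF _ hxy),
      mem_image_of_mem (fun q : WithBorel (X × Y) => q.out.2) (hSF _ hxy)⟩⟩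

theorem integral_left (hF : IsTame (prodHaar m n) F) :
    ∫ q, F q ∂prodHaar m n = ∫ y, ∫ x, F (.mk (x, y)) ∂m ∂n := by
  obtain ⟨A, B, hA, hB, h0⟩ := hF.exists_rect
  exact (isRadonProduct_prodHaar m n).integral_left hA hB hF.measurable h0 hF.integrable

theorem integral_right (hF : IsTame (prodHaar m n) F) :
    ∫ q, F q ∂prodHaar m n = ∫ x, ∫ y, F (.mk (x, y)) ∂n ∂m := by
  obtain ⟨A, B, hA, hB, h0⟩ := hF.exists_rect
  exact (isRadonProduct_prodHaar m n).integral_right hA hB hF.measurable h0 hF.integrable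

theorem integral_swap (hF : IsTame (prodHaar m n) F) :
    ∫ x, ∫ y, F (.mk (x, y)) ∂n ∂m = ∫ y, ∫ x, F (.mk (x, y)) ∂m ∂n :=
  hF.integral_right.symm.trans hF.integral_left

theorem of_lintegral_left (hF : Measurable F) {A : Set X} {B : Set Y} (hA : IsSigmaCompact A)
    (hB : IsSigmaCompact B) (h0 : ∀ x y, F (.mk (x, y)) ≠ 0 → x ∈ A ∧ y ∈ B)
    (hi : ∫⁻ y, ∫⁻ x, ‖F (.mk (x, y))‖ₑ ∂m ∂n < ∞) : IsTame (prodHaar m n) F := by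
  refine ⟨hF, ⟨hF.aestronglyMeasurable, ?_⟩, rect A B, isSigmaCompact_rect hA hB,
    fun q hq => h0 q.out.1 q.out.2 hq⟩
  rw [hasFiniteIntegral_iff_enorm, (isRadonProduct_prodHaar m n).lintegral_left hA hB hF.enorm]
  · exact hi
  · exact fun x y hxy => h0 x y (by simpa using hxy)

theorem of_lintegral_right (hF : Measurable F) {A : Set X} {B : Set Y} (hA : IsSigmaCompact A)
    (hB : IsSigmaCompact B) (h0 : ∀ x y, F (.mk (x, y)) ≠ 0 → x ∈ A ∧ y ∈ B)
    (hi : ∫⁻ x, ∫⁻ y, ‖F (.mk (x, y))‖ₑ ∂n ∂m < ∞) : IsTame (prodHaar m n) F := by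
  refine ⟨hF, ⟨hF.aestronglyMeasurable, ?_⟩, rect A B, isSigmaCompact_rect hA hB,
    fun q hq => h0 q.out.1 q.out.2 hq⟩
  rw [hasFiniteIntegral_iff_enorm, (isRadonProduct_prodHaar m n).lintegral_right hA hB hF.enorm]
  · exact hi
  · exact fun x y hxy => h0 x y (by simpa using hxy)

theorem mul_prod {k : WithBorel (X × Y) → ℂ} (hk : Measurable k) {C : ℝ} (hC : ∀ q, ‖k q‖ ≤ C)
    {u : X → ℂ} {v : Y → ℂ} (hu : IsTame m u) (hv : IsTame n v) :
    IsTame (prodHaar m n) fun q => k q * (u q.out.1 * v q.out.2) := by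
  obtain ⟨A, hA, hAu⟩ := hu.support
  obtain ⟨B, hB, hBv⟩ := hv.support
  refine IsTame.bdd_mul (IsTame.of_lintegral_left ?_ hA hB ?_ ?_) hk hC
  · exact (hu.measurable.comp continuous_fst_out.measurable).mul
      (hv.measurable.comp continuous_snd_out.measurable)
  · exact fun x y hxy => ⟨hAu x (left_ne_zero_of_mul hxy), hBv y (right_ne_zero_of_mul hxy)⟩
  · have h1 : ∀ y, ∫⁻ x, ‖u x * v y‖ₑ ∂m = (∫⁻ x, ‖u x‖ₑ ∂m) * ‖v y‖ₑ := by
      intro y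
      simp_rw [enorm_mul]
      exact lintegral_mul_const _ hu.measurable.enorm
    change ∫⁻ y, ∫⁻ x, ‖u x * v y‖ₑ ∂m ∂n < ∞
    simp_rw [h1]
    rw [lintegral_const_mul _ hv.measurable.enorm]
    exact ENNReal.mul_lt_top hu.integrable.2 hv.integrable.2

theorem slice_left (hF : IsTame (prodHaar m n) F) :
    IsTame n fun y => ∫ x, F (.mk (x, y)) ∂m := by
  obtain ⟨A, B, hA, hB, h0⟩ := hF.exists_rect
  have e2 : ∀ y, ∫ x in A, F (.mk (x, y)) ∂m = ∫ x, F (.mk (x, y)) ∂m := fun y =>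
    setIntegral_eq_integral_of_forall_compl_eq_zero fun x hx => by
      by_contra hx'
      exact hx (h0 x y hx').1
  have hm := measurable_integral_slice (measurable_slice_restrict (Y := Y) m hA) hF.measurable
  simp_rw [e2] at hm
  refine ⟨hm, ⟨hm.aestronglyMeasurable, ?_⟩, B, hB, fun y hy => ?_⟩
  · have h1 := hF.integrable.2
    rw [hasFiniteIntegral_iff_enorm, (isRadonProduct_prodHaar m n).lintegral_left hA hB
      hF.measurable.enorm (fun x y hxy => h0 x y (by simpa using hxy))] at h1
    rw [hasFiniteIntegral_iff_enorm]
    exact (lintegral_mono fun y => enorm_integral_le_lintegral_enorm _).trans_lt h1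
  · by_contra hB'
    refine hy (integral_eq_zero_of_ae (.of_forall fun x => ?_))
    by_contra hx
    exact hB' (h0 x y hx).2

end IsTame

/-- A Borel property that holds almost everywhere holds almost everywhere on almost all slices
over a `σ`-compact set. -/
theorem ae_ae_of_prodHaar {P : WithBorel (X × Y) → Prop} (hPm : MeasurableSet {q | P q})
    (hP : ∀ᵐ q ∂prodHaar m n, P q) {B : Set Y} (hB : IsSigmaCompact B) :
    ∀ᵐ x ∂m, ∀ᵐ y ∂n.restrict B, P (.mk (x, y)) := by
  have hm := (Measure.measurable_coe hPm.compl).comp (measurable_slice_restrict' (X := X) n hB)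
  have e : ∀ x : X, (∀ᵐ y ∂n.restrict B, P (.mk (x, y))) ↔
      ((n.restrict B).map (fun y => WithBorel.mk (x, y))) {q | P q}ᶜ = 0 := by
    intro x
    rw [Measure.map_apply (continuous_slice_right x).measurable hPm.compl]
    rfl
  -- Once the set of good `x` is known to be Borel, inner regularity reduces the claim to compact
  -- sets of `x`, where Fubini's theorem applies.
  have hS : MeasurableSet {x : X | ∀ᵐ y ∂n.restrict B, P (.mk (x, y))} := by
    simp_rw [e]
    exact hm (measurableSet_singleton 0)
  refine measure_eq_zero_of_forall_isCompact m
    (E := {x : X | ∀ᵐ y ∂n.restrict B, P (.mk (x, y))}ᶜ) hS.compl fun K hK => ?_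
  rw [← Measure.restrict_apply hS.compl]
  exact (isRadonProduct_prodHaar m n).ae_right hP hK.isSigmaCompact hB

end TameProduct

/-! ### Representatives in weighted spaces -/

namespace WeightedLp

variable {X : Type*} [TopologicalSpace X] [MeasurableSpace X] {v : PosFun X} {m : Measure X}

theorem measurable_coe {r : ℝ≥0∞} (f : WeightedLp r v m) : Measurable f :=
  (AEEqFun.stronglyMeasurable _).measurable

theorem norm_le_of_ae (h : WeightedLp ∞ v m) {C : ℝ} (hC : 0 ≤ C)
    (hb : ∀ᵐ x ∂m, v.toFun x * ‖h x‖ ≤ C) : ‖h‖ ≤ C := by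
  change ‖toLp ∞ v m h‖ ≤ C
  rw [Lp.norm_def, eLpNorm_exponent_top]
  refine ENNReal.toReal_le_of_le_ofReal hC (eLpNormEssSup_le_of_ae_bound ?_)
  filter_upwards [hb, coeFn_toLp h] with x hx e
  rwa [e, norm_mul, Complex.norm_real, Real.norm_of_nonneg (v.pos x).le]

theorem ae_le_norm (h : WeightedLp ∞ v m) : ∀ᵐ x ∂m, v.toFun x * ‖h x‖ ≤ ‖h‖ := by
  have h1 : ∀ᵐ x ∂m, ‖toLp ∞ v m h x‖ₑ ≤ eLpNormEssSup (toLp ∞ v m h) m :=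
    ae_le_eLpNormEssSup
  have h2 : ‖h‖ = (eLpNormEssSup (toLp ∞ v m h) m).toReal := by
    change ‖toLp ∞ v m h‖ = _
    rw [Lp.norm_def, eLpNorm_exponent_top]
  have h3 : eLpNormEssSup (toLp ∞ v m h) m ≠ ∞ := by
    rw [← eLpNorm_exponent_top]
    exact Lp.eLpNorm_ne_top _
  filter_upwards [h1, coeFn_toLp h] with x hx e
  have h4 := ENNReal.toReal_mono h3 hx
  rwa [← h2, toReal_enorm, e, norm_mul, Complex.norm_real, Real.norm_of_nonneg (v.pos x).le] at h4

theorem exists_bounded_rep [BorelSpace X] (h : WeightedLp ∞ v m) :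
    ∃ k : X → ℂ, Measurable k ∧ (∀ x, v.toFun x * ‖k x‖ ≤ ‖h‖) ∧ h =ᵐ[m] k := by
  have hE : MeasurableSet {x | v.toFun x * ‖h x‖ ≤ ‖h‖} :=
    measurableSet_le (v.continuous.measurable.mul h.measurable_coe.norm) measurable_const
  refine ⟨_, h.measurable_coe.indicator hE, fun x => ?_, ?_⟩
  · by_cases hx : x ∈ {x | v.toFun x * ‖h x‖ ≤ ‖h‖}
    · rw [indicator_of_mem hx]; exact hx
    · rw [indicator_of_notMem hx, norm_zero, mul_zero]; exact norm_nonneg _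
  · filter_upwards [h.ae_le_norm] with x hx
    exact (indicator_of_mem (show x ∈ {x | v.toFun x * ‖h x‖ ≤ ‖h‖} from hx) _).symm

/-- The class of a Borel function `k` with `v |k| ≤ C`. -/
def ofBounded [BorelSpace X] (k : X → ℂ) (hk : Measurable k) (C : ℝ)
    (hC : ∀ x, v.toFun x * ‖k x‖ ≤ C) : WeightedLp ∞ v m :=
  mk k (memLp_top_of_bound ((Complex.measurable_ofReal.comp v.continuous.measurable).mul
    hk).aestronglyMeasurable C (.of_forall fun x => by
      rw [norm_mul, Complex.norm_real, Real.norm_of_nonneg (v.pos x).le]; exact hC x))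
    hk.aestronglyMeasurable

theorem coeFn_ofBounded [BorelSpace X] (k : X → ℂ) (hk : Measurable k) (C : ℝ)
    (hC : ∀ x, v.toFun x * ‖k x‖ ≤ C) : ofBounded (m := m) k hk C hC =ᵐ[m] k :=
  coeFn_mk _ _ _

theorem norm_ofBounded_le [BorelSpace X] (k : X → ℂ) (hk : Measurable k) (C : ℝ)
    (hC0 : 0 ≤ C) (hC : ∀ x, v.toFun x * ‖k x‖ ≤ C) : ‖ofBounded (m := m) k hk C hC‖ ≤ C := by
  refine norm_le_of_ae _ hC0 ?_
  filter_upwards [coeFn_ofBounded (m := m) k hk C hC] with x e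
  rw [e]
  exact hC x

theorem norm_eq_integral (f : WeightedLp 1 v m) : ‖f‖ = ∫ x, v.toFun x * ‖f x‖ ∂m := by
  change ‖toLp 1 v m f‖ = _
  rw [L1.norm_eq_integral_norm]
  refine integral_congr_ae ?_
  filter_upwards [coeFn_toLp f] with x e
  rw [e, norm_mul, Complex.norm_real, Real.norm_of_nonneg (v.pos x).le]

theorem integrable (f : WeightedLp 1 v m) : Integrable (fun x => (v.toFun x : ℂ) * f x) m :=
  memLp_one_iff_integrable.1 f.memLp

/-- The class of an integrable function. -/
def ofIntegrable [BorelSpace X] (f : X → ℂ) (hf : Measurable f)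
    (hi : Integrable (fun x => (v.toFun x : ℂ) * f x) m) : WeightedLp 1 v m :=
  mk f (memLp_one_iff_integrable.2 hi) hf.aestronglyMeasurable

theorem coeFn_ofIntegrable [BorelSpace X] (f : X → ℂ) (hf : Measurable f)
    (hi : Integrable (fun x => (v.toFun x : ℂ) * f x) m) : ofIntegrable f hf hi =ᵐ[m] f :=
  coeFn_mk _ _ _

theorem toLp_surjective [BorelSpace X] (r : ℝ≥0∞) : Function.Surjective (toLp r v m) := by
  intro g
  have hg := (Lp.stronglyMeasurable g).measurable
  have hv : ∀ x, (v.toFun x : ℂ) ≠ 0 := fun x => Complex.ofReal_ne_zero.2 (v.pos x).ne'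
  have hm : Measurable fun x => (v.toFun x : ℂ)⁻¹ * g x :=
    (Complex.measurable_ofReal.comp v.continuous.measurable).inv.mul hg
  refine ⟨mk (fun x => (v.toFun x : ℂ)⁻¹ * g x) ?_ hm.aestronglyMeasurable, ?_⟩
  · have e : (fun x => (v.toFun x : ℂ) * ((v.toFun x : ℂ)⁻¹ * g x)) = g := by
      ext x; rw [mul_inv_cancel_left₀ (hv x)]
    rw [e]
    exact Lp.memLp g
  · refine Lp.ext ?_
    filter_upwards [coeFn_toLp (mk (fun x => (v.toFun x : ℂ)⁻¹ * g x) _ hm.aestronglyMeasurable),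
      coeFn_mk (r := r) (v := v) (fun x => (v.toFun x : ℂ)⁻¹ * g x) _ hm.aestronglyMeasurable] with x e1 e2
    rw [e1, e2, mul_inv_cancel_left₀ (hv x)]

instance [BorelSpace X] (r : ℝ≥0∞) [Fact (1 ≤ r)] : CompleteSpace (WeightedLp r v m) := by
  let e : WeightedLp r v m ≃ₗᵢ[ℂ] Lp ℂ r m :=
    { LinearEquiv.ofBijective (toLp r v m) ⟨toLp_injective, toLp_surjective r⟩ with
      norm_map' := fun _ => rfl }
  exact e.toIsometryEquiv.completeSpace

end WeightedLp

/-! ### Convolution -/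

section Nice

variable {G : Type*} [Group G] [TopologicalSpace G] [MeasurableSpace G]

/-- A Borel function with `σ`-compact support that represents an element of `L^1(G, ω)`. -/
structure IsNice (μ : Measure G) (ω : Weight G) (a : G → ℂ) : Prop where
  measurable : Measurable a
  weighted : IsTame μ fun x => (ω x : ℂ) * a x

variable [IsTopologicalGroup G] [LocallyCompactSpace G] [T2Space G] [BorelSpace G]
  {μ : Measure G} [μ.IsHaarMeasure] [μ.InnerRegular] {ω : Weight G}

theorem Weight.ofReal_ne_zero (ω : Weight G) (x : G) : (ω x : ℂ) ≠ 0 :=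
  Complex.ofReal_ne_zero.2 (ω.pos x).ne'

theorem Weight.norm_ofReal (ω : Weight G) (x : G) : ‖(ω x : ℂ)‖ = ω x := by
  rw [Complex.norm_real, Real.norm_of_nonneg (ω.pos x).le]

theorem Weight.measurable_ofReal (ω : Weight G) : Measurable fun x => (ω x : ℂ) :=
  Complex.measurable_ofReal.comp ω.continuous.measurable

/-- The weights cancel: $qa=(q/\omega)(\omega a)$ with $q/\omega$ bounded. -/
theorem IsNice.mul {a : G → ℂ} (ha : IsNice μ ω a) {q : G → ℂ} (hq : Measurable q) {C : ℝ}
    (hC : ∀ x, ‖q x‖ ≤ C * ω x) : IsTame μ fun x => q x * a x := by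
  have h1 := ha.weighted.bdd_mul (hq.div ω.measurable_ofReal) (C := C) (fun x => by
    rw [Pi.div_apply, norm_div, ω.norm_ofReal]
    exact (div_le_iff₀ (ω.pos x)).2 (hC x))
  convert! h1 using 2 with x
  rw [Pi.div_apply]
  field_simp [ω.ofReal_ne_zero x]

theorem IsNice.tame {a : G → ℂ} (ha : IsNice μ ω a) : IsTame μ a := by
  have := ha.mul (measurable_const (a := (1 : ℂ))) (C := 1) (fun x => by
    rw [norm_one, one_mul]; exact ω.one_le x)
  simpa using this

theorem L1.exists_nice (f : L1 μ ω) : ∃ a, IsNice μ ω a ∧ f =ᵐ[μ] a := by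
  obtain ⟨A, hA, hAf, h⟩ := exists_isTame_ae_eq (m := μ) (ω.measurable_ofReal.mul
    (WeightedLp.measurable_coe f)) f.integrable
  refine ⟨A.indicator f, ⟨(WeightedLp.measurable_coe f).indicator hA.measurableSet', ?_⟩, ?_⟩
  · convert! hAf using 2 with x
    by_cases hx : x ∈ A
    · rw [indicator_of_mem hx, indicator_of_mem hx]; rfl
    · rw [indicator_of_notMem hx, indicator_of_notMem hx, mul_zero]
  · filter_upwards [h] with x hx
    by_cases hxA : x ∈ A
    · rw [indicator_of_mem hxA]
    · rw [indicator_of_notMem hxA] at hx ⊢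
      exact (mul_eq_zero.1 hx).resolve_left (ω.ofReal_ne_zero x)

/-- The class of a nice function. -/
def IsNice.toL1 {a : G → ℂ} (ha : IsNice μ ω a) : L1 μ ω :=
  WeightedLp.ofIntegrable a ha.measurable ha.weighted.integrable

theorem IsNice.coeFn_toL1 {a : G → ℂ} (ha : IsNice μ ω a) : ha.toL1 =ᵐ[μ] a :=
  WeightedLp.coeFn_ofIntegrable _ _ _

theorem isNice_indicator {A K : Set G} (hA : MeasurableSet A) (hK : IsCompact K) (hAK : A ⊆ K)
    {v : G → ℂ} (hv : Continuous v) : IsNice μ ω (A.indicator v) := by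
  refine ⟨hv.measurable.indicator hA, ?_⟩
  convert! isTame_indicator (m := μ) hA hK hAK
    ((Complex.continuous_ofReal.comp ω.continuous).mul hv) using 2 with x
  by_cases hx : x ∈ A
  · rw [indicator_of_mem hx, indicator_of_mem hx]; rfl
  · rw [indicator_of_notMem hx, indicator_of_notMem hx, mul_zero]

theorem isSigmaCompact_mul {A B : Set G} (hA : IsSigmaCompact A) (hB : IsSigmaCompact B) :
    ∃ S, IsSigmaCompact S ∧ ∀ x ∈ A, ∀ y ∈ B, x * y ∈ S :=
  ⟨_, (isSigmaCompact_rect hA hB).image (f := fun q : WithBorel (G × G) => q.out.1 * q.out.2)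
    (continuous_fst_out.mul continuous_snd_out), fun x hx y hy => ⟨.mk (x, y), ⟨hx, hy⟩, rfl⟩⟩

/-- Submultiplicativity of the weight enters here. After the left translation $y\mapsto xy$ the
integrand is at most $C\,\omega(x)|a(x)|\,\omega(y)|b(y)|$, and its support lies over $A$ and $AB$.
-/
theorem isTame_convolution_kernel {a b : G → ℂ} (ha : IsNice μ ω a) (hb : IsNice μ ω b)
    {q : G → ℂ} (hq : Measurable q) {C : ℝ} (hC : ∀ x, ‖q x‖ ≤ C * ω x) :
    IsTame (prodHaar μ μ) fun z : WithBorel (G × G) =>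
      q z.out.2 * (a z.out.1 * b (z.out.1⁻¹ * z.out.2)) := by
  obtain ⟨A, hA, hAa⟩ := ha.weighted.support
  obtain ⟨B, hB, hBb⟩ := hb.weighted.support
  obtain ⟨S, hS, hAB⟩ := isSigmaCompact_mul hA hB
  have hm2 : Continuous fun z : WithBorel (G × G) => z.out.1⁻¹ * z.out.2 :=
    continuous_fst_out.inv.mul continuous_snd_out
  have hm : Measurable fun z : WithBorel (G × G) => q z.out.2 * (a z.out.1 * b (z.out.1⁻¹ * z.out.2)) :=
    (hq.comp continuous_snd_out.measurable).mul ((ha.measurable.comp continuous_fst_out.measurable).mul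
      (hb.measurable.comp hm2.measurable))
  refine IsTame.of_lintegral_right hm hA hS ?_ ?_
  · intro x y hxy
    have h1 := left_ne_zero_of_mul (right_ne_zero_of_mul hxy)
    have h2 := right_ne_zero_of_mul (right_ne_zero_of_mul hxy)
    have hx := hAa x (mul_ne_zero (ω.ofReal_ne_zero x) h1)
    have hy := hBb _ (mul_ne_zero (ω.ofReal_ne_zero (x⁻¹ * y)) h2)
    refine ⟨hx, ?_⟩
    have := hAB x hx _ hy
    rwa [mul_inv_cancel_left] at this
  · have h1 : ∀ x, ∫⁻ y, ‖q y * (a x * b (x⁻¹ * y))‖ₑ ∂μ ≤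
        ENNReal.ofReal C * ‖(ω x : ℂ) * a x‖ₑ * ∫⁻ y, ‖(ω y : ℂ) * b y‖ₑ ∂μ := by
      intro x
      rw [← lintegral_mul_left_eq_self (μ := μ) _ x, ← lintegral_const_mul _ hb.weighted.measurable.enorm]
      refine lintegral_mono fun y => ?_
      simp only
      rw [inv_mul_cancel_left, ← ofReal_norm, ← ofReal_norm, ← ofReal_norm]
      have hC0 : 0 ≤ C := by
        have := (norm_nonneg _).trans (hC 1)
        rwa [ω.map_one, mul_one] at this
      rw [← ENNReal.ofReal_mul hC0, ← ENNReal.ofReal_mul (by positivity)]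
      refine ENNReal.ofReal_le_ofReal ?_
      rw [norm_mul, norm_mul, norm_mul, norm_mul, ω.norm_ofReal, ω.norm_ofReal]
      calc ‖q (x * y)‖ * (‖a x‖ * ‖b y‖) ≤ C * (ω x * ω y) * (‖a x‖ * ‖b y‖) := by
            refine mul_le_mul_of_nonneg_right ((hC _).trans ?_) (by positivity)
            exact mul_le_mul_of_nonneg_left (ω.map_mul_le x y) hC0
        _ = C * (ω x * ‖a x‖) * (ω y * ‖b y‖) := by ring
    refine (lintegral_mono h1).trans_lt ?_
    rw [lintegral_mul_const _ (ha.weighted.measurable.enorm.const_mul _),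
      lintegral_const_mul _ ha.weighted.measurable.enorm]
    exact ENNReal.mul_lt_top (ENNReal.mul_lt_top ENNReal.ofReal_lt_top
      ha.weighted.integrable.2) hb.weighted.integrable.2

/-- The choice $q=\omega$ in `isTame_convolution_kernel`, with $x$ integrated out. -/
theorem IsNice.convolve {a b : G → ℂ} (ha : IsNice μ ω a) (hb : IsNice μ ω b) :
    IsNice μ ω (convolve μ a b) := by
  have h1 := (isTame_convolution_kernel ha hb ω.measurable_ofReal (C := 1)
    (fun x => by rw [ω.norm_ofReal, one_mul])).slice_left
  have e : (fun y => ∫ x, (ω y : ℂ) * (a x * b (x⁻¹ * y)) ∂μ) =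
      fun y => (ω y : ℂ) * Beurling.convolve μ a b y := by
    ext y
    rw [integral_const_mul]
    rfl
  have h2 : IsTame μ fun y => (ω y : ℂ) * Beurling.convolve μ a b y := by
    rw [← e]; exact h1
  refine ⟨?_, h2⟩
  have h3 := h2.measurable.div ω.measurable_ofReal
  have e2 : Beurling.convolve μ a b = (fun y => (ω y : ℂ) * Beurling.convolve μ a b y) /
      fun x => (ω x : ℂ) := by
    ext x
    rw [Pi.div_apply, mul_div_cancel_left₀ _ (ω.ofReal_ne_zero x)]
  rw [e2]
  exact h3

theorem integral_mul_convolve {a b : G → ℂ} (ha : IsNice μ ω a) (hb : IsNice μ ω b)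
    {q : G → ℂ} (hq : Measurable q) {C : ℝ} (hC : ∀ x, ‖q x‖ ≤ C * ω x) :
    ∫ x, q x * convolve μ a b x ∂μ = ∫ x, ∫ y, q (x * y) * (a x * b y) ∂μ ∂μ := by
  have h1 := (isTame_convolution_kernel ha hb hq hC).integral_swap
  calc ∫ x, q x * convolve μ a b x ∂μ
      = ∫ y, ∫ x, q y * (a x * b (x⁻¹ * y)) ∂μ ∂μ := by
        refine integral_congr_ae (.of_forall fun y => ?_)
        simp only [integral_const_mul]
        rfl
    _ = ∫ x, ∫ y, q y * (a x * b (x⁻¹ * y)) ∂μ ∂μ := h1.symm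
    _ = _ := by
        refine integral_congr_ae (.of_forall fun x => ?_)
        simp only
        rw [← integral_mul_left_eq_self (μ := μ) _ x]
        simp only [inv_mul_cancel_left]

/-- For fixed $y$ the set of $x$ with $g(y^{-1}x)\ne b(y^{-1}x)$ is a left translate of a null set.
Fubini's theorem exchanges the roles of $x$ and $y$, over the $\sigma$-compact support of $a$, so
inversion is never applied to a null set. -/
theorem convolve_ae_eq {f g a b : G → ℂ} (ha : IsNice μ ω a) (hb : IsNice μ ω b)
    (hg : Measurable g) (hfa : f =ᵐ[μ] a) (hgb : g =ᵐ[μ] b) :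
    convolve μ f g =ᵐ[μ] convolve μ a b := by
  obtain ⟨A, hA, hAa⟩ := ha.tame.support
  have hm2 : Measurable fun z : WithBorel (G × G) => z.out.2⁻¹ * z.out.1 :=
    (continuous_snd_out.inv.mul continuous_fst_out).measurable
  have hPm : MeasurableSet {z : WithBorel (G × G) | g (z.out.2⁻¹ * z.out.1) = b (z.out.2⁻¹ * z.out.1)} :=
    measurableSet_eq_fun (hg.comp hm2) (hb.measurable.comp hm2)
  have hP : ∀ᵐ z ∂prodHaar μ μ, g (z.out.2⁻¹ * z.out.1) = b (z.out.2⁻¹ * z.out.1) := by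
    refine (isRadonProduct_prodHaar μ μ).measure_eq_zero_of_left (E :=
      {z | g (z.out.2⁻¹ * z.out.1) = b (z.out.2⁻¹ * z.out.1)}ᶜ) hPm.compl fun y => ?_
    have h0 : μ {x | g x = b x}ᶜ = 0 := hgb
    rw [← measure_preimage_mul μ y⁻¹] at h0
    exact h0
  filter_upwards [ae_ae_of_prodHaar hPm hP hA] with x hx
  refine integral_congr_ae ?_
  filter_upwards [hfa, (ae_restrict_iff' hA.measurableSet').1 hx] with y e1 e2
  rw [e1]
  by_cases hy : a y = 0
  · rw [hy, zero_mul, zero_mul]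
  · exact congrArg _ (e2 (hAa y hy))

/-- In particular the main branch in the definition of `L1.conv` is always the one taken. -/
theorem L1.conv_ae_eq (f g : L1 μ ω) {a b : G → ℂ} (ha : IsNice μ ω a) (hb : IsNice μ ω b)
    (hfa : f =ᵐ[μ] a) (hgb : g =ᵐ[μ] b) : f.conv g =ᵐ[μ] convolve μ a b := by
  have h1 := convolve_ae_eq ha hb (WeightedLp.measurable_coe g) hfa hgb
  have h2 := ha.convolve hb
  have hc : MemLp (fun x => (ω.fn.toFun x : ℂ) * Beurling.convolve μ f g x) 1 μ ∧
      AEStronglyMeasurable (Beurling.convolve μ f g) μ := by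
    constructor
    · refine (memLp_one_iff_integrable.2 h2.weighted.integrable).ae_eq ?_
      filter_upwards [h1] with x e
      rw [e]
      rfl
    · exact h2.measurable.aestronglyMeasurable.congr h1.symm
  rw [L1.conv, dif_pos hc]
  exact (WeightedLp.coeFn_mk _ hc.1 hc.2).trans h1

/-! ### The pairing -/

theorem LInf.exists_rep (h : LInf μ ω) :
    ∃ k : G → ℂ, Measurable k ∧ (∀ x, ‖k x‖ ≤ ‖h‖ * ω x) ∧ h =ᵐ[μ] k := by
  obtain ⟨k, hk, hb, e⟩ := h.exists_bounded_rep
  refine ⟨k, hk, fun x => ?_, e⟩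
  have h1 : (ω x)⁻¹ * ‖k x‖ ≤ ‖h‖ := hb x
  rwa [inv_mul_le_iff₀ (ω.pos x), mul_comm] at h1

theorem pair_eq {h : LInf μ ω} {f : L1 μ ω} {k a : G → ℂ} (hk : h =ᵐ[μ] k) (ha : f =ᵐ[μ] a) :
    pair h f = ∫ x, k x * a x ∂μ := by
  refine integral_congr_ae ?_
  filter_upwards [hk, ha] with x e1 e2
  rw [e1, e2, mul_comm]

theorem pair_conv {h : LInf μ ω} {f g : L1 μ ω} {k a b : G → ℂ} (hk : h =ᵐ[μ] k)
    (hkm : Measurable k) {C : ℝ} (hC : ∀ x, ‖k x‖ ≤ C * ω x) (ha : IsNice μ ω a)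
    (hb : IsNice μ ω b) (hfa : f =ᵐ[μ] a) (hgb : g =ᵐ[μ] b) :
    pair h (f.conv g) = ∫ x, ∫ y, k (x * y) * (a x * b y) ∂μ ∂μ := by
  rw [pair_eq hk (L1.conv_ae_eq f g ha hb hfa hgb), integral_mul_convolve ha hb hkm hC]

theorem ae_eq_zero_of_integral_mul_nice {k : G → ℂ} (hk : Measurable k) {C : ℝ}
    (hC : ∀ x, ‖k x‖ ≤ C * ω x) (h0 : ∀ a, IsNice μ ω a → ∫ x, k x * a x ∂μ = 0) :
    k =ᵐ[μ] 0 := by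
  refine ae_eq_zero_of_forall_setIntegral hk (fun K hK => ?_) (fun A K hA hK hAK => ?_)
  · obtain ⟨D, hD⟩ := (hK.image ω.continuous).bddAbove
    have : IsFiniteMeasure (μ.restrict K) := isFiniteMeasure_restrict.2 hK.measure_lt_top.ne
    refine Integrable.of_bound hk.aestronglyMeasurable (|C| * D) ?_
    filter_upwards [ae_restrict_mem hK.measurableSet] with x hx
    exact (hC x).trans (mul_le_mul (le_abs_self C) (hD (mem_image_of_mem ω hx)) (ω.pos x).le
      (abs_nonneg C))
  · rw [← h0 _ (isNice_indicator hA hK hAK (v := fun _ => 1) continuous_const),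
      ← integral_indicator hA]
    refine integral_congr_ae (.of_forall fun x => ?_)
    by_cases hx : x ∈ A
    · simp [indicator_of_mem hx]
    · simp [indicator_of_notMem hx]

theorem LInf.ext_pair {h k : LInf μ ω} (H : ∀ f : L1 μ ω, pair h f = pair k f) : h = k := by
  obtain ⟨h', hm, hb, he⟩ := LInf.exists_rep (h - k)
  have h1 : ∀ f : L1 μ ω, pair (h - k) f = 0 := by
    intro f
    have e : h - k = h + (-1 : ℂ) • k := by rw [neg_one_smul, sub_eq_add_neg]
    rw [e, pair_add, pair_smul, H f]
    ring
  have h2 : h' =ᵐ[μ] 0 := ae_eq_zero_of_integral_mul_nice hm hb fun a ha => by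
    rw [← pair_eq he ha.coeFn_toL1, h1]
  rw [← sub_eq_zero]
  exact WeightedLp.ext ((he.trans h2).trans WeightedLp.coeFn_zero.symm)

theorem norm_pair_le (h : LInf μ ω) (f : L1 μ ω) : ‖pair h f‖ ≤ ‖h‖ * ‖f‖ := by
  rw [WeightedLp.norm_eq_integral, ← integral_const_mul]
  refine norm_integral_le_of_norm_le ?_ ?_
  · refine ((WeightedLp.integrable f).norm.const_mul ‖h‖).congr (.of_forall fun x => ?_)
    simp only [norm_mul, Complex.norm_real, Real.norm_of_nonneg (PosFun.pos ω.fn x).le]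
  · filter_upwards [h.ae_le_norm] with x hx
    have h1 : (ω x)⁻¹ * ‖h x‖ ≤ ‖h‖ := hx
    rw [inv_mul_le_iff₀ (ω.pos x), mul_comm] at h1
    rw [norm_mul]
    change _ ≤ ‖h‖ * (ω x * ‖f x‖)
    calc ‖f x‖ * ‖h x‖ ≤ ‖f x‖ * (‖h‖ * ω x) := by gcongr
      _ = _ := by ring

end Nice

/-! ### Bounded bilinear forms on `L^1` spaces -/

section VectorExtension

variable {X E : Type*} [MeasurableSpace X] {m : Measure X} [NormedAddCommGroup E] [NormedSpace ℂ E]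

open Classical in
/-- The vector measure `A ↦ β(1_A, ·)`. -/
def indicatorForm (β : Lp ℂ 1 m →L[ℂ] E →L[ℂ] ℂ) (A : Set X) : E →L[ℝ] ℂ :=
  if h : MeasurableSet A ∧ m A ≠ ∞ then
    (β (indicatorConstLp 1 h.1 h.2 1)).restrictScalars ℝ else 0

theorem indicatorForm_apply (β : Lp ℂ 1 m →L[ℂ] E →L[ℂ] ℂ) {A : Set X} (hA : MeasurableSet A)
    (hmA : m A ≠ ∞) (V : E) : indicatorForm β A V = β (indicatorConstLp 1 hA hmA 1) V := by
  rw [indicatorForm, dif_pos ⟨hA, hmA⟩]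
  rfl

/-- The form becomes a measure with values in the dual of `E`, dominated by $\|\beta\|\,m$.
Integration of `E`-valued functions against it is the extension of the form to $L^1(E)$. -/
theorem dominatedFinMeasAdditive_indicatorForm (β : Lp ℂ 1 m →L[ℂ] E →L[ℂ] ℂ) :
    DominatedFinMeasAdditive m (indicatorForm β) ‖β‖ := by
  refine ⟨fun s t hs ht hms hmt hst => ?_, fun s hs hms => ?_⟩
  · ext V
    rw [_root_.add_apply, indicatorForm_apply β hs hms, indicatorForm_apply β ht hmt,
      indicatorForm_apply β (hs.union ht) (by finiteness), indicatorConstLp_disjoint_union hs ht hms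
      hmt hst, map_add, _root_.add_apply]
  · refine ContinuousLinearMap.opNorm_le_bound _ (by positivity) fun V => ?_
    rw [indicatorForm_apply β hs hms.ne]
    refine (β.le_opNorm₂ _ _).trans ?_
    rw [norm_indicatorConstLp one_ne_zero ENNReal.one_ne_top]
    simp

/-- A bounded bilinear form on `L^1 × E` extends to `L^1(E)`. -/
theorem exists_extension (β : Lp ℂ 1 m →L[ℂ] E →L[ℂ] ℂ) :
    ∃ I : Lp E 1 m →L[ℂ] ℂ, (∀ F, ‖I F‖ ≤ ‖β‖ * ‖F‖) ∧
      ∀ (u : X → ℂ) (hu : MemLp u 1 m) (V : E) (h : MemLp (fun x => u x • V) 1 m),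
        I (h.toLp _) = β (hu.toLp u) V := by
  have hT := dominatedFinMeasAdditive_indicatorForm β
  have hsm : ∀ (c : ℂ) (s : Set X) (V : E),
      indicatorForm β s (c • V) = c • indicatorForm β s V := by
    intro c s V
    by_cases h : MeasurableSet s ∧ m s ≠ ∞
    · rw [indicatorForm_apply β h.1 h.2, indicatorForm_apply β h.1 h.2, map_smul]
    · rw [indicatorForm, dif_neg h]; simp
  let I : Lp E 1 m →L[ℂ] ℂ := LinearMap.mkContinuous
    { toFun := fun F => L1.setToL1 hT F
      map_add' := fun F F' => map_add _ F F'
      map_smul' := fun c F => L1.setToL1_smul hT hsm c F } ‖β‖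
    (fun F => L1.norm_setToL1_le_mul_norm hT (norm_nonneg β) F)
  refine ⟨I, fun F => L1.norm_setToL1_le_mul_norm hT (norm_nonneg β) F, fun u hu V h => ?_⟩
  -- This is $U\mapsto U\otimes V$. Both sides are continuous in `U`, so the identity has to be
  -- checked on indicator functions only.
  set J : Lp ℂ 1 m →L[ℂ] Lp E 1 m := (ContinuousLinearMap.toSpanSingleton ℂ V).compLpL 1 m
  have hJ : ∀ U : Lp ℂ 1 m, J U =ᵐ[m] fun x => U x • V := fun U =>
    ContinuousLinearMap.coeFn_compLpL _ U
  have key : ∀ U : Lp ℂ 1 m, I (J U) = β U V := by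
    intro U
    refine Lp.induction ENNReal.one_ne_top (fun U => I (J U) = β U V) ?_ ?_ ?_ U
    · intro c s hs hms
      rw [Lp.simpleFunc.coe_indicatorConst]
      have e1 : J (indicatorConstLp 1 hs hms.ne c) = indicatorConstLp 1 hs hms.ne (c • V) := by
        refine Lp.ext ?_
        filter_upwards [hJ (indicatorConstLp 1 hs hms.ne c),
          indicatorConstLp_coeFn (p := 1) (hs := hs) (hμs := hms.ne) (c := c),
          indicatorConstLp_coeFn (p := 1) (hs := hs) (hμs := hms.ne) (c := c • V)] with x h1 h2 h3
        rw [h1, h2, h3]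
        by_cases hx : x ∈ s
        · rw [indicator_of_mem hx, indicator_of_mem hx]
        · rw [indicator_of_notMem hx, indicator_of_notMem hx, zero_smul]
      have e2 : indicatorConstLp 1 hs hms.ne c = c • indicatorConstLp 1 hs hms.ne (1 : ℂ) := by
        refine Lp.ext ?_
        filter_upwards [Lp.coeFn_smul c (indicatorConstLp 1 hs hms.ne (1 : ℂ)),
          indicatorConstLp_coeFn (p := 1) (hs := hs) (hμs := hms.ne) (c := c),
          indicatorConstLp_coeFn (p := 1) (hs := hs) (hμs := hms.ne) (c := (1 : ℂ))] with x h1 h2 h3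
        rw [h1, h2, Pi.smul_apply, h3]
        by_cases hx : x ∈ s
        · rw [indicator_of_mem hx, indicator_of_mem hx, smul_eq_mul, mul_one]
        · rw [indicator_of_notMem hx, indicator_of_notMem hx, smul_zero]
      rw [e1, e2, map_smul]
      change L1.setToL1 hT (indicatorConstLp 1 hs hms.ne (c • V)) = _
      rw [L1.setToL1_indicatorConstLp hT hs hms.ne, hsm, indicatorForm_apply β hs hms.ne]
      rfl
    · intro f g hf hg _ h1 h2
      rw [map_add, map_add, map_add, _root_.add_apply, h1, h2]
    · exact isClosed_eq (by fun_prop) (by fun_prop)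
  rw [← key]
  congr 1

end VectorExtension

/-- The continuous functions with compact support. -/
def compactlySupported (Z : Type*) [TopologicalSpace Z] : Submodule ℂ (Z → ℂ) where
  carrier := {F | Continuous F ∧ HasCompactSupport F}
  add_mem' hf hg := ⟨hf.1.add hg.1, hf.2.add hg.2⟩
  zero_mem' := ⟨continuous_zero, HasCompactSupport.zero⟩
  smul_mem' c _ hf := ⟨hf.1.const_smul c, hf.2.smul_left (f := fun _ => c)⟩

section Forms

variable {X Y : Type*} [Group X] [TopologicalSpace X] [IsTopologicalGroup X]
  [LocallyCompactSpace X] [T2Space X] [MeasurableSpace X] [BorelSpace X]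
  [Group Y] [TopologicalSpace Y] [IsTopologicalGroup Y]
  [LocallyCompactSpace Y] [T2Space Y] [MeasurableSpace Y] [BorelSpace Y]
  {m : Measure X} {n : Measure Y} [m.IsHaarMeasure] [m.InnerRegular]
  [n.IsHaarMeasure] [n.InnerRegular]

theorem memLp_of_mem_compactlySupported {F : X → ℂ} (hF : F ∈ compactlySupported X) :
    MemLp F 1 m :=
  hF.1.memLp_of_hasCompactSupport hF.2

theorem slice_mem_compactlySupported {F : WithBorel (X × Y) → ℂ}
    (hF : F ∈ compactlySupported (WithBorel (X × Y))) (x : X) :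
    (fun y => F (.mk (x, y))) ∈ compactlySupported Y := by
  refine ⟨hF.1.comp (continuous_slice_right x), ?_⟩
  refine HasCompactSupport.intro (hF.2.isCompact.image continuous_snd_out) fun y hy => ?_
  by_contra h
  exact hy ⟨_, subset_tsupport F h, rfl⟩

variable (n) in
/-- The slice `F(x, ·)` in `L^1`. -/
def slice (F : compactlySupported (WithBorel (X × Y))) (x : X) : Lp ℂ 1 n :=
  (memLp_of_mem_compactlySupported (slice_mem_compactlySupported F.2 x)).toLp

theorem slice_coeFn (F : compactlySupported (WithBorel (X × Y))) (x : X) :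
    slice n F x =ᵐ[n] fun y => F.1 (.mk (x, y)) := MemLp.coeFn_toLp _

/-- A continuous function of two variables with compact support thus becomes a continuous
$L^1$-valued function, hence strongly measurable even though $L^1$ may be nonseparable. -/
theorem continuous_slice (F : compactlySupported (WithBorel (X × Y))) : Continuous (slice n F) := by
  rw [continuous_iff_continuousAt]
  intro x₀
  have h1 : ∀ x, dist (slice n F x) (slice n F x₀) =
      ∫ y, ‖F.1 (.mk (x, y)) - F.1 (.mk (x₀, y))‖ ∂n := by
    intro x
    rw [dist_eq_norm, L1.norm_eq_integral_norm]
    refine integral_congr_ae ?_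
    filter_upwards [Lp.coeFn_sub (slice n F x) (slice n F x₀), slice_coeFn F x,
      slice_coeFn F x₀] with y e1 e2 e3
    rw [e1, Pi.sub_apply, e2, e3]
  have h2 : ContinuousOn (fun x => ∫ y, ‖F.1 (.mk (x, y)) - F.1 (.mk (x₀, y))‖ ∂n) univ := by
    refine continuousOn_integral_of_compact_support
      (f := fun x y => ‖F.1 (.mk (x, y)) - F.1 (.mk (x₀, y))‖)
      (F.2.2.isCompact.image continuous_snd_out) (Continuous.continuousOn ?_) ?_
    · refine Continuous.norm (Continuous.sub (F.2.1.comp WithBorel.continuous_mk)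
        (F.2.1.comp ((continuous_slice_right x₀).comp continuous_snd)))
    · intro x y _ hy
      have h3 : ∀ x : X, F.1 (.mk (x, y)) = 0 := by
        intro x
        by_contra h
        exact hy ⟨_, subset_tsupport F.1 h, rfl⟩
      simp only [h3, sub_zero, norm_zero]
  rw [ContinuousAt, tendsto_iff_dist_tendsto_zero]
  simp_rw [h1]
  have h3 := (continuousOn_univ.1 h2).tendsto x₀
  simpa using h3

theorem hasCompactSupport_slice (F : compactlySupported (WithBorel (X × Y))) :
    HasCompactSupport (slice n F) := by
  refine HasCompactSupport.intro (F.2.2.isCompact.image continuous_fst_out) fun x hx => ?_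
  refine Lp.ext ?_
  filter_upwards [slice_coeFn (n := n) F x, Lp.coeFn_zero ℂ 1 n] with y e1 e2
  rw [e1, e2]
  by_contra h
  exact hx ⟨_, subset_tsupport F.1 h, rfl⟩

theorem memLp_slice (F : compactlySupported (WithBorel (X × Y))) : MemLp (slice n F) 1 m :=
  (continuous_slice F).memLp_of_hasCompactSupport (hasCompactSupport_slice F)

/-- By Tonelli's theorem the passage to slices is isometric from $L^1(X\times Y)$ to
$L^1(X;L^1(Y))$, which gives the sharp constant for the kernel. -/
theorem norm_slice (F : compactlySupported (WithBorel (X × Y))) :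
    ‖(memLp_slice (m := m) (n := n) F).toLp‖ =
      ‖(memLp_of_mem_compactlySupported (m := prodHaar m n) F.2).toLp‖ := by
  rw [Lp.norm_toLp, Lp.norm_toLp, eLpNorm_one_eq_lintegral_enorm, eLpNorm_one_eq_lintegral_enorm]
  have hF := isTame_of_hasCompactSupport (m := prodHaar m n) F.2.1 F.2.2
  obtain ⟨A, B, hA, hB, h0⟩ := hF.exists_rect
  rw [(isRadonProduct_prodHaar m n).lintegral_right hA hB hF.measurable.enorm
    (fun x y hxy => h0 x y (by simpa using hxy))]
  congr 1
  refine lintegral_congr fun x => ?_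
  rw [← eLpNorm_one_eq_lintegral_enorm, ← eLpNorm_congr_ae (slice_coeFn F x), ← Lp.enorm_def]

variable (m n) in
/-- The inclusion of the compactly supported functions into `L^1`. -/
def compactlySupportedToLp : compactlySupported X →ₗ[ℂ] Lp ℂ 1 m where
  toFun F := (memLp_of_mem_compactlySupported F.2).toLp
  map_add' _ _ := MemLp.toLp_add _ _
  map_smul' _ _ := MemLp.toLp_const_smul _ _

theorem denseRange_compactlySupportedToLp : DenseRange (compactlySupportedToLp m) := by
  intro f
  rw [Metric.mem_closure_iff]
  intro ε hε
  obtain ⟨g, hg, hgc, hgs⟩ := exists_hasCompactSupport_sub_le (Lp.memLp f)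
    (ε := ENNReal.ofReal (ε / 2)) (by simpa using hε)
  refine ⟨_, ⟨⟨g, hgc, hgs⟩, rfl⟩, ?_⟩
  refine lt_of_le_of_lt ?_ (half_lt_self hε)
  rw [dist_eq_norm, Lp.norm_def]
  refine ENNReal.toReal_le_of_le_ofReal (half_pos hε).le (le_trans (le_of_eq ?_) hg)
  refine eLpNorm_congr_ae ?_
  filter_upwards [Lp.coeFn_sub f (compactlySupportedToLp m ⟨g, hgc, hgs⟩),
    (memLp_of_mem_compactlySupported (m := m) (F := g) ⟨hgc, hgs⟩).coeFn_toLp] with x e1 e2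
  rw [e1, Pi.sub_apply, Pi.sub_apply]
  congr 1

/-- Bounded bilinear forms on `L^1 × L^1` are given by bounded Borel functions, on the compactly
supported functions. -/
theorem exists_form_representation (β : Lp ℂ 1 m →L[ℂ] Lp ℂ 1 n →L[ℂ] ℂ) :
    ∃ q : WithBorel (X × Y) → ℂ, Measurable q ∧ (∀ z, ‖q z‖ ≤ ‖β‖) ∧
      ∀ (u : compactlySupported X) (v : compactlySupported Y),
        β (compactlySupportedToLp m u) (compactlySupportedToLp n v) =
          ∫ z, q z * (u.1 z.out.1 * v.1 z.out.2) ∂prodHaar m n := by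
  obtain ⟨I, hI, hIβ⟩ := exists_extension β
  -- The extended form, evaluated on slices, is a functional bounded by $\|\beta\|$ in the norm of
  -- $L^1(X\times Y)$. It extends by density, and its representing function is the required kernel.
  let f : compactlySupported (WithBorel (X × Y)) →ₗ[ℂ] ℂ :=
    { toFun := fun F => I ((memLp_slice F).toLp)
      map_add' := fun F F' => by
        rw [← map_add, ← MemLp.toLp_add]
        congr 1
      map_smul' := fun c F => by
        rw [RingHom.id_apply, ← map_smul, ← MemLp.toLp_const_smul]
        congr 1 }
  have hf : ∀ F, ‖f F‖ ≤ ‖β‖ * ‖compactlySupportedToLp (prodHaar m n) F‖ := by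
    intro F
    refine (hI _).trans (le_of_eq ?_)
    rw [norm_slice]
    rfl
  have hd := denseRange_compactlySupportedToLp (m := prodHaar m n)
  obtain ⟨c, hc⟩ := exists_partition (WithBorel (X × Y))
  obtain ⟨q, hq, hqb, hqf⟩ := exists_representation (m := prodHaar m n) (fun i => (hc i).1)
    (fun i => (hc i).2) (f.extendOfNorm (compactlySupportedToLp (prodHaar m n)))
  refine ⟨q, hq, fun z => (hqb z).trans
    (LinearMap.opNorm_extendOfNorm_le hd (norm_nonneg β) hf), fun u v => ?_⟩
  have hF : (fun z : WithBorel (X × Y) => u.1 z.out.1 * v.1 z.out.2) ∈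
      compactlySupported (WithBorel (X × Y)) := by
    refine ⟨(u.2.1.comp continuous_fst_out).mul (v.2.1.comp continuous_snd_out), ?_⟩
    refine HasCompactSupport.intro (isCompact_rect u.2.2.isCompact v.2.2.isCompact) fun z hz => ?_
    by_contra h
    exact hz ⟨subset_tsupport _ (left_ne_zero_of_mul h), subset_tsupport _ (right_ne_zero_of_mul h)⟩
  have h1 := hqf _ (memLp_of_mem_compactlySupported hF) hF.2
  rw [← h1]
  have h2 := LinearMap.extendOfNorm_eq hd ⟨_, hf⟩ ⟨_, hF⟩
  refine Eq.trans ?_ h2.symm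
  -- For a tensor $u\otimes v$ the slice at $x$ is $u(x)v$, where the extension reproduces the form.
  have h3 : slice n ⟨_, hF⟩ = fun x => u.1 x • compactlySupportedToLp n v := by
    ext1 x
    refine Lp.ext ?_
    filter_upwards [slice_coeFn (n := n) ⟨_, hF⟩ x, Lp.coeFn_smul (u.1 x) (compactlySupportedToLp n v),
      (memLp_of_mem_compactlySupported (m := n) v.2).coeFn_toLp] with y e1 e2 e3
    rw [e1, e2, Pi.smul_apply, smul_eq_mul]
    change u.1 x * v.1 y = _
    rw [← e3]
    rfl
  have h4 : MemLp (fun x => u.1 x • compactlySupportedToLp n v) 1 m := by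
    rw [← h3]; exact memLp_slice _
  refine (hIβ u.1 (memLp_of_mem_compactlySupported u.2) _ h4).symm.trans ?_
  change I _ = I _
  congr 1

end Forms

/-- A Borel property that holds almost everywhere holds almost everywhere on almost all slices
over a `σ`-compact set. -/
theorem ae_ae_of_prodHaar' {X Y : Type*} [Group X] [TopologicalSpace X] [IsTopologicalGroup X]
    [LocallyCompactSpace X] [T2Space X] [MeasurableSpace X] [BorelSpace X]
    [Group Y] [TopologicalSpace Y] [IsTopologicalGroup Y]
    [LocallyCompactSpace Y] [T2Space Y] [MeasurableSpace Y] [BorelSpace Y]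
    {m : Measure X} {n : Measure Y} [m.IsHaarMeasure] [m.InnerRegular]
    [n.IsHaarMeasure] [n.InnerRegular]
    {P : WithBorel (X × Y) → Prop} (hPm : MeasurableSet {q | P q})
    (hP : ∀ᵐ q ∂prodHaar m n, P q) {A : Set X} (hA : IsSigmaCompact A) :
    ∀ᵐ y ∂n, ∀ᵐ x ∂m.restrict A, P (.mk (x, y)) := by
  have hm := (Measure.measurable_coe hPm.compl).comp (measurable_slice_restrict (Y := Y) m hA)
  have e : ∀ y : Y, (∀ᵐ x ∂m.restrict A, P (.mk (x, y))) ↔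
      ((m.restrict A).map (fun x => WithBorel.mk (x, y))) {q | P q}ᶜ = 0 := by
    intro y
    rw [Measure.map_apply (continuous_slice_left y).measurable hPm.compl]
    rfl
  have hS : MeasurableSet {y : Y | ∀ᵐ x ∂m.restrict A, P (.mk (x, y))} := by
    simp_rw [e]
    exact hm (measurableSet_singleton 0)
  refine measure_eq_zero_of_forall_isCompact n
    (E := {y : Y | ∀ᵐ x ∂m.restrict A, P (.mk (x, y))}ᶜ) hS.compl fun K hK => ?_
  rw [← Measure.restrict_apply hS.compl]
  exact (isRadonProduct_prodHaar m n).ae_left hP hA hK.isSigmaCompact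

section Forms

variable {X Y : Type*} [Group X] [TopologicalSpace X] [IsTopologicalGroup X]
  [LocallyCompactSpace X] [T2Space X] [MeasurableSpace X] [BorelSpace X]
  [Group Y] [TopologicalSpace Y] [IsTopologicalGroup Y]
  [LocallyCompactSpace Y] [T2Space Y] [MeasurableSpace Y] [BorelSpace Y]
  {m : Measure X} {n : Measure Y} [m.IsHaarMeasure] [m.InnerRegular]
  [n.IsHaarMeasure] [n.InnerRegular] {q : WithBorel (X × Y) → ℂ}

theorem IsTame.measurable_integral_left {u : X → ℂ} (hu : IsTame m u) (hq : Measurable q) :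
    Measurable fun y : Y => ∫ x, q (.mk (x, y)) * u x ∂m := by
  obtain ⟨A, hA, hAu⟩ := hu.support
  have hm := measurable_integral_slice (measurable_slice_restrict (Y := Y) m hA)
    (hq.mul (hu.measurable.comp continuous_fst_out.measurable))
  convert! hm using 2 with y
  refine (setIntegral_eq_integral_of_forall_compl_eq_zero fun x hx => ?_).symm
  by_contra hx'
  exact hx (hAu x (right_ne_zero_of_mul hx'))

theorem IsTame.measurable_integral_right {v : Y → ℂ} (hv : IsTame n v) (hq : Measurable q) :
    Measurable fun x : X => ∫ y, q (.mk (x, y)) * v y ∂n := by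
  obtain ⟨B, hB, hBv⟩ := hv.support
  have hm := measurable_integral_slice' (measurable_slice_restrict' (X := X) n hB)
    (hq.mul (hv.measurable.comp continuous_snd_out.measurable))
  convert! hm using 2 with x
  refine (setIntegral_eq_integral_of_forall_compl_eq_zero fun y hy => ?_).symm
  by_contra hy'
  exact hy (hBv y (right_ne_zero_of_mul hy'))

theorem norm_integral_mul_le {X : Type*} [MeasurableSpace X] {m : Measure X} {k u : X → ℂ}
    (hu : Integrable u m) {C : ℝ} (hk : ∀ x, ‖k x‖ ≤ C) :
    ‖∫ x, k x * u x ∂m‖ ≤ C * ∫ x, ‖u x‖ ∂m := by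
  rw [← integral_const_mul]
  refine norm_integral_le_of_norm_le (hu.norm.const_mul C) (.of_forall fun x => ?_)
  rw [norm_mul]
  exact mul_le_mul_of_nonneg_right (hk x) (norm_nonneg _)

theorem mulIntegral_toLp {X : Type*} [MeasurableSpace X] {m : Measure X} {k u : X → ℂ}
    (hk : Measurable k) {C : ℝ} (hC : ∀ x, ‖k x‖ ≤ C) (hu : MemLp u 1 m) :
    mulIntegral m k hk C hC hu.toLp = ∫ x, k x * u x ∂m := by
  rw [mulIntegral_apply]
  refine integral_congr_ae ?_
  filter_upwards [hu.coeFn_toLp] with x e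
  rw [e]

/-- A bounded bilinear form which is given by a Borel function on compactly supported functions is
given by it everywhere. -/
theorem form_eq_integral (β : Lp ℂ 1 m →L[ℂ] Lp ℂ 1 n →L[ℂ] ℂ)
    (hq : Measurable q) {C : ℝ} (hqb : ∀ z, ‖q z‖ ≤ C)
    (h : ∀ (u : compactlySupported X) (v : compactlySupported Y),
      β (compactlySupportedToLp m u) (compactlySupportedToLp n v) =
        ∫ z, q z * (u.1 z.out.1 * v.1 z.out.2) ∂prodHaar m n)
    {u : X → ℂ} {v : Y → ℂ} (hu : IsTame m u) (hv : IsTame n v) (hu' : MemLp u 1 m)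
    (hv' : MemLp v 1 n) :
    β hu'.toLp hv'.toLp = ∫ z, q z * (u z.out.1 * v z.out.2) ∂prodHaar m n := by
  have hr : ∀ {u : X → ℂ} {v : Y → ℂ}, IsTame m u → IsTame n v →
      ∫ z, q z * (u z.out.1 * v z.out.2) ∂prodHaar m n =
        ∫ x, (∫ y, q (.mk (x, y)) * v y ∂n) * u x ∂m := by
    intro u v hu hv
    rw [(IsTame.mul_prod hq hqb hu hv).integral_right]
    refine integral_congr_ae (.of_forall fun x => ?_)
    simp only
    rw [← integral_mul_const]
    refine integral_congr_ae (.of_forall fun y => ?_)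
    change q (.mk (x, y)) * (u x * v y) = _
    ring
  have hl : ∀ {u : X → ℂ} {v : Y → ℂ}, IsTame m u → IsTame n v →
      ∫ z, q z * (u z.out.1 * v z.out.2) ∂prodHaar m n =
        ∫ y, (∫ x, q (.mk (x, y)) * u x ∂m) * v y ∂n := by
    intro u v hu hv
    rw [(IsTame.mul_prod hq hqb hu hv).integral_left]
    refine integral_congr_ae (.of_forall fun y => ?_)
    simp only
    rw [← integral_mul_const]
    refine integral_congr_ae (.of_forall fun x => ?_)
    change q (.mk (x, y)) * (u x * v y) = _
    ring
  -- Density is used in one variable at a time: for fixed `v` the iterated integral is integration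
  -- of `u` against a bounded Borel function, hence continuous in `u`.
  have h1 : ∀ v : compactlySupported Y, β hu'.toLp (compactlySupportedToLp n v) =
      ∫ z, q z * (u z.out.1 * v.1 z.out.2) ∂prodHaar m n := by
    intro v
    have hv := isTame_of_hasCompactSupport (m := n) v.2.1 v.2.2
    rw [hr hu hv, ← mulIntegral_toLp (hv.measurable_integral_right hq)
      (fun x => norm_integral_mul_le hv.integrable fun y => hqb _) hu']
    refine congrFun (denseRange_compactlySupportedToLp.equalizer
      (g := fun U => β U (compactlySupportedToLp n v)) (by fun_prop) (by fun_prop) ?_) _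
    ext1 u
    rw [Function.comp_apply, h u v, hr (isTame_of_hasCompactSupport u.2.1 u.2.2) hv]
    exact (mulIntegral_toLp _ _ (memLp_of_mem_compactlySupported u.2)).symm
  rw [hl hu hv, ← mulIntegral_toLp (hu.measurable_integral_left hq)
      (fun x => norm_integral_mul_le hu.integrable fun y => hqb _) hv']
  refine congrFun (denseRange_compactlySupportedToLp.equalizer
    (g := fun V => β hu'.toLp V) (by fun_prop) (by fun_prop) ?_) _
  ext1 v
  rw [Function.comp_apply, h1 v, hl hu (isTame_of_hasCompactSupport v.2.1 v.2.2)]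
  exact (mulIntegral_toLp _ _ (memLp_of_mem_compactlySupported v.2)).symm

end Forms

/-! ### Operators from $L^1(G,\omega)$ to $L^\infty(G,1/\omega)$ and their kernels. -/

section Kernels

theorem pair_add_right {G : Type*} [Group G] [TopologicalSpace G] [MeasurableSpace G]
    {μ : Measure G} {ω : Weight G} (h : LInf μ ω) (f g : L1 μ ω) :
    pair h (f + g) = pair h f + pair h g := by
  unfold pair
  rw [← integral_add (integrable_pair h f) (integrable_pair h g)]
  refine integral_congr_ae ?_
  filter_upwards [WeightedLp.coeFn_add f g] with x e
  rw [e, add_mul]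

theorem pair_smul_right {G : Type*} [Group G] [TopologicalSpace G] [MeasurableSpace G]
    {μ : Measure G} {ω : Weight G} (c : ℂ) (h : LInf μ ω) (f : L1 μ ω) :
    pair h (c • f) = c * pair h f := by
  unfold pair
  rw [← integral_const_mul]
  refine integral_congr_ae ?_
  filter_upwards [WeightedLp.coeFn_smul c f] with x e
  rw [e, mul_assoc]

variable {G : Type*} [Group G] [TopologicalSpace G] [MeasurableSpace G]

/-- A Borel function `p` on `G × G` with `|p(x, y)| ≤ C ω(x) ω(y)`. -/
structure IsKernel (ω : Weight G) (p : WithBorel (G × G) → ℂ) (C : ℝ) : Prop where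
  measurable : Measurable p
  bound : ∀ x y, ‖p (.mk (x, y))‖ ≤ C * (ω x * ω y)

variable [IsTopologicalGroup G] [LocallyCompactSpace G] [T2Space G] [BorelSpace G]
  {μ : Measure G} [μ.IsHaarMeasure] [μ.InnerRegular] {ω : Weight G}

theorem IsKernel.nonneg {p : WithBorel (G × G) → ℂ} {C : ℝ} (hp : IsKernel ω p C) : 0 ≤ C := by
  have := (norm_nonneg _).trans (hp.bound 1 1)
  rwa [ω.map_one, mul_one, mul_one] at this

theorem measurable_tensor (ω : Weight G) :
    Measurable fun z : WithBorel (G × G) => (ω z.out.1 : ℂ) * (ω z.out.2 : ℂ) :=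
  (ω.measurable_ofReal.comp continuous_fst_out.measurable).mul
    (ω.measurable_ofReal.comp continuous_snd_out.measurable)

theorem IsKernel.tame {p : WithBorel (G × G) → ℂ} {C : ℝ} (hp : IsKernel ω p C) {a b : G → ℂ}
    (ha : IsNice μ ω a) (hb : IsNice μ ω b) :
    IsTame (prodHaar μ μ) fun z => p z * (a z.out.1 * b z.out.2) := by
  have h1 := IsTame.mul_prod (k := fun z => p z / ((ω z.out.1 : ℂ) * (ω z.out.2 : ℂ)))
    (hp.measurable.div (measurable_tensor ω)) (C := C) (fun z => by
      rw [norm_div, norm_mul, ω.norm_ofReal, ω.norm_ofReal,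
        div_le_iff₀ (mul_pos (ω.pos _) (ω.pos _))]
      exact hp.bound _ _) ha.weighted hb.weighted
  convert! h1 using 2 with z
  field_simp [ω.ofReal_ne_zero]

theorem measurable_kernel_integral {p : WithBorel (G × G) → ℂ} (hp : Measurable p) (f : L1 μ ω) :
    Measurable fun y => ∫ x, p (.mk (x, y)) * f x ∂μ := by
  obtain ⟨a, ha, hfa⟩ := L1.exists_nice f
  obtain ⟨A, hA, hAa⟩ := ha.tame.support
  have hm := measurable_integral_slice (measurable_slice_restrict (Y := G) μ hA)
    (hp.mul (ha.measurable.comp continuous_fst_out.measurable))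
  convert! hm using 2 with y
  have e2 : ∫ x in A, p (.mk (x, y)) * a x ∂μ = ∫ x, p (.mk (x, y)) * a x ∂μ :=
    setIntegral_eq_integral_of_forall_compl_eq_zero fun x hx => by
      by_contra hx'
      exact hx (hAa x (right_ne_zero_of_mul hx'))
  refine Eq.trans ?_ e2.symm
  refine integral_congr_ae ?_
  filter_upwards [hfa] with x e
  rw [e]

theorem IsKernel.integrable_slice {p : WithBorel (G × G) → ℂ} {C : ℝ} (hp : IsKernel ω p C)
    (f : L1 μ ω) (y : G) : Integrable (fun x => p (.mk (x, y)) * f x) μ := by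
  obtain ⟨a, ha, hfa⟩ := L1.exists_nice f
  refine (ha.mul (hp.measurable.comp (continuous_slice_left y).measurable) (C := C * ω y)
    (fun x => ?_)).integrable.congr ?_
  · exact (hp.bound x y).trans (le_of_eq (by ring))
  · filter_upwards [hfa] with x e
    rw [e]
    rfl

theorem IsKernel.norm_integral_le {p : WithBorel (G × G) → ℂ} {C : ℝ} (hp : IsKernel ω p C)
    (f : L1 μ ω) (y : G) : ‖∫ x, p (.mk (x, y)) * f x ∂μ‖ ≤ C * ‖f‖ * ω y := by
  have h1 : C * ‖f‖ * ω y = ∫ x, C * ω y * ‖(ω x : ℂ) * f x‖ ∂μ := by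
    rw [WeightedLp.norm_eq_integral, integral_const_mul]
    simp_rw [norm_mul, ω.norm_ofReal]
    change C * (∫ x, ω x * ‖f x‖ ∂μ) * ω y = _
    ring
  rw [h1]
  refine norm_integral_le_of_norm_le ((WeightedLp.integrable f).norm.const_mul _)
    (.of_forall fun x => ?_)
  rw [norm_mul, norm_mul, ω.norm_ofReal]
  calc ‖p (.mk (x, y))‖ * ‖f x‖ ≤ C * (ω x * ω y) * ‖f x‖ := by
        gcongr
        exact hp.bound x y
    _ = _ := by ring

/-- The class of `∫ p(x, ·) f(x) dx`. -/
def IsKernel.opFun {p : WithBorel (G × G) → ℂ} {C : ℝ} (hp : IsKernel ω p C) (f : L1 μ ω) :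
    LInf μ ω :=
  WeightedLp.ofBounded (fun y => ∫ x, p (.mk (x, y)) * f x ∂μ)
    (measurable_kernel_integral hp.measurable f) (C * ‖f‖) (fun y => by
      change (ω y)⁻¹ * _ ≤ _
      rw [inv_mul_le_iff₀ (ω.pos y), mul_comm]
      exact hp.norm_integral_le f y)

theorem IsKernel.opFun_coeFn {p : WithBorel (G × G) → ℂ} {C : ℝ} (hp : IsKernel ω p C)
    (f : L1 μ ω) : hp.opFun f =ᵐ[μ] fun y => ∫ x, p (.mk (x, y)) * f x ∂μ :=
  WeightedLp.coeFn_ofBounded _ _ _ _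

theorem IsKernel.norm_opFun_le {p : WithBorel (G × G) → ℂ} {C : ℝ} (hp : IsKernel ω p C)
    (f : L1 μ ω) : ‖hp.opFun f‖ ≤ C * ‖f‖ :=
  WeightedLp.norm_ofBounded_le _ _ _ (mul_nonneg hp.nonneg (norm_nonneg f)) _

/-- The operator `f ↦ ∫ p(x, ·) f(x) dx`. -/
def IsKernel.op (μ : Measure G) [μ.IsHaarMeasure] [μ.InnerRegular] {p : WithBorel (G × G) → ℂ}
    {C : ℝ} (hp : IsKernel ω p C) : L1 μ ω →L[ℂ] LInf μ ω :=
  LinearMap.mkContinuous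
    { toFun := fun f => hp.opFun f
      map_add' := fun f g => WeightedLp.ext <| by
        filter_upwards [hp.opFun_coeFn (f + g), hp.opFun_coeFn f, hp.opFun_coeFn g,
          WeightedLp.coeFn_add (hp.opFun f) (hp.opFun g)] with y e1 e2 e3 e4
        rw [e1, e4, e2, e3, ← integral_add (hp.integrable_slice f y) (hp.integrable_slice g y)]
        refine integral_congr_ae ?_
        filter_upwards [WeightedLp.coeFn_add f g] with x e
        rw [e, mul_add]
      map_smul' := fun c f => WeightedLp.ext <| by
        filter_upwards [hp.opFun_coeFn (c • f), hp.opFun_coeFn f,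
          WeightedLp.coeFn_smul c (hp.opFun f)] with y e1 e2 e4
        rw [e1, RingHom.id_apply, e4, e2, ← integral_const_mul]
        refine integral_congr_ae ?_
        filter_upwards [WeightedLp.coeFn_smul c f] with x e
        rw [e]
        ring } C
    (fun f => hp.norm_opFun_le f)

theorem IsKernel.op_coeFn {p : WithBorel (G × G) → ℂ} {C : ℝ} (hp : IsKernel ω p C) (f : L1 μ ω) :
    hp.op μ f =ᵐ[μ] fun y => ∫ x, p (.mk (x, y)) * f x ∂μ :=
  hp.opFun_coeFn f

theorem IsKernel.norm_op_le {p : WithBorel (G × G) → ℂ} {C : ℝ} (hp : IsKernel ω p C) :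
    ‖hp.op μ‖ ≤ C :=
  LinearMap.mkContinuous_norm_le _ hp.nonneg fun f => hp.norm_opFun_le f

theorem IsKernel.pair_op {p : WithBorel (G × G) → ℂ} {C : ℝ} (hp : IsKernel ω p C)
    (f g : L1 μ ω) : pair (hp.op μ f) g = ∫ y, ∫ x, p (.mk (x, y)) * f x * g y ∂μ ∂μ := by
  rw [pair_eq (hp.op_coeFn f) (ae_eq_refl _)]
  refine integral_congr_ae (.of_forall fun y => ?_)
  simp only
  rw [integral_mul_const]

theorem integral_kernel_congr {p : WithBorel (G × G) → ℂ} {f g : L1 μ ω} {a b : G → ℂ}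
    (hfa : f =ᵐ[μ] a) (hgb : g =ᵐ[μ] b) :
    ∫ y, ∫ x, p (.mk (x, y)) * f x * g y ∂μ ∂μ = ∫ y, ∫ x, p (.mk (x, y)) * (a x * b y) ∂μ ∂μ := by
  refine integral_congr_ae ?_
  filter_upwards [hgb] with y ey
  refine integral_congr_ae ?_
  filter_upwards [hfa] with x ex
  rw [ex, ey, mul_assoc]

theorem IsKernel.pair_op_nice {p : WithBorel (G × G) → ℂ} {C : ℝ} (hp : IsKernel ω p C)
    {f g : L1 μ ω} {a b : G → ℂ} (ha : IsNice μ ω a) (hb : IsNice μ ω b)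
    (hfa : f =ᵐ[μ] a) (hgb : g =ᵐ[μ] b) :
    pair (hp.op μ f) g = ∫ z, p z * (a z.out.1 * b z.out.2) ∂prodHaar μ μ := by
  rw [hp.pair_op, integral_kernel_congr hfa hgb, (hp.tame ha hb).integral_left]
  rfl

/-- The integral of a kernel depends on its class only. -/
theorem ae_integral_congr {p q : WithBorel (G × G) → ℂ} (hp : Measurable p) (hq : Measurable q)
    (hpq : p =ᵐ[prodHaar μ μ] q) (f : L1 μ ω) :
    ∀ᵐ y ∂μ, ∫ x, p (.mk (x, y)) * f x ∂μ = ∫ x, q (.mk (x, y)) * f x ∂μ := by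
  obtain ⟨a, ha, hfa⟩ := L1.exists_nice f
  obtain ⟨A, hA, hAa⟩ := ha.tame.support
  filter_upwards [ae_ae_of_prodHaar' (measurableSet_eq_fun hp hq) hpq hA] with y hy
  refine integral_congr_ae ?_
  filter_upwards [hfa, (ae_restrict_iff' hA.measurableSet').1 hy] with x e1 e2
  rw [e1]
  by_cases hx : a x = 0
  · rw [hx, mul_zero, mul_zero]
  · rw [e2 (hAa x hx)]

theorem form_congr {p q : WithBorel (G × G) → ℂ} (hp : Measurable p) (hq : Measurable q)
    (hpq : p =ᵐ[prodHaar μ μ] q) (f g : L1 μ ω) :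
    ∫ y, ∫ x, p (.mk (x, y)) * f x * g y ∂μ ∂μ = ∫ y, ∫ x, q (.mk (x, y)) * f x * g y ∂μ ∂μ := by
  refine integral_congr_ae ?_
  filter_upwards [ae_integral_congr hp hq hpq f] with y hy
  rw [integral_mul_const, integral_mul_const, hy]

/-- A kernel is determined by its integrals. -/
theorem IsKernel.ae_eq_zero {p : WithBorel (G × G) → ℂ} {C : ℝ} (hp : IsKernel ω p C)
    (h0 : ∀ a b, IsNice μ ω a → IsNice μ ω b →
      ∫ z, p z * (a z.out.1 * b z.out.2) ∂prodHaar μ μ = 0) : p =ᵐ[prodHaar μ μ] 0 := by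
  refine (isRadonProduct_prodHaar μ μ).ae_eq_zero hp.measurable (fun K L hK hL => ?_)
    (fun A B K L hA hB hK hL hAK hBL => ?_)
  · have h1 := hp.tame (isNice_indicator (μ := μ) (ω := ω) hK.measurableSet hK subset_rfl
      (v := fun _ => 1) continuous_const) (isNice_indicator (μ := μ) (ω := ω) hL.measurableSet hL
      subset_rfl (v := fun _ => 1) continuous_const)
    rw [← integrable_indicator_iff (measurableSet_rect hK.measurableSet hL.measurableSet)]
    convert! h1.integrable using 2 with z
    by_cases hz : z ∈ rect K L
    · rw [indicator_of_mem hz, indicator_of_mem hz.1, indicator_of_mem hz.2, mul_one, mul_one]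
    · rw [indicator_of_notMem hz]
      by_cases hz1 : z.out.1 ∈ K
      · rw [indicator_of_notMem (fun hz2 => hz ⟨hz1, hz2⟩), mul_zero, mul_zero]
      · rw [indicator_of_notMem hz1, zero_mul, mul_zero]
  · rw [← integral_indicator (measurableSet_rect hA hB), ← h0 _ _
      (isNice_indicator (μ := μ) (ω := ω) hA hK hAK (v := fun _ => 1) continuous_const)
      (isNice_indicator (μ := μ) (ω := ω) hB hL hBL (v := fun _ => 1) continuous_const)]
    congr 1
    ext z
    by_cases hz : z ∈ rect A B
    · rw [indicator_of_mem hz, indicator_of_mem hz.1, indicator_of_mem hz.2, mul_one, mul_one]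
    · rw [indicator_of_notMem hz]
      by_cases hz1 : z.out.1 ∈ A
      · rw [indicator_of_notMem (fun hz2 => hz ⟨hz1, hz2⟩), mul_zero, mul_zero]
      · rw [indicator_of_notMem hz1, zero_mul, mul_zero]

/-- The space `L^1(G, ω)` is isometric to `L^1(G)`. -/
def weightedEquiv (μ : Measure G) (ω : Weight G) : L1 μ ω ≃ₗᵢ[ℂ] Lp ℂ 1 μ :=
  { LinearEquiv.ofBijective (WeightedLp.toLp 1 ω.fn μ)
      ⟨WeightedLp.toLp_injective, WeightedLp.toLp_surjective 1⟩ with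
    norm_map' := fun _ => rfl }

theorem weightedEquiv_eq {f : L1 μ ω} {a : G → ℂ} (hfa : f =ᵐ[μ] a)
    (ha : MemLp (fun x => (ω x : ℂ) * a x) 1 μ) : weightedEquiv μ ω f = ha.toLp := by
  refine Lp.ext ?_
  filter_upwards [WeightedLp.coeFn_toLp f, ha.coeFn_toLp, hfa] with x e1 e2 e3
  rw [e2, ← e3]
  exact e1

/-- Every bounded operator from `L^1(G, ω)` to `L^∞(G, 1/ω)` is given by a kernel. -/
theorem exists_kernel (T : L1 μ ω →L[ℂ] LInf μ ω) :
    ∃ p : WithBorel (G × G) → ℂ, ∃ hp : IsKernel ω p ‖T‖, hp.op μ = T := by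
  set e := weightedEquiv μ ω
  let β : Lp ℂ 1 μ →L[ℂ] Lp ℂ 1 μ →L[ℂ] ℂ := LinearMap.mkContinuous₂
    (LinearMap.mk₂ ℂ (fun u v => pair (T (e.symm u)) (e.symm v))
      (fun u u' v => by rw [map_add, map_add, pair_add])
      (fun c u v => by rw [map_smul, map_smul, pair_smul, smul_eq_mul])
      (fun u v v' => by rw [map_add, pair_add_right])
      (fun c u v => by rw [map_smul, pair_smul_right, smul_eq_mul])) ‖T‖
    (fun u v => by
      refine (norm_pair_le _ _).trans ?_
      rw [LinearIsometryEquiv.norm_map]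
      refine mul_le_mul_of_nonneg_right ((T.le_opNorm _).trans ?_) (norm_nonneg _)
      rw [LinearIsometryEquiv.norm_map])
  have hβ : ‖β‖ ≤ ‖T‖ := LinearMap.mkContinuous₂_norm_le _ (norm_nonneg T) _
  obtain ⟨q, hq, hqb, hqf⟩ := exists_form_representation β
  -- The form lives on unweighted $L^1$; multiplication of `q` by $\omega\otimes\omega$ restores the
  -- weights.
  have hp : IsKernel ω (fun z => q z * ((ω z.out.1 : ℂ) * (ω z.out.2 : ℂ))) ‖T‖ := by
    refine ⟨hq.mul (measurable_tensor ω), fun x y => ?_⟩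
    rw [norm_mul, norm_mul, ω.norm_ofReal, ω.norm_ofReal]
    exact mul_le_mul_of_nonneg_right ((hqb _).trans hβ) (mul_pos (ω.pos _) (ω.pos _)).le
  refine ⟨_, hp, ?_⟩
  ext1 f
  refine LInf.ext_pair fun g => ?_
  obtain ⟨a, ha, hfa⟩ := L1.exists_nice f
  obtain ⟨b, hb, hgb⟩ := L1.exists_nice g
  have ha' := memLp_one_iff_integrable.2 ha.weighted.integrable
  have hb' := memLp_one_iff_integrable.2 hb.weighted.integrable
  rw [hp.pair_op_nice ha hb hfa hgb]
  have h1 : β (e f) (e g) = pair (T f) g := by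
    change pair (T (e.symm (e f))) (e.symm (e g)) = _
    rw [LinearIsometryEquiv.symm_apply_apply, LinearIsometryEquiv.symm_apply_apply]
  rw [← h1, weightedEquiv_eq hfa ha', weightedEquiv_eq hgb hb',
    form_eq_integral β hq hqb hqf ha.weighted hb.weighted ha' hb']
  refine integral_congr_ae (.of_forall fun z => ?_)
  simp only
  ring

end Kernels

/-! ### Derivations and quasi-additive kernels -/

section Triple

variable {G : Type*} [Group G] [TopologicalSpace G] [MeasurableSpace G]

/-- A Borel function on `G × (G × G)` which is bounded by a multiple of `ω ⊗ (ω ⊗ ω)`. -/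
structure IsTripleKernel (ω : Weight G) (K : WithBorel (G × WithBorel (G × G)) → ℂ) (C : ℝ) :
    Prop where
  measurable : Measurable K
  bound : ∀ x y z, ‖K (.mk (x, .mk (y, z)))‖ ≤ C * (ω x * (ω y * ω z))

variable [IsTopologicalGroup G] [LocallyCompactSpace G] [T2Space G] [BorelSpace G]
  {μ : Measure G} [μ.IsHaarMeasure] [μ.InnerRegular] {ω : Weight G}

theorem isTame_tensor {b c : G → ℂ} (hb : IsNice μ ω b) (hc : IsNice μ ω c) :
    IsTame (prodHaar μ μ) fun q : WithBorel (G × G) =>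
      ((ω q.out.1 : ℂ) * (ω q.out.2 : ℂ)) * (b q.out.1 * c q.out.2) :=
  IsKernel.tame (C := 1) ⟨measurable_tensor ω, fun x y => by
    change ‖(ω x : ℂ) * (ω y : ℂ)‖ ≤ _
    rw [norm_mul, ω.norm_ofReal, ω.norm_ofReal, one_mul]⟩ hb hc

namespace IsTripleKernel

variable {K : WithBorel (G × WithBorel (G × G)) → ℂ} {C : ℝ} (hK : IsTripleKernel ω K C)
  {a b c : G → ℂ}

include hK

theorem tame (ha : IsNice μ ω a) {v : WithBorel (G × G) → ℂ}
    (hv : IsTame (prodHaar μ μ) fun q : WithBorel (G × G) =>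
      ((ω q.out.1 : ℂ) * (ω q.out.2 : ℂ)) * v q) :
    IsTame (prodHaar μ (prodHaar μ μ)) fun t => K t * (a t.out.1 * v t.out.2) := by
  have h1 := IsTame.mul_prod (k := fun t : WithBorel (G × WithBorel (G × G)) =>
    K t / ((ω t.out.1 : ℂ) * ((ω t.out.2.out.1 : ℂ) * (ω t.out.2.out.2 : ℂ))))
    (hK.measurable.div ((ω.measurable_ofReal.comp continuous_fst_out.measurable).mul
      ((measurable_tensor ω).comp continuous_snd_out.measurable))) (C := C) (fun t => by
      rw [norm_div, norm_mul, norm_mul, ω.norm_ofReal, ω.norm_ofReal, ω.norm_ofReal,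
        div_le_iff₀ (mul_pos (ω.pos _) (mul_pos (ω.pos _) (ω.pos _)))]
      exact hK.bound _ _ _) ha.weighted hv
  convert! h1 using 2 with t
  have h2 := ω.ofReal_ne_zero t.out.1
  have h3 := ω.ofReal_ne_zero t.out.2.out.1
  have h4 := ω.ofReal_ne_zero t.out.2.out.2
  field_simp

theorem slice_left (x : G) : IsKernel ω (fun q => K (.mk (x, q))) (C * ω x) :=
  ⟨hK.measurable.comp (continuous_slice_right x).measurable, fun y z =>
    (hK.bound x y z).trans (le_of_eq (by ring))⟩

theorem slice_right (z : G) :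
    IsKernel ω (fun q => K (.mk (q.out.1, .mk (q.out.2, z)))) (C * ω z) := by
  refine ⟨hK.measurable.comp (Continuous.measurable ?_), fun x y =>
    (hK.bound x y z).trans (le_of_eq (by ring))⟩
  exact WithBorel.continuous_mk.comp (continuous_fst_out.prodMk
    ((continuous_slice_left z).comp continuous_snd_out))

/-- The orders of integration in this and the next two lemmas are those in which $\langle
D(a),b*c\rangle$, $\langle D(b),c*a\rangle$ and $\langle D(a*b),c\rangle$ arise, respectively. -/
theorem integral_eq_xyz (ha : IsNice μ ω a) (hb : IsNice μ ω b) (hc : IsNice μ ω c) :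
    ∫ t, K t * (a t.out.1 * (b t.out.2.out.1 * c t.out.2.out.2)) ∂prodHaar μ (prodHaar μ μ) =
      ∫ x, (∫ y, ∫ z, K (.mk (x, .mk (y, z))) * (b y * c z) ∂μ ∂μ) * a x ∂μ := by
  rw [(hK.tame ha (isTame_tensor hb hc)).integral_right]
  refine integral_congr_ae (.of_forall fun x => ?_)
  simp only
  have h1 := ((hK.slice_left x).tame hb hc).integral_right
  refine Eq.trans ?_ (congrArg (· * a x) h1)
  rw [← integral_mul_const]
  refine integral_congr_ae (.of_forall fun q => ?_)
  change K (.mk (x, q)) * (a x * (b q.out.1 * c q.out.2)) = _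
  ring

theorem integral_eq_yzx (ha : IsNice μ ω a) (hb : IsNice μ ω b) (hc : IsNice μ ω c) :
    ∫ t, K t * (a t.out.1 * (b t.out.2.out.1 * c t.out.2.out.2)) ∂prodHaar μ (prodHaar μ μ) =
      ∫ y, (∫ z, ∫ x, K (.mk (x, .mk (y, z))) * (c z * a x) ∂μ ∂μ) * b y ∂μ := by
  have h1 := hK.tame ha (isTame_tensor hb hc)
  rw [h1.integral_left, h1.slice_left.integral_right]
  refine integral_congr_ae (.of_forall fun y => ?_)
  simp only
  rw [← integral_mul_const]
  refine integral_congr_ae (.of_forall fun z => ?_)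
  simp only
  rw [← integral_mul_const]
  refine integral_congr_ae (.of_forall fun x => ?_)
  change K (.mk (x, .mk (y, z))) * (a x * (b y * c z)) = _
  ring

theorem integral_eq_zxy (ha : IsNice μ ω a) (hb : IsNice μ ω b) (hc : IsNice μ ω c) :
    ∫ t, K t * (a t.out.1 * (b t.out.2.out.1 * c t.out.2.out.2)) ∂prodHaar μ (prodHaar μ μ) =
      ∫ z, (∫ x, ∫ y, K (.mk (x, .mk (y, z))) * (a x * b y) ∂μ ∂μ) * c z ∂μ := by
  have h1 := hK.tame ha (isTame_tensor hb hc)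
  rw [h1.integral_left, h1.slice_left.integral_left]
  refine integral_congr_ae (.of_forall fun z => ?_)
  have h2 := ((hK.slice_right z).tame ha hb).integral_swap
  refine Eq.trans ?_ (congrArg (· * c z) h2.symm)
  simp only
  rw [← integral_mul_const]
  refine integral_congr_ae (.of_forall fun y => ?_)
  simp only
  rw [← integral_mul_const]
  refine integral_congr_ae (.of_forall fun x => ?_)
  change K (.mk (x, .mk (y, z))) * (a x * (b y * c z)) =
    K (.mk (x, .mk (y, z))) * (a x * b y) * c z
  ring

/-- The claim reduces to two variables: once $x$ is integrated over a set `A`, a kernel `E` in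
$(y,z)$ remains, and it vanishes by `IsKernel.ae_eq_zero`. Hence the integrals of `K` over all the
rectangles `A × S` vanish, with `S` an arbitrary relatively compact Borel set of pairs. -/
theorem ae_eq_zero (h0 : ∀ a b c, IsNice μ ω a → IsNice μ ω b → IsNice μ ω c →
      ∫ t, K t * (a t.out.1 * (b t.out.2.out.1 * c t.out.2.out.2)) ∂prodHaar μ (prodHaar μ μ) = 0) :
    K =ᵐ[prodHaar μ (prodHaar μ μ)] 0 := by
  have hv : Continuous fun q : WithBorel (G × G) => (ω q.out.1 : ℂ) * (ω q.out.2 : ℂ) :=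
    (Complex.continuous_ofReal.comp (ω.continuous.comp continuous_fst_out)).mul
      (Complex.continuous_ofReal.comp (ω.continuous.comp continuous_snd_out))
  have htame : ∀ (A L : Set G) (S M : Set (WithBorel (G × G))), MeasurableSet A → MeasurableSet S →
      IsCompact L → IsCompact M → A ⊆ L → S ⊆ M → IsTame (prodHaar μ (prodHaar μ μ))
        fun t => K t * (A.indicator (fun _ => 1) t.out.1 * S.indicator (fun _ => 1) t.out.2) := by
    intro A L S M hA hS hL hM hAL hSM
    refine hK.tame (isNice_indicator hA hL hAL continuous_const) ?_
    convert! isTame_indicator (m := prodHaar μ μ) hS hM hSM hv using 2 with q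
    by_cases hq : q ∈ S
    · rw [indicator_of_mem hq, indicator_of_mem hq, mul_one]
    · rw [indicator_of_notMem hq, indicator_of_notMem hq, mul_zero]
  have hind : ∀ (A : Set G) (S : Set (WithBorel (G × G))), (rect A S).indicator K =
      fun t => K t * (A.indicator (fun _ => 1) t.out.1 * S.indicator (fun _ => 1) t.out.2) := by
    intro A S
    ext t
    by_cases ht : t ∈ rect A S
    · rw [indicator_of_mem ht, indicator_of_mem ht.1, indicator_of_mem ht.2, mul_one, mul_one]
    · rw [indicator_of_notMem ht]
      by_cases ht1 : t.out.1 ∈ A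
      · rw [indicator_of_notMem (fun ht2 => ht ⟨ht1, ht2⟩), mul_zero, mul_zero]
      · rw [indicator_of_notMem ht1, zero_mul, mul_zero]
  refine (isRadonProduct_prodHaar μ (prodHaar μ μ)).ae_eq_zero hK.measurable (fun L M hL hM => ?_)
    (fun A S L M hA hS hL hM hAL hSM => ?_)
  · rw [← integrable_indicator_iff (measurableSet_rect hL.measurableSet hM.measurableSet), hind]
    exact (htame L L M M hL.measurableSet hM.measurableSet hL hM subset_rfl subset_rfl).integrable
  · have hu : IsNice μ ω (A.indicator fun _ => 1) := isNice_indicator hA hL hAL continuous_const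
    set E : WithBorel (G × G) → ℂ := fun q => ∫ x, K (.mk (x, q)) * A.indicator (fun _ => 1) x ∂μ
      with hE
    have hEk : IsKernel ω E (C * ∫ x, ‖(ω x : ℂ) * A.indicator (fun _ => 1) x‖ ∂μ) := by
      refine ⟨hu.tame.measurable_integral_left hK.measurable, fun y z => ?_⟩
      rw [mul_right_comm, ← integral_const_mul]
      refine norm_integral_le_of_norm_le (hu.weighted.integrable.norm.const_mul _)
        (.of_forall fun x => ?_)
      rw [norm_mul, norm_mul, ω.norm_ofReal]
      refine (mul_le_mul_of_nonneg_right (hK.bound x y z) (norm_nonneg _)).trans (le_of_eq ?_)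
      ring
    have hE0 : E =ᵐ[prodHaar μ μ] 0 := by
      refine hEk.ae_eq_zero fun b c hb hc => ?_
      rw [← h0 _ b c hu hb hc, (hK.tame hu (isTame_tensor hb hc)).integral_left]
      refine integral_congr_ae (.of_forall fun q => ?_)
      simp only [hE]
      rw [← integral_mul_const]
      refine integral_congr_ae (.of_forall fun x => ?_)
      change _ = K (.mk (x, q)) * (A.indicator (fun _ => 1) x * (b q.out.1 * c q.out.2))
      ring
    rw [← integral_indicator (measurableSet_rect hA hS), hind,
      (htame A L S M hA hS hL hM hAL hSM).integral_left]
    refine integral_eq_zero_of_ae ?_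
    filter_upwards [hE0] with q hq
    have e : ∫ x, K (.mk (x, q)) * (A.indicator (fun _ => 1) x * S.indicator (fun _ => 1) q) ∂μ =
        E q * S.indicator (fun _ => 1) q := by
      rw [hE, ← integral_mul_const]
      refine integral_congr_ae (.of_forall fun x => ?_)
      simp only
      ring
    refine e.trans ?_
    rw [hq]
    simp

end IsTripleKernel

end Triple

/-! ### The derivation identity as quasi-additivity of the kernel. -/

section QuasiAdditive

variable {G : Type*} [Group G] [TopologicalSpace G] [MeasurableSpace G]
  [IsTopologicalGroup G] [LocallyCompactSpace G] [T2Space G] [BorelSpace G]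
  {μ : Measure G} [μ.IsHaarMeasure] [μ.InnerRegular] {ω : Weight G}
  {p : WithBorel (G × G) → ℂ} {C : ℝ}

theorem continuous_triple_fst : Continuous fun t : WithBorel (G × WithBorel (G × G)) => t.out.1 :=
  continuous_fst_out

theorem continuous_triple_snd :
    Continuous fun t : WithBorel (G × WithBorel (G × G)) => t.out.2.out.1 :=
  continuous_fst_out.comp continuous_snd_out

theorem continuous_triple_thd :
    Continuous fun t : WithBorel (G × WithBorel (G × G)) => t.out.2.out.2 :=
  continuous_snd_out.comp continuous_snd_out

namespace IsKernel

variable (hp : IsKernel ω p C)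

include hp

theorem bound_mul_left (x y z : G) : ‖p (.mk (x * y, z))‖ ≤ C * (ω x * (ω y * ω z)) := by
  refine (hp.bound _ _).trans ?_
  rw [← mul_assoc (ω x)]
  exact mul_le_mul_of_nonneg_left (mul_le_mul_of_nonneg_right (ω.map_mul_le x y) (ω.pos z).le)
    hp.nonneg

theorem bound_mul_right (x y z : G) : ‖p (.mk (x, y * z))‖ ≤ C * (ω x * (ω y * ω z)) :=
  (hp.bound _ _).trans (mul_le_mul_of_nonneg_left (mul_le_mul_of_nonneg_left (ω.map_mul_le y z)
    (ω.pos x).le) hp.nonneg)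

theorem triple_left : IsTripleKernel ω
    (fun t => p (.mk (t.out.1 * t.out.2.out.1, t.out.2.out.2))) C :=
  ⟨hp.measurable.comp (WithBorel.continuous_mk.comp
    ((continuous_triple_fst.mul continuous_triple_snd).prodMk continuous_triple_thd)).measurable,
    hp.bound_mul_left⟩

theorem triple_right : IsTripleKernel ω
    (fun t => p (.mk (t.out.1, t.out.2.out.1 * t.out.2.out.2))) C :=
  ⟨hp.measurable.comp (WithBorel.continuous_mk.comp
    (continuous_triple_fst.prodMk (continuous_triple_snd.mul continuous_triple_thd))).measurable,
    hp.bound_mul_right⟩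

theorem triple_cyclic : IsTripleKernel ω
    (fun t => p (.mk (t.out.2.out.1, t.out.2.out.2 * t.out.1))) C :=
  ⟨hp.measurable.comp (WithBorel.continuous_mk.comp
    (continuous_triple_snd.prodMk (continuous_triple_thd.mul continuous_triple_fst))).measurable,
    fun x y z => (hp.bound_mul_right y z x).trans (le_of_eq (by ring))⟩

theorem measurable_slice_left (y : G) : Measurable fun x => p (.mk (x, y)) :=
  hp.measurable.comp (continuous_slice_left y).measurable

theorem measurable_slice_right (x : G) : Measurable fun y => p (.mk (x, y)) :=
  hp.measurable.comp (continuous_slice_right x).measurable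

theorem pair_conv_left {f g h : L1 μ ω} {a b c : G → ℂ} (ha : IsNice μ ω a) (hb : IsNice μ ω b)
    (hc : IsNice μ ω c) (hfa : f =ᵐ[μ] a) (hgb : g =ᵐ[μ] b) (hhc : h =ᵐ[μ] c) :
    pair (hp.op μ (f.conv g)) h =
      ∫ z, (∫ x, ∫ y, p (.mk (x * y, z)) * (a x * b y) ∂μ ∂μ) * c z ∂μ := by
  have hab := ha.convolve hb
  rw [hp.pair_op_nice hab hc (L1.conv_ae_eq f g ha hb hfa hgb) hhc, (hp.tame hab hc).integral_left]
  refine integral_congr_ae (.of_forall fun z => ?_)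
  simp only
  rw [← integral_mul_convolve ha hb (hp.measurable_slice_left z) (C := C * ω z)
    (fun x => (hp.bound x z).trans (le_of_eq (by ring))), ← integral_mul_const]
  refine integral_congr_ae (.of_forall fun x => ?_)
  change p (.mk (x, z)) * (convolve μ a b x * c z) = _
  ring

theorem pair_conv_right {f g h : L1 μ ω} {a b c : G → ℂ} (ha : IsNice μ ω a) (hb : IsNice μ ω b)
    (hc : IsNice μ ω c) (hfa : f =ᵐ[μ] a) (hgb : g =ᵐ[μ] b) (hhc : h =ᵐ[μ] c) :
    pair (hp.op μ f) (g.conv h) =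
      ∫ x, (∫ y, ∫ z, p (.mk (x, y * z)) * (b y * c z) ∂μ ∂μ) * a x ∂μ := by
  have hbc := hb.convolve hc
  rw [hp.pair_op_nice ha hbc hfa (L1.conv_ae_eq g h hb hc hgb hhc), (hp.tame ha hbc).integral_right]
  refine integral_congr_ae (.of_forall fun x => ?_)
  simp only
  rw [← integral_mul_convolve hb hc (hp.measurable_slice_right x) (C := C * ω x)
    (fun y => (hp.bound x y).trans (le_of_eq (by ring))), ← integral_mul_const]
  refine integral_congr_ae (.of_forall fun y => ?_)
  change p (.mk (x, y)) * (a x * convolve μ b c y) = _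
  ring

omit hp in
-- `WithBorel` changes nothing but the $\sigma$-algebra, so the two triple products are the same
-- topological group with its Borel sets, and `prodHaar` has the null sets of `radonHaar`.
theorem ae_triple {P : WithBorel (G × G × G) → Prop} :
    (∀ᵐ t ∂prodHaar μ (prodHaar μ μ), P (.mk (t.out.1, t.out.2.out.1, t.out.2.out.2))) ↔
      ∀ᵐ t ∂radonHaar (WithBorel (G × G × G)), P t := by
  rw [ae_prodHaar]
  exact Iff.rfl

/-- The three pairings in the derivation identity are the integrals of $p(xy,z)$, $p(x,yz)$ and
$p(y,zx)$ against the same product $a(x)b(y)c(z)$, and such integrals determine a triple kernel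
almost everywhere. -/
theorem op_mem_derivations_iff : hp.op μ ∈ derivations μ ω ↔ QuasiAdditive p := by
  have h1 := hp.triple_left
  have h2 := hp.triple_right
  have h3 := hp.triple_cyclic
  constructor
  · intro hD
    refine ⟨hp.measurable, (ae_triple (μ := μ)).1 ?_⟩
    have hK : IsTripleKernel ω (fun t => p (.mk (t.out.1 * t.out.2.out.1, t.out.2.out.2)) -
        (p (.mk (t.out.1, t.out.2.out.1 * t.out.2.out.2)) +
          p (.mk (t.out.2.out.1, t.out.2.out.2 * t.out.1)))) (C + (C + C)) := by
      refine ⟨h1.measurable.sub (h2.measurable.add h3.measurable), fun x y z => ?_⟩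
      refine (norm_sub_le _ _).trans ?_
      rw [add_mul, add_mul]
      exact add_le_add (h1.bound x y z) ((norm_add_le _ _).trans
        (add_le_add (h2.bound x y z) (h3.bound x y z)))
    have h0 := hK.ae_eq_zero (μ := μ) fun a b c ha hb hc => by
      have e := hD ha.toL1 hb.toL1 hc.toL1
      rw [hp.pair_conv_left ha hb hc ha.coeFn_toL1 hb.coeFn_toL1 hc.coeFn_toL1,
        hp.pair_conv_right ha hb hc ha.coeFn_toL1 hb.coeFn_toL1 hc.coeFn_toL1,
        hp.pair_conv_right hb hc ha hb.coeFn_toL1 hc.coeFn_toL1 ha.coeFn_toL1] at e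
      have i1 := h1.integral_eq_zxy ha hb hc
      have i2 := h2.integral_eq_xyz ha hb hc
      have i3 := h3.integral_eq_yzx ha hb hc
      have t1 := (h1.tame ha (isTame_tensor hb hc)).integrable
      have t2 := (h2.tame ha (isTame_tensor hb hc)).integrable
      have t3 := (h3.tame ha (isTame_tensor hb hc)).integrable
      simp_rw [sub_mul, add_mul]
      refine (integral_sub t1 (t2.add t3)).trans ?_
      refine (congrArg₂ (· - ·) i1 ((integral_add t2 t3).trans (congrArg₂ (· + ·) i2 i3))).trans ?_
      exact sub_eq_zero.2 e
    filter_upwards [h0] with t ht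
    exact sub_eq_zero.1 ht
  · intro hq f g h
    obtain ⟨a, ha, hfa⟩ := L1.exists_nice f
    obtain ⟨b, hb, hgb⟩ := L1.exists_nice g
    obtain ⟨c, hc, hhc⟩ := L1.exists_nice h
    rw [hp.pair_conv_left ha hb hc hfa hgb hhc, hp.pair_conv_right ha hb hc hfa hgb hhc,
      hp.pair_conv_right hb hc ha hgb hhc hfa]
    have i1 := h1.integral_eq_zxy ha hb hc
    have i2 := h2.integral_eq_xyz ha hb hc
    have i3 := h3.integral_eq_yzx ha hb hc
    refine i1.symm.trans (Eq.trans ?_ (congrArg₂ (· + ·) i2 i3))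
    rw [← integral_add (h2.tame ha (isTame_tensor hb hc)).integrable
      (h3.tame ha (isTame_tensor hb hc)).integrable]
    refine integral_congr_ae ?_
    filter_upwards [(ae_triple (μ := μ)).2 hq.2] with t ht
    rw [← add_mul]
    exact congrArg (· * _) ht

end IsKernel

end QuasiAdditive

/-! ### Derivations as quasi-additive functions -/

section Gamma

variable {G : Type*} [Group G] [TopologicalSpace G] [MeasurableSpace G]
  [IsTopologicalGroup G] [LocallyCompactSpace G] [T2Space G] [BorelSpace G]
  {μ : Measure G} [μ.IsHaarMeasure] [μ.InnerRegular] {ω : Weight G}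
  {p : WithBorel (G × G) → ℂ} {C : ℝ}

theorem ae_eq_prodHaar_iff {p q : WithBorel (G × G) → ℂ} :
    p =ᵐ[radonHaar (WithBorel (G × G))] q ↔ p =ᵐ[prodHaar μ μ] q := by
  rw [EventuallyEq, EventuallyEq, ae_prodHaar]

theorem tensorInv_mul_le_iff (z : WithBorel (G × G)) (t : ℂ) :
    ω.tensorInv.toFun z * ‖t‖ ≤ C ↔ ‖t‖ ≤ C * (ω z.out.1 * ω z.out.2) := by
  change (ω z.out.1 * ω z.out.2)⁻¹ * ‖t‖ ≤ C ↔ _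
  rw [inv_mul_le_iff₀ (mul_pos (ω.pos _) (ω.pos _)), mul_comm]

/-- The class of a kernel. -/
def IsKernel.toLInf₂ (hp : IsKernel ω p C) : LInf₂ ω :=
  WeightedLp.ofBounded p hp.measurable C fun z => (tensorInv_mul_le_iff z _).2 (hp.bound _ _)

theorem IsKernel.coeFn_toLInf₂ (hp : IsKernel ω p C) :
    hp.toLInf₂ =ᵐ[radonHaar (WithBorel (G × G))] p :=
  WeightedLp.coeFn_ofBounded _ _ _ _

theorem IsKernel.norm_toLInf₂_le (hp : IsKernel ω p C) : ‖hp.toLInf₂‖ ≤ C :=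
  WeightedLp.norm_ofBounded_le _ _ _ hp.nonneg _

theorem exists_isKernel (P : LInf₂ ω) :
    ∃ p, IsKernel ω p ‖P‖ ∧ P =ᵐ[radonHaar (WithBorel (G × G))] p := by
  obtain ⟨p, hp, hb, he⟩ := P.exists_bounded_rep
  exact ⟨p, ⟨hp, fun x y => (tensorInv_mul_le_iff (WithBorel.mk (x, y)) _).1 (hb _)⟩, he⟩

theorem IsKernel.pair_op_class (hp : IsKernel ω p C) {P : LInf₂ ω}
    (hP : P =ᵐ[radonHaar (WithBorel (G × G))] p) (f g : L1 μ ω) :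
    pair (hp.op μ f) g = ∫ y, ∫ x, P (.mk (x, y)) * f x * g y ∂μ ∂μ := by
  rw [hp.pair_op]
  exact form_congr hp.measurable (WeightedLp.measurable_coe P)
    (ae_eq_prodHaar_iff.1 hP.symm) f g

/-- An element of `L^∞(G × G, 1/ω^⊗)` is determined by its bilinear form. -/
theorem eq_of_forms_eq (μ : Measure G) [μ.IsHaarMeasure] [μ.InnerRegular] {P Q : LInf₂ ω}
    (h : ∀ f g : L1 μ ω, ∫ y, ∫ x, P (.mk (x, y)) * f x * g y ∂μ ∂μ =
      ∫ y, ∫ x, Q (.mk (x, y)) * f x * g y ∂μ ∂μ) : P = Q := by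
  obtain ⟨p, hp, hPp⟩ := exists_isKernel P
  obtain ⟨q, hq, hQq⟩ := exists_isKernel Q
  have hk : IsKernel ω (fun z => p z - q z) (‖P‖ + ‖Q‖) := by
    refine ⟨hp.measurable.sub hq.measurable, fun x y => (norm_sub_le _ _).trans ?_⟩
    rw [add_mul]
    exact add_le_add (hp.bound x y) (hq.bound x y)
  have h0 : (fun z => p z - q z) =ᵐ[prodHaar μ μ] 0 := hk.ae_eq_zero fun a b ha hb => by
    have h1 := h ha.toL1 hb.toL1
    rw [← hp.pair_op_class hPp, ← hq.pair_op_class hQq,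
      hp.pair_op_nice ha hb ha.coeFn_toL1 hb.coeFn_toL1,
      hq.pair_op_nice ha hb ha.coeFn_toL1 hb.coeFn_toL1] at h1
    simp_rw [sub_mul]
    exact (integral_sub (hp.tame ha hb).integrable (hq.tame ha hb).integrable).trans
      (sub_eq_zero.2 h1)
  refine WeightedLp.ext (hPp.trans (EventuallyEq.trans ?_ hQq.symm))
  refine (ae_eq_prodHaar_iff (μ := μ)).2 ?_
  filter_upwards [h0] with z hz
  exact sub_eq_zero.1 hz

theorem IsKernel.op_eq {q : WithBorel (G × G) → ℂ} {C' : ℝ} (hp : IsKernel ω p C)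
    (hq : IsKernel ω q C') (hpq : p =ᵐ[radonHaar (WithBorel (G × G))] q) : hp.op μ = hq.op μ := by
  ext1 f
  refine LInf.ext_pair fun g => ?_
  rw [hp.pair_op_class hp.coeFn_toLInf₂, hq.pair_op_class (hp.coeFn_toLInf₂.trans hpq)]

theorem IsKernel.toLInf₂_mem (hp : IsKernel ω p C) (h : QuasiAdditive p) :
    hp.toLInf₂ ∈ quasiAdditive ω :=
  ⟨p, h, ⟨C, fun x y => (div_le_iff₀ (mul_pos (ω.pos x) (ω.pos y))).2 (hp.bound x y)⟩,
    hp.coeFn_toLInf₂⟩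

theorem exists_quasiAdditive_kernel (P : quasiAdditive ω) :
    ∃ p, IsKernel ω p ‖P‖ ∧ QuasiAdditive p ∧ P.1 =ᵐ[radonHaar (WithBorel (G × G))] p := by
  obtain ⟨p, hp, hPp⟩ := exists_isKernel P.1
  obtain ⟨q, hq, ⟨C, hC⟩, hPq⟩ := P.2
  have hqk : IsKernel ω q C :=
    ⟨hq.1, fun x y => (div_le_iff₀ (mul_pos (ω.pos x) (ω.pos y))).1 (hC x y)⟩
  refine ⟨p, hp, ?_, hPp⟩
  -- Quasi-additivity passes from `q` to the representative `p` with the sharp bound, because both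
  -- define the same operator and quasi-additivity is a property of that operator.
  have h1 := (hqk.op_mem_derivations_iff (μ := radonHaar G)).2 hq
  rw [hqk.op_eq hp (hPq.symm.trans hPp)] at h1
  exact hp.op_mem_derivations_iff.1 h1

/-- The isometry of the space of derivations onto `D(G, ω)`. -/
theorem exists_isometry (μ : Measure G) [μ.IsHaarMeasure] [μ.InnerRegular] (ω : Weight G) :
    ∃ Γ : derivations μ ω ≃ₗᵢ[ℂ] quasiAdditive ω, ∀ (D : derivations μ ω) (f g : L1 μ ω),
      pair (D.1 f) g = ∫ y, ∫ x, (Γ D).1 (.mk (x, y)) * f x * g y ∂μ ∂μ := by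
  choose k hk hkD using fun D : derivations μ ω => exists_kernel D.1
  have hkq : ∀ D, QuasiAdditive (k D) := fun D =>
    (hk D).op_mem_derivations_iff.1 (by rw [hkD D]; exact D.2)
  set F : derivations μ ω → quasiAdditive ω := fun D =>
    ⟨(hk D).toLInf₂, (hk D).toLInf₂_mem (hkq D)⟩ with hF
  have hform : ∀ (D : derivations μ ω) (f g : L1 μ ω),
      pair (D.1 f) g = ∫ y, ∫ x, (F D).1 (.mk (x, y)) * f x * g y ∂μ ∂μ := by
    intro D f g
    rw [← (hk D).pair_op_class (hk D).coeFn_toLInf₂, hkD]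
  -- Uniqueness of kernels, in a form that serves for linearity, for the norm and for surjectivity.
  -- It is needed because the kernels `k D` are chosen independently for each `D`.
  have hop : ∀ (D : derivations μ ω) {p : WithBorel (G × G) → ℂ} {C : ℝ} (hp : IsKernel ω p C)
      {P : LInf₂ ω}, P =ᵐ[radonHaar (WithBorel (G × G))] p →
      (hp.op μ = D.1 ↔ (F D).1 = P) := by
    intro D p C hp P hP
    constructor
    · intro h
      refine eq_of_forms_eq μ fun f g => ?_
      rw [← hform, ← hp.pair_op_class hP, h]
    · intro h
      ext1 f
      refine LInf.ext_pair fun g => ?_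
      rw [hform, h, hp.pair_op_class hP]
  let L : derivations μ ω →ₗ[ℂ] quasiAdditive ω :=
    { toFun := F
      map_add' := fun D E => Subtype.ext <| by
        have hpq : IsKernel ω (fun z => k D z + k E z) (‖D.1‖ + ‖E.1‖) := by
          refine ⟨(hk D).measurable.add (hk E).measurable, fun x y => (norm_add_le _ _).trans ?_⟩
          rw [add_mul]
          exact add_le_add ((hk D).bound x y) ((hk E).bound x y)
        refine (hop (D + E) hpq ?_).1 ?_
        · filter_upwards [WeightedLp.coeFn_add (F D).1 (F E).1, (hk D).coeFn_toLInf₂,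
            (hk E).coeFn_toLInf₂] with z e1 e2 e3
          refine e1.trans ?_
          rw [e2, e3]
        · ext1 f
          refine WeightedLp.ext ?_
          have e1 : (D + E).1 f = (hk D).op μ f + (hk E).op μ f := by rw [hkD, hkD]; rfl
          rw [e1]
          filter_upwards [hpq.op_coeFn f, (hk D).op_coeFn f, (hk E).op_coeFn f,
            WeightedLp.coeFn_add ((hk D).op μ f) ((hk E).op μ f)] with y e1 e2 e3 e4
          rw [e1, e4, e2, e3,
            ← integral_add ((hk D).integrable_slice f y) ((hk E).integrable_slice f y)]
          simp_rw [add_mul]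
      map_smul' := fun c D => Subtype.ext <| by
        have hpq : IsKernel ω (fun z => c * k D z) (‖c‖ * ‖D.1‖) := by
          refine ⟨(hk D).measurable.const_mul c, fun x y => ?_⟩
          rw [norm_mul, mul_assoc]
          exact mul_le_mul_of_nonneg_left ((hk D).bound x y) (norm_nonneg c)
        refine (hop (c • D) hpq ?_).1 ?_
        · filter_upwards [WeightedLp.coeFn_smul c (F D).1, (hk D).coeFn_toLInf₂] with z e1 e2
          refine e1.trans ?_
          rw [e2]
        · ext1 f
          refine WeightedLp.ext ?_
          have e1 : (c • D).1 f = c • (hk D).op μ f := by rw [hkD]; rfl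
          rw [e1]
          filter_upwards [hpq.op_coeFn f, (hk D).op_coeFn f,
            WeightedLp.coeFn_smul c ((hk D).op μ f)] with y e1 e2 e4
          rw [e1, e4, e2, ← integral_const_mul]
          simp_rw [mul_assoc] }
  -- One inequality comes from the kernel bounded by $\|D\|$, the other from a representative
  -- bounded by the norm of its class.
  have hL : ∀ D, ‖L D‖ = ‖D‖ := by
    intro D
    refine le_antisymm (hk D).norm_toLInf₂_le ?_
    obtain ⟨q, hq, hPq⟩ := exists_isKernel (F D).1
    have h1 := (hop D hq hPq).2 rfl
    change ‖D.1‖ ≤ ‖(F D).1‖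
    rw [← h1]
    exact hq.norm_op_le
  refine ⟨LinearIsometryEquiv.ofSurjective ⟨L, hL⟩ fun P => ?_, hform⟩
  obtain ⟨p, hp, hpq, hPp⟩ := exists_quasiAdditive_kernel P
  refine ⟨⟨hp.op μ, hp.op_mem_derivations_iff.2 hpq⟩, Subtype.ext ?_⟩
  exact (hop ⟨hp.op μ, hp.op_mem_derivations_iff.2 hpq⟩ hp hPp).1 rfl

/-- Completeness of the space of derivations is carried over by the isometry to $D(G,\omega)$. -/
theorem isClosed_derivations : IsClosed (derivations μ ω : Set (L1 μ ω →L[ℂ] LInf μ ω)) := by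
  have hc : ∀ a c : L1 μ ω, Continuous fun D : L1 μ ω →L[ℂ] LInf μ ω => pair (D a) c := by
    intro a c
    let φ : LInf μ ω →L[ℂ] ℂ := LinearMap.mkContinuous
      { toFun := fun h => pair h c
        map_add' := fun h k => pair_add h k c
        map_smul' := fun t h => pair_smul t h c } ‖c‖
      (fun h => (norm_pair_le h c).trans (le_of_eq (mul_comm _ _)))
    exact φ.continuous.comp (ContinuousLinearMap.apply ℂ (LInf μ ω) a).continuous
  have e : (derivations μ ω : Set (L1 μ ω →L[ℂ] LInf μ ω)) =
      ⋂ (a : L1 μ ω) (b : L1 μ ω) (c : L1 μ ω), {D | pair (D (a.conv b)) c =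
        pair (D a) (b.conv c) + pair (D b) (c.conv a)} := by
    ext D
    simp only [mem_iInter]
    exact Iff.rfl
  rw [e]
  exact isClosed_iInter fun a => isClosed_iInter fun b => isClosed_iInter fun c =>
    isClosed_eq (hc _ _) ((hc _ _).add (hc _ _))

theorem completeSpace_derivations : CompleteSpace (derivations μ ω) :=
  isClosed_derivations.completeSpace_coe

/-! ### Inner derivations -/

theorem isKernel_commutator {k : G → ℂ} (hk : Measurable k) (hb : ∀ x, ‖k x‖ ≤ C * ω x) :
    IsKernel ω (fun z => k (z.out.1 * z.out.2) - k (z.out.2 * z.out.1)) (C + C) := by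
  have hC : 0 ≤ C := by
    have := (norm_nonneg _).trans (hb 1)
    rwa [ω.map_one, mul_one] at this
  refine ⟨(hk.comp (continuous_fst_out.mul continuous_snd_out).measurable).sub
    (hk.comp (continuous_snd_out.mul continuous_fst_out).measurable), fun x y => ?_⟩
  refine (norm_sub_le _ _).trans ?_
  rw [add_mul]
  refine add_le_add ((hb _).trans (mul_le_mul_of_nonneg_left (ω.map_mul_le x y) hC))
    ((hb _).trans (mul_le_mul_of_nonneg_left ((ω.map_mul_le y x).trans (le_of_eq ?_)) hC))
  exact mul_comm _ _

theorem quasiAdditive_commutator {k : G → ℂ} (hk : Measurable k) :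
    QuasiAdditive fun z : WithBorel (G × G) => k (z.out.1 * z.out.2) - k (z.out.2 * z.out.1) := by
  refine ⟨(hk.comp (continuous_fst_out.mul continuous_snd_out).measurable).sub
    (hk.comp (continuous_snd_out.mul continuous_fst_out).measurable), .of_forall fun t => ?_⟩
  change k (t.out.1 * t.out.2.1 * t.out.2.2) - k (t.out.2.2 * (t.out.1 * t.out.2.1)) =
    k (t.out.1 * (t.out.2.1 * t.out.2.2)) - k (t.out.2.1 * t.out.2.2 * t.out.1) +
      (k (t.out.2.1 * (t.out.2.2 * t.out.1)) - k (t.out.2.2 * t.out.1 * t.out.2.1))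
  simp only [mul_assoc]
  ring

/-- For $xy$ the variable $x$ is fixed and for $yx$ the variable $y$ is fixed, so only left
translates of null sets occur. -/
theorem ae_comp_mul {h k : G → ℂ} (hh : Measurable h) (hk : Measurable k) (e : h =ᵐ[μ] k) :
    ∀ᵐ z ∂radonHaar (WithBorel (G × G)), h (z.out.1 * z.out.2) = k (z.out.1 * z.out.2) ∧
      h (z.out.2 * z.out.1) = k (z.out.2 * z.out.1) := by
  rw [← ae_prodHaar (m := μ) (n := μ)]
  have h1 : Measurable fun z : WithBorel (G × G) => z.out.1 * z.out.2 :=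
    (continuous_fst_out.mul continuous_snd_out).measurable
  have h2 : Measurable fun z : WithBorel (G × G) => z.out.2 * z.out.1 :=
    (continuous_snd_out.mul continuous_fst_out).measurable
  have h0 : ∀ x, μ {y | ¬ h (x * y) = k (x * y)} = 0 := by
    intro x
    have h3 : μ {y | h y = k y}ᶜ = 0 := e
    rw [← measure_preimage_mul μ x] at h3
    exact h3
  refine Filter.Eventually.and ?_ ?_
  · exact (isRadonProduct_prodHaar μ μ).measure_eq_zero_of_right
      (E := {z | h (z.out.1 * z.out.2) = k (z.out.1 * z.out.2)}ᶜ)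
      (measurableSet_eq_fun (hh.comp h1) (hk.comp h1)).compl h0
  · exact (isRadonProduct_prodHaar μ μ).measure_eq_zero_of_left
      (E := {z | h (z.out.2 * z.out.1) = k (z.out.2 * z.out.1)}ᶜ)
      (measurableSet_eq_fun (hh.comp h2) (hk.comp h2)).compl h0

/-- By Fubini's theorem and left invariance, $\langle h,f*g\rangle$ and $\langle h,g*f\rangle$ have
the kernels $h(xy)$ and $h(yx)$. -/
theorem pair_op_commutator {h : LInf μ ω} {k : G → ℂ} (hk : Measurable k)
    (hb : ∀ x, ‖k x‖ ≤ C * ω x) (hhk : h =ᵐ[μ] k) (f g : L1 μ ω) :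
    pair ((isKernel_commutator hk hb).op μ f) g = pair h (f.conv g) - pair h (g.conv f) := by
  obtain ⟨a, ha, hfa⟩ := L1.exists_nice f
  obtain ⟨b, hb', hgb⟩ := L1.exists_nice g
  have hC : 0 ≤ C := by
    have := (norm_nonneg _).trans (hb 1)
    rwa [ω.map_one, mul_one] at this
  have k1 : IsKernel ω (fun z => k (z.out.1 * z.out.2)) C :=
    ⟨hk.comp (continuous_fst_out.mul continuous_snd_out).measurable, fun x y =>
      (hb _).trans (mul_le_mul_of_nonneg_left (ω.map_mul_le x y) hC)⟩
  have k2 : IsKernel ω (fun z => k (z.out.2 * z.out.1)) C :=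
    ⟨hk.comp (continuous_snd_out.mul continuous_fst_out).measurable, fun x y =>
      (hb _).trans (mul_le_mul_of_nonneg_left ((ω.map_mul_le y x).trans
        (le_of_eq (mul_comm _ _))) hC)⟩
  have t1 := k1.tame ha hb'
  have t2 := k2.tame ha hb'
  rw [(isKernel_commutator hk hb).pair_op_nice ha hb' hfa hgb,
    pair_conv hhk hk hb ha hb' hfa hgb, pair_conv hhk hk hb hb' ha hgb hfa]
  simp_rw [sub_mul]
  refine (integral_sub t1.integrable t2.integrable).trans (congrArg₂ (· - ·) t1.integral_right
    (t2.integral_left.trans ?_))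
  refine integral_congr_ae (.of_forall fun y => integral_congr_ae (.of_forall fun x => ?_))
  change k (y * x) * (a x * b y) = k (y * x) * (b y * a x)
  ring

theorem mem_innerQuasiAdditive_iff {P : LInf₂ ω} : P ∈ innerQuasiAdditive μ ω ↔
    ∃ (k : G → ℂ) (C : ℝ), Measurable k ∧ (∀ x, ‖k x‖ ≤ C * ω x) ∧
      P =ᵐ[radonHaar (WithBorel (G × G))]
        fun z => k (z.out.1 * z.out.2) - k (z.out.2 * z.out.1) := by
  constructor
  · rintro ⟨h, hh⟩
    obtain ⟨k, hk, hb, e⟩ := LInf.exists_rep h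
    refine ⟨k, _, hk, hb, ?_⟩
    filter_upwards [hh, ae_comp_mul (WeightedLp.measurable_coe h) hk e] with z h1 h2
    rw [h1, h2.1, h2.2]
  · rintro ⟨k, C, hk, hb, e⟩
    have hb' : ∀ x, ω.inv.toFun x * ‖k x‖ ≤ C := fun x => by
      change (ω x)⁻¹ * _ ≤ _
      rw [inv_mul_le_iff₀ (ω.pos x), mul_comm]
      exact hb x
    have h1 := WeightedLp.coeFn_ofBounded (m := μ) k hk C hb'
    refine ⟨WeightedLp.ofBounded k hk C hb', ?_⟩
    filter_upwards [e, ae_comp_mul (WeightedLp.measurable_coe _) hk h1] with z h1 h2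
    rw [h1, h2.1, h2.2]

theorem innerQuasiAdditive_subset :
    innerQuasiAdditive μ ω ⊆ (quasiAdditive ω : Set (LInf₂ ω)) := by
  intro P hP
  obtain ⟨k, C, hk, hb, e⟩ := mem_innerQuasiAdditive_iff.1 hP
  exact ⟨_, quasiAdditive_commutator hk, ⟨_, fun x y =>
    (div_le_iff₀ (mul_pos (ω.pos x) (ω.pos y))).2 ((isKernel_commutator hk hb).bound x y)⟩, e⟩

theorem image_inner {F : derivations μ ω → quasiAdditive ω}
    (hF : ∀ (D : derivations μ ω) (f g : L1 μ ω),
      pair (D.1 f) g = ∫ y, ∫ x, (F D).1 (.mk (x, y)) * f x * g y ∂μ ∂μ) :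
    (fun D => (F D).1) '' {D | IsInner D.1} = innerQuasiAdditive μ ω := by
  ext P
  constructor
  · rintro ⟨D, ⟨h, hh⟩, rfl⟩
    obtain ⟨k, hk, hb, e⟩ := LInf.exists_rep h
    have hK := isKernel_commutator hk hb
    refine mem_innerQuasiAdditive_iff.2 ⟨k, _, hk, hb, ?_⟩
    have h1 : (F D).1 = hK.toLInf₂ := eq_of_forms_eq μ fun f g => by
      rw [← hF, ← hK.pair_op_class hK.coeFn_toLInf₂, hh, pair_op_commutator hk hb e]
    simp only [h1]
    exact hK.coeFn_toLInf₂
  · intro hP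
    obtain ⟨k, C, hk, hb, e⟩ := mem_innerQuasiAdditive_iff.1 hP
    have hK := isKernel_commutator hk hb
    have hb' : ∀ x, ω.inv.toFun x * ‖k x‖ ≤ C := fun x => by
      change (ω x)⁻¹ * _ ≤ _
      rw [inv_mul_le_iff₀ (ω.pos x), mul_comm]
      exact hb x
    have h1 := WeightedLp.coeFn_ofBounded (m := μ) k hk C hb'
    refine ⟨⟨hK.op μ, hK.op_mem_derivations_iff.2 (quasiAdditive_commutator hk)⟩,
      ⟨WeightedLp.ofBounded k hk C hb', pair_op_commutator hk hb h1⟩, ?_⟩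
    refine eq_of_forms_eq μ fun f g => ?_
    rw [← hF, hK.pair_op_class e]

/-- `D(f)(x) = ∫ p(y, x) f(y) dy` for almost all `x`, for the function `p` that belongs to `D`. -/
theorem ae_eq_integral_of_forms {D : L1 μ ω →L[ℂ] LInf μ ω} {P : LInf₂ ω}
    (h : ∀ f g : L1 μ ω, pair (D f) g = ∫ y, ∫ x, P (.mk (x, y)) * f x * g y ∂μ ∂μ) (f : L1 μ ω) :
    ∀ᵐ x ∂μ, D f x = ∫ y, P (.mk (y, x)) * f y ∂μ := by
  obtain ⟨p, hp, hPp⟩ := exists_isKernel P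
  have h1 : D f = hp.op μ f := LInf.ext_pair fun g => by rw [h, hp.pair_op_class hPp]
  rw [h1]
  filter_upwards [hp.op_coeFn f, ae_integral_congr (WeightedLp.measurable_coe P) hp.measurable
    (ae_eq_prodHaar_iff.1 hPp) f] with x e1 e2
  rw [e1, e2]

theorem forms_of_ae_eq_integral {D : L1 μ ω →L[ℂ] LInf μ ω} {P : LInf₂ ω} {f : L1 μ ω}
    (h : ∀ᵐ x ∂μ, D f x = ∫ y, P (.mk (y, x)) * f y ∂μ) (g : L1 μ ω) :
    pair (D f) g = ∫ y, ∫ x, P (.mk (x, y)) * f x * g y ∂μ ∂μ := by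
  rw [pair_eq h (ae_eq_refl _)]
  refine integral_congr_ae (.of_forall fun y => ?_)
  simp only
  rw [integral_mul_const]

end Gamma

/-! ### Bounded quasi-additive functions are commutators -/

section Fubini

variable {X Y : Type*} [TopologicalSpace X] [TopologicalSpace Y] [T2Space X] [T2Space Y]
  [MeasurableSpace X] [BorelSpace X] [MeasurableSpace Y] [BorelSpace Y] {m : Measure X}
  {n : Measure Y} {p : Measure (WithBorel (X × Y))} [IsFiniteMeasureOnCompacts m]
  [IsFiniteMeasureOnCompacts n] [m.InnerRegular] [n.InnerRegular]

theorem IsProduct.ae_of_ae_ae {X Y : Type*} [TopologicalSpace X] [TopologicalSpace Y]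
    [MeasurableSpace X] [BorelSpace X] [MeasurableSpace Y] [BorelSpace Y] {m : Measure X}
    {n : Measure Y} {p : Measure (WithBorel (X × Y))} (h : IsProduct m n p)
    {P : WithBorel (X × Y) → Prop} (hP : MeasurableSet {q | P q})
    (h0 : ∀ᵐ x ∂m, ∀ᵐ y ∂n, P (.mk (x, y))) : ∀ᵐ q ∂p, P q := by
  change p {q | P q}ᶜ = 0
  rw [← lintegral_indicator_one hP.compl, h.lintegral_right (measurable_one.indicator hP.compl)]
  refine (lintegral_congr_ae (g := fun _ => 0) ?_).trans (by simp)
  filter_upwards [h0] with x hx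
  refine (lintegral_congr_ae (g := fun _ => 0) ?_).trans (by simp)
  filter_upwards [hx] with y hy
  exact indicator_of_notMem (not_not_intro hy) _

theorem IsRadonProduct.ae_of_ae_ae (h : IsRadonProduct m n p) {P : WithBorel (X × Y) → Prop}
    (hP : MeasurableSet {q | P q}) (h0 : ∀ K L, IsCompact K → IsCompact L →
      ∀ᵐ x ∂m.restrict K, ∀ᵐ y ∂n.restrict L, P (.mk (x, y))) : ∀ᵐ q ∂p, P q := by
  refine h.measure_eq_zero hP.compl fun K L hK hL => ?_
  rw [← Measure.restrict_apply hP.compl]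
  exact (h.restrict hK.isSigmaCompact hL.isSigmaCompact).ae_of_ae_ae hP (h0 K L hK hL)

end Fubini

section Commutator

open scoped Pointwise

variable {G : Type*} [Group G] [TopologicalSpace G] [MeasurableSpace G]
  [IsTopologicalGroup G] [LocallyCompactSpace G] [T2Space G] [BorelSpace G]
  {μ : Measure G} [μ.IsHaarMeasure] [μ.InnerRegular]

theorem ae_swap {P : WithBorel (G × G) → Prop} (hP : MeasurableSet {q | P q})
    (h : ∀ᵐ q ∂prodHaar μ μ, P q) : ∀ᵐ q ∂prodHaar μ μ, P (.mk (q.out.2, q.out.1)) := by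
  have hc : Measurable fun q : WithBorel (G × G) => WithBorel.mk (q.out.2, q.out.1) :=
    (WithBorel.continuous_mk.comp (continuous_snd_out.prodMk continuous_fst_out)).measurable
  refine (isRadonProduct_prodHaar μ μ).ae_of_ae_ae (hc hP) fun K L hK hL => ?_
  exact (isRadonProduct_prodHaar μ μ).ae_left h hL.isSigmaCompact hK.isSigmaCompact

theorem ae_restrict_inv_mul {P : G → Prop} {B M : Set G} {y : G} (hy : y ∈ B)
    (hM : MeasurableSet M) (hBM : MeasurableSet (B⁻¹ * M)) (h : ∀ᵐ z ∂μ.restrict (B⁻¹ * M), P z) :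
    ∀ᵐ v ∂μ.restrict M, P (y⁻¹ * v) := by
  rw [ae_restrict_iff' hBM] at h
  rw [ae_restrict_iff' hM]
  have h1 := (measurePreserving_mul_left μ y⁻¹).quasiMeasurePreserving.ae h
  filter_upwards [h1] with v hv hvM
  exact hv (mul_mem_mul (inv_mem_inv.2 hy) hvM)

theorem ae_comp_mul_swap {P : G → Prop} (h : ∀ᵐ u ∂μ, P u) :
    ∀ᵐ q ∂prodHaar μ μ, P (q.out.2 * q.out.1) := by
  obtain ⟨N, hN, hNm, hN0⟩ := exists_measurable_superset_of_null h
  have h2 : Measurable fun z : WithBorel (G × G) => z.out.2 * z.out.1 :=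
    (continuous_snd_out.mul continuous_fst_out).measurable
  refine measure_mono_null (t := (fun z : WithBorel (G × G) => z.out.2 * z.out.1) ⁻¹' N)
    (fun q hq => hN hq) ?_
  exact (isRadonProduct_prodHaar μ μ).measure_eq_zero_of_left (h2 hNm) fun y =>
    (measure_preimage_mul μ y N).trans hN0

/-- Quasi-additivity after the substitution `z = y⁻¹ v`, with `y` as the innermost variable. -/
theorem ae_ae_of_quasiAdditive {r : WithBorel (G × G) → ℝ} (hr : Measurable r)
    (hq : ∀ᵐ t ∂prodHaar μ (prodHaar μ μ), r (.mk (t.out.1 * t.out.2.out.1, t.out.2.out.2)) =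
      r (.mk (t.out.1, t.out.2.out.1 * t.out.2.out.2)) +
        r (.mk (t.out.2.out.1, t.out.2.out.2 * t.out.1)))
    {B : Set G} (hB : IsCompact B) :
    ∀ᵐ q ∂prodHaar μ μ, ∀ᵐ y ∂μ.restrict B, r (.mk (q.out.1 * y, y⁻¹ * q.out.2)) =
      r q + r (.mk (y, y⁻¹ * q.out.2 * q.out.1)) := by
  set Q : WithBorel (G × WithBorel (G × G)) → Prop := fun t =>
    r (.mk (t.out.2.out.1 * t.out.1, t.out.1⁻¹ * t.out.2.out.2)) =
      r t.out.2 + r (.mk (t.out.1, t.out.1⁻¹ * t.out.2.out.2 * t.out.2.out.1)) with hQ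
  have hQm : MeasurableSet {t | Q t} := by
    have c1 := continuous_triple_fst (G := G)
    have c2 := continuous_triple_snd (G := G)
    have c3 := continuous_triple_thd (G := G)
    refine measurableSet_eq_fun (hr.comp (WithBorel.continuous_mk.comp ?_).measurable)
      ((hr.comp continuous_snd_out.measurable).add
        (hr.comp (WithBorel.continuous_mk.comp ?_).measurable))
    · exact (c2.mul c1).prodMk (c1.inv.mul c3)
    · exact c1.prodMk ((c1.inv.mul c3).mul c2)
  have hm : MeasurableSet {q : WithBorel (G × G) | ∀ᵐ y ∂μ.restrict B, Q (.mk (y, q))} := by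
    have h1 := (Measure.measurable_coe hQm.compl).comp
      (measurable_slice_restrict (Y := WithBorel (G × G)) μ hB.isSigmaCompact)
    convert! h1 (measurableSet_singleton 0) using 1
    ext q
    simp only [mem_preimage, Function.comp_apply, mem_singleton_iff]
    rw [Measure.map_apply (continuous_slice_left q).measurable hQm.compl]
    rfl
  refine (isRadonProduct_prodHaar μ μ).ae_of_ae_ae hm fun L M hL hM => ?_
  have hZ : IsCompact (B⁻¹ * M) := hB.inv.mul hM
  have h1 := (isRadonProduct_prodHaar μ (prodHaar μ μ)).ae_right hq hL.isSigmaCompact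
    (isCompact_rect hB hZ).isSigmaCompact
  filter_upwards [h1] with x hx
  have h2 := ((isRadonProduct_prodHaar μ μ).restrict hB.isSigmaCompact hZ.isSigmaCompact).ae_right hx
  -- For fixed $x$ and $y$ the substitution $z=y^{-1}v$ is a left translation, and it maps `M` into
  -- `B⁻¹ * M`, where the identity is available.
  have h3 : ∀ᵐ y ∂μ.restrict B, ∀ᵐ v ∂μ.restrict M, Q (.mk (y, .mk (x, v))) := by
    filter_upwards [h2, ae_restrict_mem hB.measurableSet] with y hy hyB
    filter_upwards [ae_restrict_inv_mul hyB hM.measurableSet hZ.measurableSet hy] with v hv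
    refine Eq.trans hv ?_
    change r (.mk (x, y * (y⁻¹ * v))) + _ = _
    rw [mul_inv_cancel_left]
    rfl
  have h4 : MeasurableSet {q : WithBorel (G × G) | Q (.mk (q.out.1, .mk (x, q.out.2)))} := by
    refine (WithBorel.continuous_mk.comp (continuous_fst_out.prodMk
      ((continuous_slice_right x).comp continuous_snd_out))).measurable hQm
  have e := (isRadonProduct_prodHaar μ μ).restrict hB.isSigmaCompact hM.isSigmaCompact
  -- Exchange of $y$ and $v$: the variable of integration $y$ becomes the innermost one.
  exact e.ae_left (e.ae_of_ae_ae h4 h3)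

/-- Averaging the identity $r(xy,y^{-1}v)=r(x,v)+r(y,y^{-1}vx)$ over a translate of a compact set
gives $M_{xa}(xv)=c\,r(x,v)+M_a(vx)$. A supremum over all translates removes the dependence on $a$
at the price of an inequality. -/
theorem exists_le_commutator {r : WithBorel (G × G) → ℝ} (hr : Measurable r) {C : ℝ}
    (hC : ∀ q, |r q| ≤ C)
    (hq : ∀ᵐ t ∂prodHaar μ (prodHaar μ μ), r (.mk (t.out.1 * t.out.2.out.1, t.out.2.out.2)) =
      r (.mk (t.out.1, t.out.2.out.1 * t.out.2.out.2)) +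
        r (.mk (t.out.2.out.1, t.out.2.out.2 * t.out.1))) :
    ∃ (h : G → ℝ) (E : ℝ), Measurable h ∧ (∀ x, |h x| ≤ E) ∧
      ∀ᵐ q ∂prodHaar μ μ, r q ≤ h (q.out.1 * q.out.2) - h (q.out.2 * q.out.1) := by
  obtain ⟨K, hK, hK1⟩ := exists_compact_mem_nhds (1 : G)
  set c : ℝ := μ.real K with hc
  have hc0 : 0 < c := ENNReal.toReal_pos (measure_pos_of_mem_nhds μ hK1).ne' hK.measure_lt_top.ne
  let N : G → WithBorel (G × G) → ℝ := fun a q =>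
    ∫ y in K, r (.mk (q.out.1 * (a * y), (a * y)⁻¹ * q.out.2)) ∂μ
  let M : G → G → ℝ := fun a u => ∫ y in K, r (.mk (a * y, (a * y)⁻¹ * u)) ∂μ
  -- Translation by $x$ merely replaces the index $a$ by $xa$, which the supremum over all indices
  -- absorbs.
  have hNM : ∀ a x v, N a (.mk (x, v)) = M (x * a) (x * v) := by
    intro a x v
    refine integral_congr_ae (.of_forall fun y => ?_)
    change r (.mk (x * (a * y), (a * y)⁻¹ * v)) = r (.mk (x * a * y, (x * a * y)⁻¹ * (x * v)))
    congr 3 <;> group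
  have hint : ∀ {f : G → G × G}, Continuous f → IntegrableOn (fun y => r (.mk (f y))) K μ := by
    intro f hf
    refine Measure.integrableOn_of_bounded (M := C) hK.measure_lt_top.ne
      (hr.comp (WithBorel.continuous_mk.comp hf).measurable).aestronglyMeasurable
      (.of_forall fun y => hC _)
  have hNm : ∀ a, Measurable (N a) := by
    intro a
    have hF : Measurable fun t : WithBorel (G × WithBorel (G × G)) =>
        ((r (.mk (t.out.2.out.1 * (a * t.out.1), (a * t.out.1)⁻¹ * t.out.2.out.2)) : ℝ) : ℂ) := by
      have c1 := continuous_const.mul (continuous_triple_fst (G := G)) (f := fun _ => a)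
      exact Complex.measurable_ofReal.comp (hr.comp (WithBorel.continuous_mk.comp
        ((continuous_triple_snd.mul c1).prodMk (c1.inv.mul continuous_triple_thd))).measurable)
    have h1 := Complex.measurable_re.comp
      (measurable_integral_slice (measurable_slice_restrict μ hK.isSigmaCompact) hF)
    convert! h1 using 1
    ext q
    exact congrArg Complex.re (integral_ofReal (𝕜 := ℂ)
      (f := fun y => r (.mk (q.out.1 * (a * y), (a * y)⁻¹ * q.out.2)))).symm
  have hMm : ∀ a, Measurable (M a) := by
    intro a
    have h1 := (hNm a).comp (continuous_slice_right (1 : G)).measurable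
    convert! h1 using 1
    ext u
    rw [Function.comp_apply, hNM, one_mul, one_mul]
  have hMC : ∀ a u, |M a u| ≤ C * c := fun a u =>
    norm_setIntegral_le_of_norm_le_const (f := fun y => r (.mk (a * y, (a * y)⁻¹ * u)))
      hK.measure_lt_top fun y _ => hC _
  obtain ⟨d, hd⟩ := exists_partition G
  -- The index runs through the whole group, so a pointwise supremum might not be Borel; the local
  -- essential supremum takes its place.
  obtain ⟨h, hh, hhC, hMh, hhJ⟩ := exists_local_essSup (m := μ) (fun i => (hd i).1)
    (fun i => (hd i).2) hMm hMC
  -- Here $c\,r(x,v)+M_a(vx)=N_a(x,v)=M_{xa}(xv)\le h(xv)$.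
  have key : ∀ a, ∀ᵐ q ∂prodHaar μ μ,
      c * r q + M a (q.out.2 * q.out.1) ≤ h (q.out.1 * q.out.2) := by
    intro a
    have h1 : ∀ᵐ q ∂prodHaar μ μ, N a q ≤ h (q.out.1 * q.out.2) := by
      refine (isRadonProduct_prodHaar μ μ).measure_eq_zero_of_right
        (E := {q | N a q ≤ h (q.out.1 * q.out.2)}ᶜ) (measurableSet_le (hNm a)
          (hh.comp (continuous_fst_out.mul continuous_snd_out).measurable)).compl fun x => ?_
      have h2 : μ {u | M (x * a) u ≤ h u}ᶜ = 0 := hMh (x * a)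
      rw [← measure_preimage_mul μ x] at h2
      refine Eq.trans (congrArg μ ?_) h2
      ext v
      change ¬ N a (.mk (x, v)) ≤ h (x * v) ↔ ¬ M (x * a) (x * v) ≤ h (x * v)
      rw [hNM]
    have hB : IsCompact ((fun y => a * y) '' K) := hK.image (continuous_const_mul a)
    filter_upwards [h1, ae_ae_of_quasiAdditive hr hq hB] with q h1 h2
    refine le_of_eq_of_le ?_ h1
    have h3 : ∀ᵐ y ∂μ.restrict K, r (.mk (q.out.1 * (a * y), (a * y)⁻¹ * q.out.2)) =
        r q + r (.mk (a * y, (a * y)⁻¹ * (q.out.2 * q.out.1))) := by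
      rw [ae_restrict_iff' hB.measurableSet] at h2
      rw [ae_restrict_iff' hK.measurableSet]
      filter_upwards [(measurePreserving_mul_left μ a).quasiMeasurePreserving.ae h2] with y hy hyK
      rw [← mul_assoc _ q.out.2]
      exact hy (mem_image_of_mem _ hyK)
    refine Eq.symm ((integral_congr_ae h3).trans ?_)
    have h4 : IntegrableOn (fun _ : G => r q) K μ := integrableOn_const hK.measure_lt_top.ne
    rw [integral_add h4 (hint (by fun_prop)), setIntegral_const, smul_eq_mul]
  refine ⟨fun x => h x / c, max (C * c) 0 / c, hh.div_const c, fun x => ?_, ?_⟩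
  · rw [abs_div, abs_of_pos hc0]
    exact div_le_div_of_nonneg_right (hhC x) hc0.le
  · refine (isRadonProduct_prodHaar μ μ).measure_eq_zero (measurableSet_le hr
      (((hh.div_const c).comp (continuous_fst_out.mul continuous_snd_out).measurable).sub
        ((hh.div_const c).comp (continuous_snd_out.mul continuous_fst_out).measurable))).compl
      fun L L' hL hL' => ?_
    -- For $(x,v)\in L\times L'$ the product $vx$ stays in a compact set, where countably many $M_j$
    -- control $h$. Thus countably many instances of `key` suffice to replace $M_j(vx)$ by $h(vx)$.
    have hU : IsCompact (L' * L) := hL'.mul hL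
    obtain ⟨J, hJ, hJh⟩ := hhJ _ hU
    rw [ae_restrict_iff' hU.measurableSet] at hJh
    have h1 := (ae_ball_iff hJ).2 fun j _ => key j
    have h2 : ∀ᵐ q ∂prodHaar μ μ, ¬ (q ∈ {q | r q ≤ h (q.out.1 * q.out.2) / c -
        h (q.out.2 * q.out.1) / c}ᶜ ∩ rect L L') := by
      filter_upwards [h1, ae_comp_mul_swap hJh] with q h1 h2 h3
      refine h3.1 ?_
      have := h2 (mul_mem_mul h3.2.2 h3.2.1) (h (q.out.1 * q.out.2) - c * r q) fun j hj => by
        linarith [h1 j hj]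
      change r q ≤ _
      rw [← sub_div, le_div_iff₀ hc0]
      linarith
    convert! h2 using 1
    change _ ↔ prodHaar μ μ {q | ¬ ¬ _} = 0
    simp only [not_not]
    rfl

/-- A commutator changes sign when its variables are exchanged. Hence the bound for $r$ gives
$r(x,y)+r(y,x)\le0$, and the bound for $-r$ gives the opposite inequality. The bound for
$r(y,x)=-r(x,y)$ is then the missing lower bound for $r(x,y)$, with the same $h$. -/
theorem exists_eq_commutator {r : WithBorel (G × G) → ℝ} (hr : Measurable r) {C : ℝ}
    (hC : ∀ q, |r q| ≤ C)
    (hq : ∀ᵐ t ∂prodHaar μ (prodHaar μ μ), r (.mk (t.out.1 * t.out.2.out.1, t.out.2.out.2)) =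
      r (.mk (t.out.1, t.out.2.out.1 * t.out.2.out.2)) +
        r (.mk (t.out.2.out.1, t.out.2.out.2 * t.out.1))) :
    ∃ (h : G → ℝ) (E : ℝ), Measurable h ∧ (∀ x, |h x| ≤ E) ∧
      ∀ᵐ q ∂prodHaar μ μ, r q = h (q.out.1 * q.out.2) - h (q.out.2 * q.out.1) := by
  have swap : ∀ {s : WithBorel (G × G) → ℝ} (_ : Measurable s) {h : G → ℝ} (_ : Measurable h)
      (_ : ∀ᵐ q ∂prodHaar μ μ, s q ≤ h (q.out.1 * q.out.2) - h (q.out.2 * q.out.1)),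
      ∀ᵐ q ∂prodHaar μ μ, s q + s (.mk (q.out.2, q.out.1)) ≤ 0 := by
    intro s hs h hh h0
    filter_upwards [h0, ae_swap (measurableSet_le hs
      ((hh.comp (continuous_fst_out.mul continuous_snd_out).measurable).sub
        (hh.comp (continuous_snd_out.mul continuous_fst_out).measurable))) h0] with q h1 h2
    have h3 : s (.mk (q.out.2, q.out.1)) ≤ h (q.out.2 * q.out.1) - h (q.out.1 * q.out.2) := h2
    linarith
  obtain ⟨h, E, hh, hE, h0⟩ := exists_le_commutator hr hC hq
  obtain ⟨k, -, hk, -, k0⟩ := exists_le_commutator (μ := μ) hr.neg (C := C)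
    (fun q => (abs_neg _).trans_le (hC q)) (by
      filter_upwards [hq] with t ht
      simp only [Pi.neg_apply]
      rw [ht]; ring)
  refine ⟨h, E, hh, hE, ?_⟩
  filter_upwards [h0, ae_swap (measurableSet_le hr
      ((hh.comp (continuous_fst_out.mul continuous_snd_out).measurable).sub
        (hh.comp (continuous_snd_out.mul continuous_fst_out).measurable))) h0,
    swap hr.neg hk k0] with q h1 h2 h3
  have h4 : r (.mk (q.out.2, q.out.1)) ≤ h (q.out.2 * q.out.1) - h (q.out.1 * q.out.2) := h2
  simp only [Pi.neg_apply] at h3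
  linarith

-- Quasi-additivity is linear over the reals, so the real and imaginary parts are commutators
-- separately.
variable (μ) in
theorem quasiAdditive_const_eq :
    (quasiAdditive (Weight.const G) : Set (LInf₂ (Weight.const G))) =
      innerQuasiAdditive μ (Weight.const G) := by
  refine Subset.antisymm (fun P hP => ?_) innerQuasiAdditive_subset
  obtain ⟨p, hp, hpq, e⟩ := exists_quasiAdditive_kernel ⟨P, hP⟩
  have hb : ∀ q, ‖p q‖ ≤ ‖(⟨P, hP⟩ : quasiAdditive (Weight.const G))‖ := fun q =>
    (hp.bound q.out.1 q.out.2).trans_eq (by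
      change _ * ((1 : ℝ) * 1) = _
      rw [mul_one, mul_one])
  have hq := (IsKernel.ae_triple (μ := μ)).2 hpq.2
  obtain ⟨h, E, hh, hE, h0⟩ := exists_eq_commutator (μ := μ)
    (Complex.measurable_re.comp hp.measurable)
    (fun q => (Complex.abs_re_le_norm _).trans (hb q)) (by
      filter_upwards [hq] with t ht
      exact (congrArg Complex.re ht).trans (Complex.add_re _ _))
  obtain ⟨k, F, hk, hF, k0⟩ := exists_eq_commutator (μ := μ)
    (Complex.measurable_im.comp hp.measurable)
    (fun q => (Complex.abs_im_le_norm _).trans (hb q)) (by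
      filter_upwards [hq] with t ht
      exact (congrArg Complex.im ht).trans (Complex.add_im _ _))
  refine mem_innerQuasiAdditive_iff.2 ⟨fun x => ⟨h x, k x⟩, E + F,
    ?_, fun x => ?_, ?_⟩
  · convert! (Complex.measurable_ofReal.comp hh).add
      ((Complex.measurable_ofReal.comp hk).mul_const Complex.I) using 2 with x
    exact Complex.mk_eq_add_mul_I _ _
  · change _ ≤ (E + F) * 1
    rw [mul_one]
    exact (Complex.norm_le_abs_re_add_abs_im _).trans (add_le_add (hE x) (hF x))
  · rw [ae_prodHaar (m := μ) (n := μ)] at h0 k0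
    filter_upwards [e, h0, k0] with q e1 e2 e3
    exact e1.trans (Complex.ext e2 e3)

/-- Since $\omega(x)\omega(x^{-1})=\omega(e)=1$ and both factors are at least $1$, both equal $1$.
-/
theorem Weight.IsMultiplicative.eq_const {ω : Weight G} (hω : ω.IsMultiplicative) :
    ω = Weight.const G := by
  have h : ∀ x, ω x = 1 := fun x => by
    have h1 := hω x x⁻¹
    rw [mul_inv_cancel, ω.map_one] at h1
    nlinarith [ω.one_le x, ω.one_le x⁻¹]
  cases ω
  simp only [Weight.const, Weight.mk.injEq]
  exact funext h

end Commutator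

end

end Beurling

theorem theorem2p3 {G : Type*} [Group G] [TopologicalSpace G] [IsTopologicalGroup G]
    [LocallyCompactSpace G] [T2Space G] [MeasurableSpace G] [BorelSpace G]
    (μ : MeasureTheory.Measure G) [μ.IsHaarMeasure] [μ.InnerRegular] (ω : Beurling.Weight G) :
    (∃ Γ : Beurling.derivations μ ω ≃ₗᵢ[ℂ] Beurling.quasiAdditive ω,
      (∀ (D : Beurling.derivations μ ω) (f g : Beurling.L1 μ ω),
        Beurling.pair (D.1 f) g = ∫ y, ∫ x, (Γ D).1 (.mk (x, y)) * f x * g y ∂μ ∂μ) ∧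
      (∀ (D : Beurling.derivations μ ω) (p : Beurling.quasiAdditive ω),
        (∀ f g : Beurling.L1 μ ω,
          Beurling.pair (D.1 f) g = ∫ y, ∫ x, p.1 (.mk (x, y)) * f x * g y ∂μ ∂μ) → p = Γ D) ∧
      (fun D => (Γ D).1) '' {D | Beurling.IsInner D.1} = Beurling.innerQuasiAdditive μ ω) ∧
    CompleteSpace (Beurling.quasiAdditive ω) ∧
    (∀ D : Beurling.derivations μ ω, ∃! p : Beurling.quasiAdditive ω, ∀ f : Beurling.L1 μ ω,
      ∀ᵐ x ∂μ, D.1 f x = ∫ y, p.1 (.mk (y, x)) * f y ∂μ) ∧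
    (ω.IsMultiplicative →
      (Beurling.quasiAdditive ω : Set (Beurling.LInf₂ ω)) = Beurling.innerQuasiAdditive μ ω) ∧
    (Beurling.quasiAdditive (Beurling.Weight.const G) :
        Set (Beurling.LInf₂ (Beurling.Weight.const G))) =
      Beurling.innerQuasiAdditive μ (Beurling.Weight.const G) := by
  obtain ⟨Γ, hΓ⟩ := Beurling.exists_isometry μ ω
  refine ⟨⟨Γ, hΓ, fun D p hp => Subtype.ext <| Beurling.eq_of_forms_eq μ fun f g => ?_,
    Beurling.image_inner hΓ⟩, ?_, fun D => ⟨Γ D, ?_, fun p hp => ?_⟩, fun hω => ?_,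
    Beurling.quasiAdditive_const_eq μ⟩
  · rw [← hp f g, hΓ D f g]
  · have := Beurling.completeSpace_derivations (μ := μ) (ω := ω)
    exact Γ.symm.toIsometryEquiv.completeSpace
  · exact Beurling.ae_eq_integral_of_forms (hΓ D)
  · refine Subtype.ext <| Beurling.eq_of_forms_eq μ fun f g => ?_
    rw [← Beurling.forms_of_ae_eq_integral (hp f) g, hΓ D f g]
  · rw [hω.eq_const]
    exact Beurling.quasiAdditive_const_eq μ
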